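/- **Setting.** Let $\mathfrak g$ be a finite-dimensional simple complex Lie algebra, $G$ a connected (linear) algebraic group over $\mathbf C$ with Lie algebra $\mathfrak g$, and $(\cdot\mid\cdot)$ a nondegenerate symmetric invariant bilinear form on $\mathfrak g$. The dual $\mathfrak g^*$ carries the coadjoint actions $\mathrm{ad}^*$ of $\mathfrak g$ and $\mathrm{Ad}^*$ of $G$, and the Kirillov–Kostant bracket $\{F,H\}(\xi)=\xi([d_\xi F,d_\xi H])$ on $\mathbf C[\mathfrak g^*]$. For $i=1,2$ let $f_i\in\mathfrak g$ be nilpotent, $\chi_i=(f_i\mid\cdot)\in\mathfrak g^*$, and let $\mathfrak g=\bigoplus_{j\in\mathbf Z}\mathfrak g^{(i)}_j$ be a good grading for $f_i$, i.e. a Lie algebra grading with $f_i\in\mathfrak g^{(i)}_{-2}$ such that $\mathrm{ad}(f_i):\mathfrak g^{(i)}_j\to\mathfrak g^{(i)}_{j-2}$ is injective for $j\ge1$ and surjective for $j\le1$. Let $q_i\in\mathfrak g$ be the semisimple element with $\mathfrak g^{(i)}_j=\{x:[q_i,x]=jx\}$ for all $j$, and assume that $q_1,q_2$ lie in a common Cartan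 subalgebra $\mathfrak h$. Choose a Lagrangian subspace $\mathfrak l_i$ of $\mathfrak g^{(i)}_1$ for the symplectic form $\chi_i([\cdot,\cdot])$ and put $\mathfrak m_i=\mathfrak l_i\oplus\bigoplus_{j\ge2}\mathfrak g^{(i)}_j$, a Lie subalgebra of $\mathfrak g$. Let $(e_2,h_2,f_2)$ satisfy $[h_2,e_2]=2e_2$, $[h_2,f_2]=-2f_2$, $[e_2,f_2]=h_2$ with $h_2\in\mathfrak g^{(2)}_0$, $e_2\in\mathfrak g^{(2)}_2$, and let $S_2=\chi_2+\mathrm{Ker}\,\mathrm{ad}^*(e_2)$ be the Slodowy slice of $f_2$. **Assumptions.** 1. $\mathfrak m_2=\mathfrak m_1\oplus\mathfrak m_0$, where $\mathfrak m_1$ is an ideal of $\mathfrak m_2$ and $\mathfrak m_0$ is an $\mathfrak h$-stable Lie subalgebra of $\mathfrak m_2$; 2. $f_0:=f_2-f_1\in\mathfrak g^{(1)}_0$ and $\mathfrak m_0\subseteq\mathfrak g^{(1)}_0$; 3. $[q_2-q_1,f_1]=0$. Let $M_1$ and $M_0$ be the connected unipotent subgroups of $G$ with Lie algebras $\mathfrak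 m_1$ and $\mathfrak m_0$, let $\mu_1:\mathfrak g^*\to\mathfrak m_1^*$, $\xi\mapsto(\xi-\chi_1)|_{\mathfrak m_1}$, and let $\mu_1^{-1}(0)/M_1$ be the quotient for the coadjoint action, with the ring of functions $\mathbf C[\mu_1^{-1}(0)]^{M_1}$. **Theorem.** (a) For every $\mathfrak{sl}_2$-triple $(e_1,h_1,f_1)$ with $h_1\in\mathfrak g^{(1)}_0$ and $e_1\in\mathfrak g^{(1)}_2$ (the zero triple if $f_1=0$), the Slodowy slice $S_{f_1}=\chi_1+\mathrm{Ker}\,\mathrm{ad}^*(e_1)$ is contained in $\mu_1^{-1}(0)$ and $\xi\mapsto[\xi]$ is an isomorphism of varieties $S_{f_1}\cong\mu_1^{-1}(0)/M_1$. The bracket of $\mathbf C[\mathfrak g^*]$ induces a Poisson bracket on the functions on $\mu_1^{-1}(0)/M_1$, computed with arbitrary polynomial lifts. (b) The formula $g\cdot[\xi]=[\mathrm{Ad}^*(g)\xi]$ defines an algebraic action of $M_0$ on $\mu_1^{-1}(0)/M_1$. It is Hamiltonian with moment map $$\mu_0:\mu_1^{-1}(0)/M_1\to\mathfrak m_0^*,\qquad[\xi]\mapsto(\xi-\chi_2)|_{\mathfrak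 m_0},$$ that is: $M_0$ acts by Poisson automorphisms, $\mu_0$ is a well-defined $M_0$-equivariant morphism of varieties, its comap $\mathbf C[\mathfrak m_0^*]\to\mathbf C[\mu_1^{-1}(0)/M_1]$ respects the Poisson brackets, and for $x\in\mathfrak m_0$ and every regular function $F$ one has $\{\mu_0^*x,F\}(p)=\frac{d}{dt}\big|_{t=0}F(\exp(-tx)\cdot p)$. (c) The action is free on $\mu_0^{-1}(0)$ in the following sense: the map $M_0\times S_2\to\mu_0^{-1}(0)$, $(g,\xi)\mapsto g\cdot[\xi]$, is a well-defined $M_0$-equivariant isomorphism of varieties, where $M_0$ acts on $M_0\times S_2$ by left multiplication on the first factor. -/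

import Mathlib

/-!
Affine varieties are represented by their points together with their algebra of regular functions,
a subalgebra of the algebra of all complex functions on the set of points. A morphism is a map that
pulls regular functions back to regular functions.
-/

noncomputable section

namespace SlodowyStages

open Module

section Varieties

/-- Polynomial functions on a finite-dimensional complex vector space: the algebra generated by the
linear forms. -/
def polyFun (E : Type*) [AddCommGroup E] [Module ℂ E] : Subalgebra ℂ (E → ℂ) :=
  Algebra.adjoin ℂ (Set.range fun (l : Dual ℂ E) (x : E) => l x)

/-- Pullback of functions along a map. -/
def pullback {X Y : Type*} (f : X → Y) : (Y → ℂ) →ₐ[ℂ] (X → ℂ) where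
  toFun F := F ∘ f
  map_one' := rfl
  map_mul' _ _ := rfl
  map_zero' := rfl
  map_add' _ _ := rfl
  commutes' _ := rfl

/-- Regular functions on a closed subset: restrictions of the regular functions. -/
def regSub {X : Type*} (A : Subalgebra ℂ (X → ℂ)) (s : Set X) : Subalgebra ℂ (s → ℂ) :=
  A.map (pullback (Subtype.val : s → X))

/-- Regular functions on a product of affine varieties. -/
def regProd {X Y : Type*} (A : Subalgebra ℂ (X → ℂ)) (B : Subalgebra ℂ (Y → ℂ)) :
    Subalgebra ℂ (X × Y → ℂ) :=
  A.map (pullback Prod.fst) ⊔ B.map (pullback Prod.snd)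

/-- Regular functions on a quotient: the functions whose pullback is regular, i.e. the invariant
regular functions. -/
def regQuot {X : Type*} (A : Subalgebra ℂ (X → ℂ)) (r : Setoid X) :
    Subalgebra ℂ (Quotient r → ℂ) :=
  A.comap (pullback (Quotient.mk r))

/-- Morphisms of varieties. -/
def IsMorphism {X Y : Type*} (A : Subalgebra ℂ (X → ℂ)) (B : Subalgebra ℂ (Y → ℂ))
    (f : X → Y) : Prop :=
  ∀ F ∈ B, F ∘ f ∈ A

/-- Isomorphisms of varieties. -/
def IsIsomorphism {X Y : Type*} (A : Subalgebra ℂ (X → ℂ)) (B : Subalgebra ℂ (Y → ℂ))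
    (f : X ≃ Y) : Prop :=
  IsMorphism A B f ∧ IsMorphism B A f.symm

theorem polyFun_comp {E E' : Type*} [AddCommGroup E] [Module ℂ E] [AddCommGroup E'] [Module ℂ E']
    (L : E →ₗ[ℂ] E') {p : E' → ℂ} (hp : p ∈ polyFun E') : p ∘ L ∈ polyFun E := by
  have h : polyFun E' ≤ (polyFun E).comap (pullback L) := by
    refine Algebra.adjoin_le ?_
    rintro _ ⟨l, rfl⟩
    exact Algebra.subset_adjoin ⟨l.comp L, rfl⟩
  exact h hp

end Varieties

section Poisson

/-- A Poisson bracket on a commutative complex algebra. -/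
structure PoissonBracket (A : Type*) [CommRing A] [Algebra ℂ A] where
  bracket : A →ₗ[ℂ] A →ₗ[ℂ] A
  self : ∀ a, bracket a a = 0
  jacobi : ∀ a b c,
    bracket a (bracket b c) = bracket (bracket a b) c + bracket b (bracket a c)
  leibniz : ∀ a b c, bracket a (b * c) = bracket a b * c + b * bracket a c

variable {L : Type*} [LieRing L] [LieAlgebra ℂ L] [FiniteDimensional ℂ L]

/-- The differential at `ξ` of a polynomial function on `L*`, as an element of `L = L**`. -/
def dualGradient (F : Dual ℂ L → ℂ) (ξ : Dual ℂ L) : L :=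
  ∑ i, lineDeriv ℂ F ξ ((finBasis ℂ L).coord i) • finBasis ℂ L i

/-- The Kirillov-Kostant bracket `{F, H}(ξ) = ξ([d_ξ F, d_ξ H])` of polynomial functions on `L*`. -/
def kkBracket (F H : Dual ℂ L → ℂ) (ξ : Dual ℂ L) : ℂ :=
  ξ ⁅dualGradient F ξ, dualGradient H ξ⁆

end Poisson

section AlgebraicGroups

variable {g : Type*} [LieRing g] [LieAlgebra ℂ g] {V : Type*} [AddCommGroup V] [Module ℂ V]

/-- The subgroup `H` of `GL(V)` is Zariski closed. -/
def IsZariskiClosed (H : Subgroup (LinearMap.GeneralLinearGroup ℂ V)) : Prop :=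
  ∃ S : Set (End ℂ V → ℂ), S ⊆ polyFun (End ℂ V) ∧
    ∀ u : LinearMap.GeneralLinearGroup ℂ V, u ∈ H ↔ ∀ p ∈ S, p u = 0

/-- Regular functions on a Zariski closed subgroup of `GL(V)`: polynomials in the entries of `u`
and of `u⁻¹`. -/
def regGroup (H : Subgroup (LinearMap.GeneralLinearGroup ℂ V)) : Subalgebra ℂ (H → ℂ) :=
  Algebra.adjoin ℂ
    ((Set.range fun (l : Dual ℂ (End ℂ V)) (u : H) => l (u : LinearMap.GeneralLinearGroup ℂ V)) ∪
     (Set.range fun (l : Dual ℂ (End ℂ V)) (u : H) =>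
        l ((u⁻¹ : H) : LinearMap.GeneralLinearGroup ℂ V)))

/-- Connectedness in the Zariski topology: the only idempotent regular functions are `0` and
`1`. -/
def IsZariskiConnected (H : Subgroup (LinearMap.GeneralLinearGroup ℂ V)) : Prop :=
  ∀ p ∈ regGroup H, p * p = p → p = 0 ∨ p = 1

/-- The Lie algebra of a closed subgroup of `GL(V)`, as a subset of `gl(V)`: the tangent space at
the identity. -/
def tangentSpace (H : Subgroup (LinearMap.GeneralLinearGroup ℂ V)) : Set (End ℂ V) :=
  {X | ∀ p ∈ polyFun (End ℂ V),
    (∀ u : LinearMap.GeneralLinearGroup ℂ V, u ∈ H → p u = 0) → lineDeriv ℂ p 1 X = 0}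

/-- Conjugation by `u` on `gl(V)`. -/
def conj (u : LinearMap.GeneralLinearGroup ℂ V) : End ℂ V →ₗ[ℂ] End ℂ V :=
  LinearMap.mulLeft ℂ (u : End ℂ V) ∘ₗ LinearMap.mulRight ℂ ((u⁻¹ : (End ℂ V)ˣ) : End ℂ V)

theorem conj_apply (u : LinearMap.GeneralLinearGroup ℂ V) (X : End ℂ V) :
    conj u X = (u : End ℂ V) * (X * ((u⁻¹ : (End ℂ V)ˣ) : End ℂ V)) := rfl

theorem conj_mem_tangentSpace {H : Subgroup (LinearMap.GeneralLinearGroup ℂ V)}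
    {u : LinearMap.GeneralLinearGroup ℂ V} (hu : u ∈ H) {X : End ℂ V} (hX : X ∈ tangentSpace H) :
    conj u X ∈ tangentSpace H := by
  intro p hp hpH
  have h := hX (p ∘ conj u) (polyFun_comp _ hp) (fun v hv => by
    have := hpH (u * v * u⁻¹) (H.mul_mem (H.mul_mem hu hv) (H.inv_mem hu))
    simpa [conj_apply, mul_assoc] using this)
  rw [← h]
  have h1 : conj u 1 = 1 := by simp [conj_apply]
  simp only [lineDeriv, Function.comp, map_add, map_smul, h1]

/-- The polynomial `1 + N + N²/2! + ...` up to degree `dim V`; this is the exponential of `N` when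
`N` is nilpotent. -/
def nilExp (N : End ℂ V) : End ℂ V :=
  ∑ k ∈ Finset.range (finrank ℂ V + 1), ((k.factorial : ℂ)⁻¹) • N ^ k

variable (g V) in
/-- A connected linear algebraic group `G ⊆ GL(V)` together with an identification of `g` with its
Lie algebra. -/
structure ConnectedAlgebraicGroup where
  carrier : Subgroup (LinearMap.GeneralLinearGroup ℂ V)
  closed : IsZariskiClosed carrier
  connected : IsZariskiConnected carrier
  lieMap : g →ₗ[ℂ] End ℂ V
  lieMap_lie : ∀ x y, lieMap ⁅x, y⁆ = lieMap x * lieMap y - lieMap y * lieMap x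
  lieMap_injective : Function.Injective lieMap
  range_lieMap : Set.range lieMap = tangentSpace carrier

end AlgebraicGroups

namespace ConnectedAlgebraicGroup

variable {g V : Type*} [LieRing g] [LieAlgebra ℂ g] [AddCommGroup V] [Module ℂ V]
variable (G : ConnectedAlgebraicGroup g V)

theorem conj_mem_range (u : G.carrier) (x : g) :
    ∃ y : g, G.lieMap y = conj (u : LinearMap.GeneralLinearGroup ℂ V) (G.lieMap x) := by
  have h : G.lieMap x ∈ tangentSpace G.carrier := G.range_lieMap ▸ Set.mem_range_self x
  have h' := conj_mem_tangentSpace u.2 h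
  rwa [← G.range_lieMap] at h'

/-- The element `Ad(u) x` of `g`: the one corresponding to `u x u⁻¹` in `gl(V)`. -/
def adFun (u : G.carrier) (x : g) : g := (G.conj_mem_range u x).choose

theorem lieMap_adFun (u : G.carrier) (x : g) :
    G.lieMap (G.adFun u x) = conj (u : LinearMap.GeneralLinearGroup ℂ V) (G.lieMap x) :=
  (G.conj_mem_range u x).choose_spec

/-- The adjoint action of `G` on `g`. -/
def Ad : Representation ℂ G.carrier g where
  toFun u :=
    { toFun := G.adFun u
      map_add' := fun x y => G.lieMap_injective (by simp only [lieMap_adFun, map_add])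
      map_smul' := fun c x => G.lieMap_injective (by
        simp only [lieMap_adFun, map_smul, RingHom.id_apply]) }
  map_one' := by
    ext x
    apply G.lieMap_injective
    simp [lieMap_adFun, conj_apply]
  map_mul' u v := by
    ext x
    apply G.lieMap_injective
    simp [lieMap_adFun, conj_apply, mul_assoc]

theorem lieMap_Ad (u : G.carrier) (x : g) :
    G.lieMap (G.Ad u x) = (u : LinearMap.GeneralLinearGroup ℂ V).val * G.lieMap x *
      ((u : LinearMap.GeneralLinearGroup ℂ V)⁻¹).val := by
  rw [mul_assoc]
  exact G.lieMap_adFun u x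

/-- The coadjoint action `Ad*(u) ξ = ξ ∘ Ad(u⁻¹)` of `G` on `g*`. -/
def coAd : Representation ℂ G.carrier (Dual ℂ g) := G.Ad.dual

/-- A subgroup of `G`, viewed in `GL(V)`. -/
def toGL (M : Subgroup G.carrier) : Subgroup (LinearMap.GeneralLinearGroup ℂ V) :=
  M.map G.carrier.subtype

/-- `M` is the connected unipotent (closed) subgroup of `G` with Lie algebra `m`. -/
structure IsUnipotentSubgroup (M : Subgroup G.carrier) (m : LieSubalgebra ℂ g) : Prop where
  closed : IsZariskiClosed (G.toGL M)
  connected : IsZariskiConnected (G.toGL M)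
  unipotent : ∀ u ∈ M, IsNilpotent ((u : LinearMap.GeneralLinearGroup ℂ V).val - 1)
  lie : tangentSpace (G.toGL M) = G.lieMap '' (m : Set g)

/-- Regular functions on a closed subgroup of `G`. -/
def regSubgroup (M : Subgroup G.carrier) : Subalgebra ℂ (M → ℂ) :=
  (regGroup (G.toGL M)).map
    (pullback fun u : M => (⟨u.1.1, Subgroup.mem_map_of_mem _ u.2⟩ : G.toGL M))

/-- Two points of `X ⊆ g*` are equivalent when they are in the same `M`-orbit for the coadjoint
action. -/
def orbitSetoid (M : Subgroup G.carrier) (X : Set (Dual ℂ g)) : Setoid X where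
  r ξ η := ∃ u : M, G.coAd (u : G.carrier) (ξ : Dual ℂ g) = η
  iseqv :=
    { refl := fun ξ => ⟨1, by simp⟩
      symm := by
        rintro ξ η ⟨u, hu⟩
        refine ⟨u⁻¹, ?_⟩
        rw [← hu, ← Module.End.mul_apply, ← map_mul]
        simp
      trans := by
        rintro ξ η ζ ⟨u, hu⟩ ⟨v, hv⟩
        refine ⟨v * u, ?_⟩
        rw [← hv, ← hu, ← Module.End.mul_apply, ← map_mul]
        rfl }

end ConnectedAlgebraicGroup

section GoodGradings

variable {g : Type*} [LieRing g] [LieAlgebra ℂ g]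

/-- `Γ` is a good `ℤ`-grading of `g` for `f`. -/
structure IsGoodGrading (Γ : ℤ → Submodule ℂ g) (f : g) : Prop where
  internal : DirectSum.IsInternal Γ
  lie_mem : ∀ i j, ∀ x ∈ Γ i, ∀ y ∈ Γ j, ⁅x, y⁆ ∈ Γ (i + j)
  mem : f ∈ Γ (-2)
  injective : ∀ j, 1 ≤ j → ∀ x ∈ Γ j, ⁅f, x⁆ = 0 → x = 0
  surjective : ∀ j, j ≤ 1 → ∀ y ∈ Γ (j - 2), ∃ x ∈ Γ j, ⁅f, x⁆ = y

/-- `Γ` is the eigenspace decomposition of `ad q`. -/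
def IsGradingElement (Γ : ℤ → Submodule ℂ g) (q : g) : Prop :=
  ∀ i x, x ∈ Γ i ↔ ⁅q, x⁆ = (i : ℂ) • x

/-- `(e, h, f)` is an `sl₂`-triple (possibly zero, when `f = 0`) with `h` of degree `0` and `e` of
degree `2`. -/
structure IsGradedTriple (Γ : ℤ → Submodule ℂ g) (e h f : g) : Prop where
  lie_h_e : ⁅h, e⁆ = (2 : ℂ) • e
  lie_h_f : ⁅h, f⁆ = -((2 : ℂ) • f)
  lie_e_f : ⁅e, f⁆ = h
  h_mem : h ∈ Γ 0
  e_mem : e ∈ Γ 2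

/-- `l` is a Lagrangian subspace of the degree `1` part for the form `χ([·, ·])`. -/
def IsLagrangian (Γ : ℤ → Submodule ℂ g) (χ : Dual ℂ g) (l : Submodule ℂ g) : Prop :=
  ∀ x, x ∈ l ↔ x ∈ Γ 1 ∧ ∀ y ∈ l, χ ⁅x, y⁆ = 0

/-- `m` is a good algebra: the sum of a Lagrangian subspace of the degree `1` part and of the parts
of degree at least `2`. -/
def IsGoodAlgebra (Γ : ℤ → Submodule ℂ g) (χ : Dual ℂ g) (m : LieSubalgebra ℂ g) : Prop :=
  ∃ l : Submodule ℂ g, IsLagrangian Γ χ l ∧ m.toSubmodule = l ⊔ ⨆ i : {i : ℤ // 2 ≤ i}, Γ i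

/-- The Slodowy slice `χ + Ker ad*(e)`. -/
def slice (χ : Dual ℂ g) (e : g) : Set (Dual ℂ g) := {ξ | ⁅e, ξ - χ⁆ = 0}

/-- The twisted restriction `ξ ↦ (ξ - χ)|_m`. -/
def twistedRestriction (χ : Dual ℂ g) (m : LieSubalgebra ℂ g) (ξ : Dual ℂ g) : Dual ℂ m :=
  (ξ - χ).comp m.toSubmodule.subtype

/-- The zero fibre of the twisted restriction. -/
def zeroFibre (χ : Dual ℂ g) (m : LieSubalgebra ℂ g) : Set (Dual ℂ g) :=
  twistedRestriction χ m ⁻¹' {0}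

end GoodGradings

section Reduction

variable {g V : Type*} [LieRing g] [LieAlgebra ℂ g] [FiniteDimensional ℂ g]
  [AddCommGroup V] [Module ℂ V] (G : ConnectedAlgebraicGroup g V)

/-- The quotient `μ⁻¹(0) / M`, where `μ(ξ) = (ξ - χ)|_m`. -/
abbrev Reduced (χ : Dual ℂ g) (m : LieSubalgebra ℂ g) (M : Subgroup G.carrier) :=
  Quotient (G.orbitSetoid M (zeroFibre χ m))

/-- The class in `μ⁻¹(0) / M` of a point of `μ⁻¹(0)`. -/
def cls (χ : Dual ℂ g) (m : LieSubalgebra ℂ g) (M : Subgroup G.carrier) (ξ : zeroFibre χ m) :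
    Reduced G χ m M :=
  Quotient.mk (G.orbitSetoid M (zeroFibre χ m)) ξ

/-- Regular functions on `μ⁻¹(0) / M`. -/
def regReduced (χ : Dual ℂ g) (m : LieSubalgebra ℂ g) (M : Subgroup G.carrier) :
    Subalgebra ℂ (Reduced G χ m M → ℂ) :=
  regQuot (regSub (polyFun (Dual ℂ g)) (zeroFibre χ m)) _

/-- The Poisson bracket `P` on `μ⁻¹(0) / M` is induced by the bracket of `g*`: it is computed with
arbitrary polynomial lifts. -/
def IsReducedBracket (χ : Dual ℂ g) (m : LieSubalgebra ℂ g) (M : Subgroup G.carrier)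
    (P : PoissonBracket (regReduced G χ m M)) : Prop :=
  ∀ F H : regReduced G χ m M, ∀ F' ∈ polyFun (Dual ℂ g), ∀ H' ∈ polyFun (Dual ℂ g),
    (∀ ξ : zeroFibre χ m, F' ξ = (F : Reduced G χ m M → ℂ) (cls G χ m M ξ)) →
    (∀ ξ : zeroFibre χ m, H' ξ = (H : Reduced G χ m M → ℂ) (cls G χ m M ξ)) →
    ∀ ξ : zeroFibre χ m,
      (P.bracket F H : Reduced G χ m M → ℂ) (cls G χ m M ξ) = kkBracket F' H' ξ

variable {Q : Type*}

/-- The action of `M` on the variety `Q` is algebraic. -/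
def IsAlgebraicAction (A : Subalgebra ℂ (Q → ℂ)) (M : Subgroup G.carrier) [MulAction M Q] : Prop :=
  IsMorphism (regProd (G.regSubgroup M) A) A fun x : M × Q => x.1 • x.2

/-- The algebraic action of `M`, with Lie algebra `m`, on the Poisson variety `Q` is Hamiltonian
with moment map `μ`. -/
structure IsHamiltonian (A : Subalgebra ℂ (Q → ℂ)) (P : PoissonBracket A) (M : Subgroup G.carrier)
    (m : LieSubalgebra ℂ g) [MulAction M Q] (μ : Q → Dual ℂ m) : Prop where
  /-- The group acts by Poisson automorphisms. -/
  poisson : ∀ (u : M) (F H F' H' : A), (∀ p, (F' : Q → ℂ) p = (F : Q → ℂ) (u • p)) →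
    (∀ p, (H' : Q → ℂ) p = (H : Q → ℂ) (u • p)) →
    ∀ p, (P.bracket F' H' : Q → ℂ) p = (P.bracket F H : Q → ℂ) (u • p)
  /-- The moment map is a morphism of varieties. -/
  morphism : IsMorphism A (polyFun (Dual ℂ m)) μ
  /-- The moment map is equivariant for the coadjoint action on `m*`. -/
  equivariant : ∀ (u : M) (y : m), ∃ y' : m, (y' : g) = G.Ad (u : G.carrier)⁻¹ y ∧
    ∀ p, μ (u • p) y = μ p y'
  /-- The comap of the moment map is compatible with the brackets. -/
  comap_bracket : ∀ F ∈ polyFun (Dual ℂ m), ∀ H ∈ polyFun (Dual ℂ m), ∀ F' H' : A,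
    (F' : Q → ℂ) = F ∘ μ → (H' : Q → ℂ) = H ∘ μ →
    (P.bracket F' H' : Q → ℂ) = kkBracket F H ∘ μ
  /-- The derivative of the action along `x ∈ m` is the Hamiltonian vector field of the function
  `p ↦ μ(p)(x)`. -/
  infinitesimal : ∀ x : m, ∃ γ : ℂ → M,
    (∀ t, ((γ t : G.carrier) : LinearMap.GeneralLinearGroup ℂ V).val
      = nilExp (t • G.lieMap (x : g))) ∧
    ∀ F X : A, (∀ p, (X : Q → ℂ) p = μ p x) →
      ∀ p, HasDerivAt (fun t => (F : Q → ℂ) (γ (-t) • p)) ((P.bracket X F : Q → ℂ) p) 0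

end Reduction

end SlodowyStages

end

/-!
Everything rests on one retraction argument. If `f` has degree `-2` and `a`, `b`, `C` are graded
subspaces with `a`, `b` in positive degrees, the map `(x, y, s) ↦ exp(ad x) exp(ad y) (f + s) - f`
agrees with the linear map `(x, y, s) ↦ [x, f] + [y, f] + s` up to terms of strictly smaller
triangular order with respect to the grading. So it is invertible with a polynomial inverse as soon
as the linear map is injective. With `(a, b) = (m₁, 0)` this is the isomorphism between the slice of
`f₁` and `μ₁⁻¹(0)/M₁`; with `(a, b) = (m₁, m₀)` in the grading of `f₂` it factors every point of
`μ₁⁻¹(0) ∩ {ξ | ξ = χ₂ on m₀}` uniquely as `Ad*(v) Ad*(u) η` with `v ∈ M₁`, `u ∈ M₀` and `η` in the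
slice of `f₂`, and discarding `v` gives the isomorphism of part (c). The second case needs `m₁` and
`m₀` to be graded for the grading of `f₂`: since `q₁` and `q₂` commute, `ad q₂` preserves the
degrees of the first grading, hence also `m₁` and `m₀`, the parts of `m₂` of positive and of zero
degree.
The Poisson structure and the Hamiltonian property follow from the invariance of the
Kirillov–Kostant bracket and from `m₁` being an ideal.
-/

noncomputable section

namespace SlodowyStages

open Module

/-! ### Morphisms to vector spaces -/

section PolynomialMaps

variable {X Y : Type*} {A : Subalgebra ℂ (X → ℂ)}
variable {E E' E'' : Type*} [AddCommGroup E] [Module ℂ E] [AddCommGroup E'] [Module ℂ E']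
  [AddCommGroup E''] [Module ℂ E'']

theorem dual_mem_polyFun (l : Dual ℂ E) : (fun x => l x) ∈ polyFun E :=
  Algebra.subset_adjoin ⟨l, rfl⟩

theorem const_mem (A : Subalgebra ℂ (X → ℂ)) (c : ℂ) : (fun _ => c) ∈ A :=
  A.algebraMap_mem c

theorem isMorphism_iff_dual {φ : X → E} :
    IsMorphism A (polyFun E) φ ↔ ∀ l : Dual ℂ E, (fun x => l (φ x)) ∈ A := by
  refine ⟨fun h l => h _ (dual_mem_polyFun l), fun h => ?_⟩
  have : polyFun E ≤ A.comap (pullback φ) := by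
    refine Algebra.adjoin_le ?_
    rintro _ ⟨l, rfl⟩
    exact h l
  exact fun F hF => this hF

theorem IsMorphism.comp {Z : Type*} {B : Subalgebra ℂ (Y → ℂ)} {C : Subalgebra ℂ (Z → ℂ)}
    {ψ : Y → Z} {φ : X → Y} (hψ : IsMorphism B C ψ) (hφ : IsMorphism A B φ) :
    IsMorphism A C (fun x => ψ (φ x)) :=
  fun F hF => hφ _ (hψ F hF)

theorem isMorphism_id : IsMorphism A A (fun x => x) := fun _ hF => hF

theorem isMorphism_const (c : E) : IsMorphism A (polyFun E) (fun _ => c) :=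
  isMorphism_iff_dual.2 fun l => const_mem A (l c)

theorem IsMorphism.add {φ ψ : X → E} (hφ : IsMorphism A (polyFun E) φ)
    (hψ : IsMorphism A (polyFun E) ψ) : IsMorphism A (polyFun E) (fun x => φ x + ψ x) :=
  isMorphism_iff_dual.2 fun l => by
    simpa only [map_add] using!
      A.add_mem (isMorphism_iff_dual.1 hφ l) (isMorphism_iff_dual.1 hψ l)

theorem IsMorphism.linear {φ : X → E} (L : E →ₗ[ℂ] E') (hφ : IsMorphism A (polyFun E) φ) :
    IsMorphism A (polyFun E') (fun x => L (φ x)) :=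
  isMorphism_iff_dual.2 fun l => isMorphism_iff_dual.1 hφ (l.comp L)

theorem isMorphism_linear (L : E →ₗ[ℂ] E') : IsMorphism (polyFun E) (polyFun E') (fun x => L x) :=
  isMorphism_id.linear L

theorem IsMorphism.const_smul {φ : X → E} (c : ℂ) (hφ : IsMorphism A (polyFun E) φ) :
    IsMorphism A (polyFun E) (fun x => c • φ x) :=
  hφ.linear (c • LinearMap.id)

theorem IsMorphism.neg {φ : X → E} (hφ : IsMorphism A (polyFun E) φ) :
    IsMorphism A (polyFun E) (fun x => -φ x) :=
  hφ.linear (-LinearMap.id)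

theorem IsMorphism.sub {φ ψ : X → E} (hφ : IsMorphism A (polyFun E) φ)
    (hψ : IsMorphism A (polyFun E) ψ) : IsMorphism A (polyFun E) (fun x => φ x - ψ x) := by
  simpa only [sub_eq_add_neg] using hφ.add hψ.neg

theorem IsMorphism.sum {ι : Type*} (s : Finset ι) {φ : ι → X → E}
    (hφ : ∀ i ∈ s, IsMorphism A (polyFun E) (φ i)) :
    IsMorphism A (polyFun E) (fun x => ∑ i ∈ s, φ i x) := by
  classical
  induction s using Finset.induction_on with
  | empty => simpa using isMorphism_const (0 : E)
  | insert i s hi ih =>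
    simp only [Finset.sum_insert hi]
    exact (hφ i (Finset.mem_insert_self i s)).add
      (ih fun j hj => hφ j (Finset.mem_insert_of_mem hj))

theorem IsMorphism.bilinear [FiniteDimensional ℂ E] {φ : X → E} {ψ : X → E'}
    (L : E →ₗ[ℂ] E' →ₗ[ℂ] E'') (hφ : IsMorphism A (polyFun E) φ)
    (hψ : IsMorphism A (polyFun E') ψ) : IsMorphism A (polyFun E'') (fun x => L (φ x) (ψ x)) := by
  refine isMorphism_iff_dual.2 fun l => ?_
  have h : (fun x => l (L (φ x) (ψ x))) =
      ∑ i, (fun x => (finBasis ℂ E).coord i (φ x)) * fun x => l (L (finBasis ℂ E i) (ψ x)) := by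
    funext x
    have := congrArg (fun z => l (L z (ψ x))) ((finBasis ℂ E).sum_repr (φ x))
    simp only [map_sum, map_smul, LinearMap.sum_apply, LinearMap.smul_apply, smul_eq_mul] at this
    simp [this]
  rw [h]
  exact A.sum_mem fun i _ => A.mul_mem (isMorphism_iff_dual.1 hφ _)
    (isMorphism_iff_dual.1 hψ (l.comp (L (finBasis ℂ E i))))

theorem IsMorphism.smul {c : X → ℂ} {φ : X → E} (hc : c ∈ A) (hφ : IsMorphism A (polyFun E) φ) :
    IsMorphism A (polyFun E) (fun x => c x • φ x) :=
  isMorphism_iff_dual.2 fun l => by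
    simpa only [map_smul] using! A.mul_mem hc (isMorphism_iff_dual.1 hφ l)

theorem IsMorphism.mul [FiniteDimensional ℂ E] {φ ψ : X → End ℂ E}
    (hφ : IsMorphism A (polyFun (End ℂ E)) φ) (hψ : IsMorphism A (polyFun (End ℂ E)) ψ) :
    IsMorphism A (polyFun (End ℂ E)) (fun x => φ x * ψ x) :=
  hφ.bilinear (LinearMap.mul ℂ (End ℂ E)) hψ

theorem IsMorphism.pow [FiniteDimensional ℂ E] {φ : X → End ℂ E}
    (hφ : IsMorphism A (polyFun (End ℂ E)) φ) (n : ℕ) :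
    IsMorphism A (polyFun (End ℂ E)) (fun x => φ x ^ n) := by
  induction n with
  | zero => simpa using isMorphism_const (1 : End ℂ E)
  | succ n ih => simpa only [pow_succ] using ih.mul hφ

theorem IsMorphism.apply [FiniteDimensional ℂ E] {φ : X → End ℂ E} {ψ : X → E}
    (hφ : IsMorphism A (polyFun (End ℂ E)) φ) (hψ : IsMorphism A (polyFun E) ψ) :
    IsMorphism A (polyFun E) (fun x => φ x (ψ x)) :=
  hφ.bilinear LinearMap.id hψ

theorem IsMorphism.nilExp [FiniteDimensional ℂ E] {φ : X → End ℂ E}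
    (hφ : IsMorphism A (polyFun (End ℂ E)) φ) :
    IsMorphism A (polyFun (End ℂ E)) (fun x => nilExp (φ x)) :=
  IsMorphism.sum _ fun k _ => (hφ.pow k).const_smul _

theorem IsMorphism.restrict {φ : X → Y} {B : Subalgebra ℂ (Y → ℂ)} (hφ : IsMorphism A B φ)
    (s : Set X) : IsMorphism (regSub A s) B (fun x => φ x) :=
  fun F hF => ⟨F ∘ φ, hφ F hF, rfl⟩

theorem IsMorphism.codRestrict {φ : X → Y} {B : Subalgebra ℂ (Y → ℂ)} (hφ : IsMorphism A B φ)
    (s : Set Y) (h : ∀ x, φ x ∈ s) : IsMorphism A (regSub B s) (fun x => (⟨φ x, h x⟩ : s)) := by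
  rintro _ ⟨F, hF, rfl⟩
  exact hφ F hF

theorem isMorphism_fst {B : Subalgebra ℂ (Y → ℂ)} :
    IsMorphism (regProd A B) A (fun x : X × Y => x.1) :=
  fun F hF => (le_sup_left : _ ≤ regProd A B) ⟨F, hF, rfl⟩

theorem isMorphism_snd {B : Subalgebra ℂ (Y → ℂ)} :
    IsMorphism (regProd A B) B (fun x : X × Y => x.2) :=
  fun F hF => (le_sup_right : _ ≤ regProd A B) ⟨F, hF, rfl⟩

theorem IsMorphism.prodMk {Z : Type*} {B : Subalgebra ℂ (Y → ℂ)} {C : Subalgebra ℂ (Z → ℂ)}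
    {φ : Z → X} {ψ : Z → Y} (hφ : IsMorphism C A φ) (hψ : IsMorphism C B ψ) :
    IsMorphism C (regProd A B) (fun z => (φ z, ψ z)) := by
  have : regProd A B ≤ C.comap (pullback fun z => (φ z, ψ z)) := by
    refine sup_le ?_ ?_
    · rintro _ ⟨F, hF, rfl⟩
      exact hφ F hF
    · rintro _ ⟨F, hF, rfl⟩
      exact hψ F hF
  exact fun F hF => this hF

end PolynomialMaps

section Differential

variable {E : Type*} [AddCommGroup E] [Module ℂ E]

theorem exists_differential {p : E → ℂ} (hp : p ∈ polyFun E) :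
    ∃ d : E → Dual ℂ E, (∀ v, (fun x => d x v) ∈ polyFun E) ∧
      ∀ (c : ℂ → E) (t : ℂ) (v : E), (∀ l : Dual ℂ E, HasDerivAt (fun s => l (c s)) (l v) t) →
        HasDerivAt (fun s => p (c s)) (d (c t) v) t := by
  induction hp using Algebra.adjoin_induction with
  | mem p hp =>
    obtain ⟨l, rfl⟩ := hp
    exact ⟨fun _ => l, fun v => const_mem _ _, fun c t v h => h l⟩
  | algebraMap r =>
    exact ⟨fun _ => 0, fun v => const_mem _ _, fun c t v _ => hasDerivAt_const t r⟩
  | add p q _ _ ihp ihq =>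
    obtain ⟨d, hd, hc⟩ := ihp
    obtain ⟨d', hd', hc'⟩ := ihq
    exact ⟨fun x => d x + d' x, fun v => Subalgebra.add_mem _ (hd v) (hd' v),
      fun c t v h => (hc c t v h).add (hc' c t v h)⟩
  | mul p q hp hq ihp ihq =>
    obtain ⟨d, hd, hc⟩ := ihp
    obtain ⟨d', hd', hc'⟩ := ihq
    refine ⟨fun x => q x • d x + p x • d' x, fun v => Subalgebra.add_mem _
      (Subalgebra.mul_mem _ hq (hd v)) (Subalgebra.mul_mem _ hp (hd' v)), fun c t v h => ?_⟩
    refine ((hc c t v h).mul (hc' c t v h)).congr_deriv ?_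
    change _ = q (c t) * d (c t) v + p (c t) * d' (c t) v
    ring

theorem hasDerivAt_line (l : Dual ℂ E) (x v : E) (t : ℂ) :
    HasDerivAt (fun s : ℂ => l (x + s • v)) (l v) t := by
  simpa using ((hasDerivAt_id t).mul_const (l v)).const_add (l x)

/-- The differential of a polynomial function, characterized by the chain rule along curves; no
topology on `E` is needed. The junk value at other functions is `0`. -/
def differential (p : E → ℂ) : E → Dual ℂ E :=
  open Classical in if hp : p ∈ polyFun E then (exists_differential hp).choose else 0

theorem differential_mem {p : E → ℂ} (hp : p ∈ polyFun E) (v : E) :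
    (fun x => differential p x v) ∈ polyFun E := by
  simpa only [differential, hp, dif_pos] using (exists_differential hp).choose_spec.1 v

theorem hasDerivAt_comp_curve {p : E → ℂ} (hp : p ∈ polyFun E) {c : ℂ → E} {t : ℂ} {v : E}
    (h : ∀ l : Dual ℂ E, HasDerivAt (fun s => l (c s)) (l v) t) :
    HasDerivAt (fun s => p (c s)) (differential p (c t) v) t := by
  simpa only [differential, hp, dif_pos] using (exists_differential hp).choose_spec.2 c t v h

theorem hasDerivAt_comp_line {p : E → ℂ} (hp : p ∈ polyFun E) (x v : E) :
    HasDerivAt (fun s : ℂ => p (x + s • v)) (differential p x v) 0 := by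
  simpa using hasDerivAt_comp_curve hp (c := fun s : ℂ => x + s • v) (t := 0)
    fun l => hasDerivAt_line l x v 0

theorem lineDeriv_eq_differential {p : E → ℂ} (hp : p ∈ polyFun E) (x v : E) :
    lineDeriv ℂ p x v = differential p x v :=
  (hasDerivAt_comp_line hp x v).deriv

end Differential

section OneVariable

open Polynomial

theorem id_mem_polyFun : (fun t : ℂ => t) ∈ polyFun ℂ := dual_mem_polyFun (LinearMap.id : Dual ℂ ℂ)

theorem exists_polynomial_of_mem_polyFun {φ : ℂ → ℂ} (hφ : φ ∈ polyFun ℂ) :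
    ∃ P : ℂ[X], ∀ t, P.eval t = φ t := by
  have h : polyFun ℂ ≤ (aeval (fun t : ℂ => t) : ℂ[X] →ₐ[ℂ] (ℂ → ℂ)).range := by
    refine Algebra.adjoin_le ?_
    rintro _ ⟨l, rfl⟩
    refine ⟨l 1 • X, funext fun t => ?_⟩
    simpa [mul_comm] using (l.map_smul t 1).symm
  obtain ⟨P, rfl⟩ := h hφ
  exact ⟨P, fun t => (aeval_fn_apply P (fun t => t) t).symm⟩

theorem X_pow_succ_dvd_of_derivative {P : ℂ[X]} {k : ℕ} (h0 : P.coeff 0 = 0)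
    (h : X ^ k ∣ derivative P) : X ^ (k + 1) ∣ P := by
  rw [X_pow_dvd_iff] at h ⊢
  rintro (_ | d) hd
  · exact h0
  · have := h d (by omega)
    rw [coeff_derivative] at this
    exact (mul_eq_zero.1 this).resolve_right (Nat.cast_add_one_ne_zero d)

end OneVariable

section Triangular

variable {E : Type*} [AddCommGroup E] [Module ℂ E] {W : ℕ → Submodule ℂ E}

theorem iterate_sub_iterate_mem (h0 : W 0 = ⊤) {Φ : E → E}
    (hΦ : ∀ k x y, x - y ∈ W k → Φ x - Φ y ∈ W (k + 1)) (k : ℕ) (x y : E) :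
    Φ^[k] x - Φ^[k] y ∈ W k := by
  induction k with
  | zero => simp [h0]
  | succ k ih => simpa only [Function.iterate_succ_apply'] using hΦ k _ _ ih

theorem exists_inverse_of_triangular (h0 : W 0 = ⊤) {n : ℕ} (hn : W n = ⊥)
    {N : E → E} (hN : IsMorphism (polyFun E) (polyFun E) N)
    (htri : ∀ k x y, x - y ∈ W k → N x - N y ∈ W (k + 1)) :
    ∃ I : E → E, IsMorphism (polyFun E) (polyFun E) I ∧ (∀ x, I (x + N x) = x) ∧
      ∀ y, I y + N (I y) = y := by
  -- The solution of `x + N x = y` is the unique fixed point of the contraction `z ↦ y - N z`.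
  let Φ : E → E → E := fun y z => y - N z
  have hconst : ∀ y z z', (Φ y)^[n] z = (Φ y)^[n] z' := fun y z z' => by
    have hΦ : ∀ k x x', x - x' ∈ W k → Φ y x - Φ y x' ∈ W (k + 1) := fun k x x' h => by
      rw [sub_sub_sub_cancel_left]
      exact htri k x' x (sub_mem_comm_iff.1 h)
    simpa only [hn, Submodule.mem_bot, sub_eq_zero] using iterate_sub_iterate_mem h0 hΦ n z z'
  have hmorph : ∀ k, IsMorphism (polyFun E) (polyFun E) fun y => (Φ y)^[k] 0 := fun k => by
    induction k with
    | zero => exact isMorphism_const 0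
    | succ k ih =>
      simp only [Function.iterate_succ_apply']
      exact isMorphism_id.sub (hN.comp ih)
  refine ⟨fun y => (Φ y)^[n] 0, hmorph n, fun x => ?_, fun y => ?_⟩
  · have hfix : Φ (x + N x) x = x := add_sub_cancel_right x (N x)
    exact (hconst _ 0 x).trans (Function.iterate_fixed hfix n)
  · have hfix : Φ y ((Φ y)^[n] 0) = (Φ y)^[n] 0 := by
      rw [← Function.iterate_succ_apply' (Φ y), Function.iterate_succ_apply, hconst y (Φ y 0) 0]
    exact (sub_eq_iff_eq_add.1 hfix).symm

theorem exists_inverse_of_leadingPart {E' : Type*} [AddCommGroup E'] [Module ℂ E']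
    (h0 : W 0 = ⊤) {n : ℕ} (hn : W n = ⊥) {F : ℕ → Submodule ℂ E'} {Λ : E →ₗ[ℂ] E'}
    (hΛ : Function.Injective Λ) (hΛF : ∀ k v, Λ v ∈ F k → v ∈ W (k + 1)) {Θ : E → E'}
    (hΘ : IsMorphism (polyFun E) (polyFun E') Θ) (hmem : ∀ v, Θ v ∈ LinearMap.range Λ)
    (hlead : ∀ k v v', v - v' ∈ W k → Θ v - Θ v' - Λ (v - v') ∈ F k) :
    ∃ T : E' → E, IsMorphism (polyFun E') (polyFun E) T ∧
      (∀ z ∈ LinearMap.range Λ, Θ (T z) = z) ∧ ∀ v, T (Θ v) = v := by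
  obtain ⟨P, hP⟩ := Λ.exists_leftInverse_of_injective (LinearMap.ker_eq_bot.2 hΛ)
  have hPΛ : ∀ v, P (Λ v) = v := LinearMap.congr_fun hP
  have hΛP : ∀ z ∈ LinearMap.range Λ, Λ (P z) = z := by
    rintro _ ⟨v, rfl⟩
    rw [hPΛ]
  obtain ⟨I, hI, hI_add, hadd_I⟩ := exists_inverse_of_triangular h0 hn
    (N := fun v => P (Θ v) - v) ((hΘ.linear P).sub isMorphism_id) fun k v v' hv => by
      refine hΛF k _ ?_
      have hN : Λ (P (Θ v) - v - (P (Θ v') - v')) = Θ v - Θ v' - Λ (v - v') := by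
        simp only [map_sub, hΛP _ (hmem _)]
        abel
      exact hN ▸ hlead k v v' hv
  simp only [add_sub_cancel] at hI_add hadd_I
  refine ⟨fun z => I (P z), hI.comp (isMorphism_linear P), fun z hz => ?_, hI_add⟩
  rw [← hΛP _ (hmem _), hadd_I, hΛP z hz]

end Triangular

/-! ### The exponential of a nilpotent endomorphism -/

section NilpotentExponential

open Polynomial

/-- The Taylor polynomial of degree `n` of the exponential series, at which `nilExp` evaluates. -/
def expPoly (n : ℕ) : ℂ[X] := ∑ k ∈ Finset.range (n + 1), C ((k.factorial : ℂ)⁻¹) * X ^ k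

/-- The Taylor polynomial of degree `n` of `log (1 + X)`, inverse to `expPoly n - 1` modulo
`X ^ (n + 1)`. -/
def logPoly (n : ℕ) : ℂ[X] := ∑ k ∈ Finset.range n, C ((-1) ^ k * ((k : ℂ) + 1)⁻¹) * X ^ (k + 1)

theorem derivative_expPoly (n : ℕ) :
    derivative (expPoly n) = expPoly n - C ((n.factorial : ℂ)⁻¹) * X ^ n := by
  have h : ∀ k : ℕ, derivative (C (((k + 1).factorial : ℂ)⁻¹) * X ^ (k + 1)) =
      C ((k.factorial : ℂ)⁻¹) * (X : ℂ[X]) ^ k := by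
    intro k
    rw [derivative_C_mul_X_pow, Nat.factorial_succ]
    congr 2
    push_cast
    have : ((k : ℂ) + 1) ≠ 0 := Nat.cast_add_one_ne_zero k
    have : (k.factorial : ℂ) ≠ 0 := by exact_mod_cast k.factorial_ne_zero
    field_simp
  rw [expPoly, Finset.sum_range_succ, add_sub_cancel_right]
  rw [← Finset.sum_range_succ, Finset.sum_range_succ', derivative_add, derivative_sum]
  simp only [h]
  simp

theorem derivative_logPoly (n : ℕ) :
    derivative (logPoly n) = ∑ k ∈ Finset.range n, (-X) ^ k := by
  rw [logPoly, derivative_sum]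
  refine Finset.sum_congr rfl fun k _ => ?_
  have : ((k : ℂ) + 1) ≠ 0 := Nat.cast_add_one_ne_zero k
  rw [derivative_C_mul_X_pow, Nat.add_sub_cancel, neg_pow, Nat.cast_add, Nat.cast_one, mul_assoc,
    inv_mul_cancel₀ this]
  simp [neg_pow (X : ℂ[X]) k]

theorem one_add_X_mul_derivative_logPoly (n : ℕ) :
    (1 + X) * derivative (logPoly n) = 1 - (-X) ^ n := by
  rw [derivative_logPoly]
  have := mul_neg_geom_sum (-X : ℂ[X]) n
  rwa [sub_neg_eq_add] at this

theorem X_dvd_logPoly (n : ℕ) : X ∣ logPoly n :=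
  Finset.dvd_sum fun k _ => Dvd.dvd.mul_left (dvd_pow_self X (Nat.succ_ne_zero k)) _

theorem X_dvd_expPoly_sub_one (n : ℕ) : X ∣ expPoly n - 1 := by
  rw [expPoly, Finset.sum_range_succ']
  simp only [Nat.factorial_zero, Nat.cast_one, inv_one, C_1, pow_zero, mul_one,
    add_sub_cancel_right]
  exact Finset.dvd_sum fun k _ => Dvd.dvd.mul_left (dvd_pow_self X (Nat.succ_ne_zero k)) _

theorem X_dvd_comp {p q : ℂ[X]} (hp : X ∣ p) (hq : X ∣ q) : X ∣ p.comp q := by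
  obtain ⟨r, rfl⟩ := hp
  rw [mul_comp, X_comp]
  exact hq.mul_right _

theorem X_pow_dvd_logPoly_comp_expPoly (n : ℕ) :
    X ^ (n + 1) ∣ (logPoly n).comp (expPoly n - 1) - X := by
  set E := expPoly n with hE
  have hX : X ∣ E - 1 := X_dvd_expPoly_sub_one n
  apply X_pow_succ_dvd_of_derivative
  · exact X_dvd_iff.1 (dvd_sub (X_dvd_comp (X_dvd_logPoly n) hX) dvd_rfl)
  · have hlog := congrArg (fun p : ℂ[X] => p.comp (E - 1)) (one_add_X_mul_derivative_logPoly n)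
    simp only [mul_comp, add_comp, one_comp, X_comp, sub_comp, pow_comp, neg_comp,
      add_sub_cancel] at hlog
    have hderiv : derivative ((logPoly n).comp (E - 1) - X) =
        -(-(E - 1)) ^ n - C ((n.factorial : ℂ)⁻¹) * X ^ n *
          (derivative (logPoly n)).comp (E - 1) := by
      rw [derivative_sub, derivative_comp, derivative_sub, derivative_one, sub_zero, derivative_X,
        hE, derivative_expPoly, ← hE, sub_mul, hlog]
      ring
    rw [hderiv]
    refine dvd_sub ((dvd_neg).2 (pow_dvd_pow_of_dvd ((dvd_neg).2 hX) n)) ?_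
    exact Dvd.dvd.mul_right (dvd_mul_left _ _) _

-- Modulo `X ^ n` the only solution of `(1 + X) P' = P` with `P(0) = 0` is `P = 0`.
theorem X_pow_dvd_of_one_add_X_mul_derivative {n : ℕ} {P : ℂ[X]} (h0 : P.coeff 0 = 0)
    (hode : X ^ n ∣ (1 + X) * derivative P - P) : ∀ k ≤ n, X ^ (k + 1) ∣ P
  | 0, _ => by simpa using X_dvd_iff.2 h0
  | k + 1, hk => by
    have ih := X_pow_dvd_of_one_add_X_mul_derivative h0 hode k (by omega)
    have hmul : X ^ (k + 1) ∣ (1 + X) * derivative P := by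
      simpa using dvd_add ((pow_dvd_pow X hk).trans hode) ih
    have hcop : IsCoprime (X ^ (k + 1) : ℂ[X]) (1 + X) := IsCoprime.pow_left ⟨-1, 1, by ring⟩
    exact X_pow_succ_dvd_of_derivative h0 (hcop.dvd_of_dvd_mul_left hmul)

theorem X_pow_dvd_expPoly_comp_logPoly (n : ℕ) :
    X ^ (n + 1) ∣ (expPoly n).comp (logPoly n) - (1 + X) := by
  set L := logPoly n
  have hX : X ∣ L := X_dvd_logPoly n
  set R := (expPoly n).comp L with hR
  have hderiv : derivative R = (R - C ((n.factorial : ℂ)⁻¹) * L ^ n) * derivative L := by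
    rw [hR, derivative_comp, derivative_expPoly, sub_comp, mul_comp, C_comp, pow_comp, X_comp,
      mul_comm]
  have hlog : (1 + X) * derivative L = 1 - (-X) ^ n := one_add_X_mul_derivative_logPoly n
  have hode : (1 + X) * derivative (R - (1 + X)) - (R - (1 + X)) =
      -(R * (-X) ^ n) - C ((n.factorial : ℂ)⁻¹) * L ^ n * ((1 + X) * derivative L) := by
    rw [derivative_sub, hderiv, derivative_add, derivative_one, derivative_X]
    linear_combination R * hlog
  refine X_pow_dvd_of_one_add_X_mul_derivative ?_ ?_ n le_rfl
  · have hcomp : X ∣ (expPoly n - 1).comp L := X_dvd_comp (X_dvd_expPoly_sub_one n) hX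
    rw [sub_comp, one_comp] at hcomp
    rw [← X_dvd_iff, ← sub_sub]
    exact dvd_sub hcomp dvd_rfl
  · rw [hode]
    refine dvd_sub ((dvd_neg).2 (Dvd.dvd.mul_left ?_ _)) ?_
    · exact pow_dvd_pow_of_dvd ((dvd_neg).2 dvd_rfl) n
    · exact Dvd.dvd.mul_right (Dvd.dvd.mul_left (pow_dvd_pow_of_dvd hX n) _) _

variable {V : Type*} [AddCommGroup V] [Module ℂ V]

theorem nilExp_eq_aeval (N : End ℂ V) : nilExp N = aeval N (expPoly (finrank ℂ V)) := by
  simp [nilExp, expPoly, Algebra.smul_def]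

/-- The logarithm of a unipotent endomorphism, as a polynomial in `u - 1`; a junk value unless
`u - 1` is nilpotent. -/
def nilLog (u : End ℂ V) : End ℂ V := aeval (u - 1) (logPoly (finrank ℂ V))

theorem isNilpotent_nilLog {u : End ℂ V} (hu : IsNilpotent (u - 1)) : IsNilpotent (nilLog u) := by
  obtain ⟨r, hr⟩ := X_dvd_logPoly (finrank ℂ V)
  rw [nilLog, hr, map_mul, aeval_X]
  refine Commute.isNilpotent_mul_right ?_ hu
  simpa only [aeval_X] using Commute.map (Commute.all X r) (aeval (u - 1))

variable [FiniteDimensional ℂ V]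

theorem pow_finrank_eq_zero {N : End ℂ V} (hN : IsNilpotent N) : N ^ finrank ℂ V = 0 := by
  have := (LinearMap.charpoly_eq_X_pow_iff N).2
    (fun v => hN.imp fun n hn => by simp [hn])
  have h := N.aeval_self_charpoly
  rwa [this, map_pow, aeval_X] at h

theorem aeval_eq_of_X_pow_dvd_sub {N : End ℂ V} (hN : IsNilpotent N) {P Q : ℂ[X]}
    (h : X ^ (finrank ℂ V + 1) ∣ P - Q) : aeval N P = aeval N Q := by
  obtain ⟨r, hr⟩ := h
  rw [← sub_eq_zero, ← map_sub, hr, map_mul, map_pow, aeval_X, pow_succ, pow_finrank_eq_zero hN]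
  simp

theorem nilLog_nilExp {N : End ℂ V} (hN : IsNilpotent N) : nilLog (nilExp N) = N := by
  have := aeval_eq_of_X_pow_dvd_sub hN (X_pow_dvd_logPoly_comp_expPoly (finrank ℂ V))
  rw [aeval_comp, map_sub, aeval_X, map_one, ← nilExp_eq_aeval] at this
  exact this

theorem nilExp_nilLog {u : End ℂ V} (hu : IsNilpotent (u - 1)) : nilExp (nilLog u) = u := by
  have := aeval_eq_of_X_pow_dvd_sub hu (X_pow_dvd_expPoly_comp_logPoly (finrank ℂ V))
  rw [aeval_comp, map_add, aeval_X, map_one, add_sub_cancel] at this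
  rw [nilExp_eq_aeval]
  exact this

theorem nilExp_eq_sum {N : End ℂ V} {n : ℕ} (hN : N ^ n = 0) :
    nilExp N = ∑ k ∈ Finset.range n, ((k.factorial : ℂ)⁻¹) • N ^ k := by
  have hfin := pow_finrank_eq_zero ⟨n, hN⟩
  have : ∀ a b : ℕ, a ≤ b → N ^ a = 0 → ∑ k ∈ Finset.range b, ((k.factorial : ℂ)⁻¹) • N ^ k =
      ∑ k ∈ Finset.range a, ((k.factorial : ℂ)⁻¹) • N ^ k := by
    intro a b hab ha
    refine (Finset.sum_subset (Finset.range_mono hab) fun k _ hk => ?_).symm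
    rw [pow_eq_zero_of_le (by simpa using hk) ha, smul_zero]
  rw [nilExp, this _ _ (Nat.le_succ _) hfin]
  rcases le_total n (finrank ℂ V) with h | h
  · exact this _ _ h hN
  · exact (this _ _ h hfin).symm

theorem nilExp_eq_exp [Module ℚ (End ℂ V)] {N : End ℂ V} (hN : IsNilpotent N) :
    nilExp N = IsNilpotent.exp N := by
  obtain ⟨n, hn⟩ := hN
  rw [nilExp_eq_sum hn, IsNilpotent.exp_eq_sum hn]
  refine Finset.sum_congr rfl fun k _ => ?_
  have hk : (k.factorial : ℂ) ≠ 0 := by exact_mod_cast k.factorial_ne_zero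
  have hk' : (k.factorial : ℚ) ≠ 0 := by exact_mod_cast k.factorial_ne_zero
  have hcancel : (k.factorial : ℂ) • ((k.factorial : ℚ)⁻¹ • N ^ k : End ℂ V) = N ^ k := by
    rw [Nat.cast_smul_eq_nsmul, ← Nat.cast_smul_eq_nsmul ℚ, smul_smul, mul_inv_cancel₀ hk',
      one_smul]
  rw [← hcancel, smul_smul, inv_mul_cancel₀ hk, one_smul, hcancel]

variable (V) in
/-- The rational structure underlying a complex algebra of endomorphisms, over which
`IsNilpotent.exp` is defined. -/
abbrev ratModuleEnd : Module ℚ (End ℂ V) := Module.compHom _ (algebraMap ℚ ℂ)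

theorem nilExp_add_of_commute {N N' : End ℂ V} (h : Commute N N') (hN : IsNilpotent N)
    (hN' : IsNilpotent N') : nilExp (N + N') = nilExp N * nilExp N' := by
  let := ratModuleEnd V
  rw [nilExp_eq_exp (h.isNilpotent_add hN hN'), nilExp_eq_exp hN, nilExp_eq_exp hN',
    IsNilpotent.exp_add_of_commute h hN hN']

theorem nilExp_zero : nilExp (0 : End ℂ V) = 1 := by
  rw [nilExp_eq_sum (n := 1) (by simp)]
  simp

theorem nilExp_mul_nilExp_neg {N : End ℂ V} (hN : IsNilpotent N) :
    nilExp N * nilExp (-N) = 1 := by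
  rw [← nilExp_add_of_commute ((Commute.refl N).neg_right) hN hN.neg, add_neg_cancel, nilExp_zero]

theorem nilExp_neg_mul_nilExp {N : End ℂ V} (hN : IsNilpotent N) :
    nilExp (-N) * nilExp N = 1 := by
  simpa using nilExp_mul_nilExp_neg hN.neg

theorem nilExp_natCast_smul {N : End ℂ V} (hN : IsNilpotent N) (n : ℕ) :
    nilExp ((n : ℂ) • N) = nilExp N ^ n := by
  induction n with
  | zero => simp [nilExp_zero]
  | succ n ih =>
    rw [Nat.cast_add, Nat.cast_one, add_smul, one_smul, pow_succ, ← ih]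
    exact nilExp_add_of_commute ((Commute.refl N).smul_left _) (hN.smul _) hN

theorem hasDerivAt_nilExp_smul {N : End ℂ V} (hN : IsNilpotent N) (l : Dual ℂ (End ℂ V)) (t : ℂ) :
    HasDerivAt (fun s : ℂ => l (nilExp (s • N))) (l (nilExp (t • N) * N)) t := by
  have hpow := pow_finrank_eq_zero hN
  set n := finrank ℂ V
  have hfun : (fun s : ℂ => l (nilExp (s • N))) = fun s => ∑ k ∈ Finset.range (n + 1),
      s ^ k * (((k.factorial : ℂ)⁻¹) * l (N ^ k)) := by
    funext s
    simp only [nilExp, map_sum, map_smul, _root_.smul_pow, smul_eq_mul]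
    exact Finset.sum_congr rfl fun k _ => by ring
  rw [hfun]
  refine (HasDerivAt.fun_sum fun k _ => (hasDerivAt_pow k t).mul_const _).congr_deriv ?_
  rw [nilExp_eq_sum (n := n) (by rw [_root_.smul_pow, hpow, smul_zero]), Finset.sum_range_succ',
    Finset.sum_mul, map_sum]
  simp only [Nat.cast_zero, zero_mul, add_zero]
  refine Finset.sum_congr rfl fun k _ => ?_
  rw [smul_mul_assoc, _root_.smul_pow, smul_mul_assoc, map_smul, map_smul, ← pow_succ,
    Nat.factorial_succ]
  have : ((k : ℂ) + 1) ≠ 0 := Nat.cast_add_one_ne_zero k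
  have : (k.factorial : ℂ) ≠ 0 := by exact_mod_cast k.factorial_ne_zero
  simp only [smul_eq_mul, Nat.add_sub_cancel]
  push_cast
  field_simp

end NilpotentExponential

section ExponentialAlgebra

variable {V W : Type*} [AddCommGroup V] [Module ℂ V] [AddCommGroup W] [Module ℂ W]

theorem isNilpotent_mulLeft {N : End ℂ V} (hN : IsNilpotent N) :
    IsNilpotent (LinearMap.mulLeft ℂ N) :=
  hN.imp fun n hn => by rw [LinearMap.pow_mulLeft, hn, LinearMap.mulLeft_zero_eq_zero]

theorem isNilpotent_mulRight {N : End ℂ V} (hN : IsNilpotent N) :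
    IsNilpotent (LinearMap.mulRight ℂ N) :=
  hN.imp fun n hn => by rw [LinearMap.pow_mulRight, hn, LinearMap.mulRight_zero_eq_zero]

theorem isNilpotent_mulLeft_add_mulRight_neg {N : End ℂ V} (hN : IsNilpotent N) :
    IsNilpotent (LinearMap.mulLeft ℂ N + LinearMap.mulRight ℂ (-N)) :=
  (LinearMap.commute_mulLeft_right N (-N)).isNilpotent_add (isNilpotent_mulLeft hN)
    (isNilpotent_mulRight hN.neg)

variable [FiniteDimensional ℂ V] [FiniteDimensional ℂ W]

theorem nilExp_intertwine {N : End ℂ V} {N' : End ℂ W} (hN : IsNilpotent N) (hN' : IsNilpotent N')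
    (T : V →ₗ[ℂ] W) (h : ∀ v, N' (T v) = T (N v)) (v : V) : nilExp N' (T v) = T (nilExp N v) := by
  obtain ⟨n, hn⟩ := hN
  obtain ⟨n', hn'⟩ := hN'
  rw [nilExp_eq_sum (pow_eq_zero_of_le (le_max_left n n') hn),
    nilExp_eq_sum (pow_eq_zero_of_le (le_max_right n n') hn')]
  have hpow (k : ℕ) : (N' ^ k) (T v) = T ((N ^ k) v) :=
    LinearMap.congr_fun (Module.End.commute_pow_left_of_commute (LinearMap.ext h) k) v
  simp [LinearMap.sum_apply, hpow]

theorem nilExp_mulLeft {N : End ℂ V} (hN : IsNilpotent N) :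
    nilExp (LinearMap.mulLeft ℂ N) = LinearMap.mulLeft ℂ (nilExp N) := by
  obtain ⟨n, hn⟩ := hN
  rw [nilExp_eq_sum hn, nilExp_eq_sum (n := n) (by
    rw [LinearMap.pow_mulLeft, hn, LinearMap.mulLeft_zero_eq_zero])]
  ext x : 1
  simp [LinearMap.pow_mulLeft, LinearMap.sum_apply, Finset.sum_mul]

theorem nilExp_mulRight {N : End ℂ V} (hN : IsNilpotent N) :
    nilExp (LinearMap.mulRight ℂ N) = LinearMap.mulRight ℂ (nilExp N) := by
  obtain ⟨n, hn⟩ := hN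
  rw [nilExp_eq_sum hn, nilExp_eq_sum (n := n) (by
    rw [LinearMap.pow_mulRight, hn, LinearMap.mulRight_zero_eq_zero])]
  ext x : 1
  simp [LinearMap.pow_mulRight, LinearMap.sum_apply, Finset.mul_sum]

theorem nilExp_conj {N : End ℂ V} (hN : IsNilpotent N) (Y : End ℂ V) :
    nilExp (LinearMap.mulLeft ℂ N + LinearMap.mulRight ℂ (-N)) Y =
      nilExp N * Y * nilExp (-N) := by
  rw [nilExp_add_of_commute (LinearMap.commute_mulLeft_right N (-N)) (isNilpotent_mulLeft hN)
    (isNilpotent_mulRight hN.neg), nilExp_mulLeft hN, nilExp_mulRight hN.neg]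
  simp [mul_assoc]

/-- The exponential of a nilpotent endomorphism, as an element of the general linear group. -/
def expGL (N : End ℂ V) (hN : IsNilpotent N) : LinearMap.GeneralLinearGroup ℂ V :=
  ⟨nilExp N, nilExp (-N), nilExp_mul_nilExp_neg hN, nilExp_neg_mul_nilExp hN⟩

theorem expGL_val (N : End ℂ V) (hN : IsNilpotent N) : (expGL N hN).val = nilExp N := rfl

end ExponentialAlgebra

/-! ### Unipotent groups and their Lie algebras -/

section TangentSpace

variable {V : Type*} [AddCommGroup V] [Module ℂ V]
variable {H : Subgroup (LinearMap.GeneralLinearGroup ℂ V)}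

theorem isMorphism_differential {E : Type*} [AddCommGroup E] [Module ℂ E] [FiniteDimensional ℂ E]
    {p : E → ℂ} (hp : p ∈ polyFun E) :
    IsMorphism (polyFun E) (polyFun (Dual ℂ E)) (differential p) := by
  refine isMorphism_iff_dual.2 fun l => ?_
  obtain ⟨v, rfl⟩ := (evalEquiv ℂ E).surjective l
  exact differential_mem hp v

/-- The derivative of a polynomial function along the left invariant vector field defined
by `X`. -/
def leftDerivative (X : End ℂ V) (p : End ℂ V → ℂ) : End ℂ V → ℂ :=
  fun u => differential p u (u * X)

theorem leftDerivative_eq_zero {X : End ℂ V} (hX : X ∈ tangentSpace H) {p : End ℂ V → ℂ}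
    (hp : p ∈ polyFun (End ℂ V))
    (hpH : ∀ u : LinearMap.GeneralLinearGroup ℂ V, u ∈ H → p u = 0)
    (u : LinearMap.GeneralLinearGroup ℂ V) (hu : u ∈ H) : leftDerivative X p u = 0 := by
  have h := hX (p ∘ LinearMap.mulLeft ℂ (u : End ℂ V)) (polyFun_comp _ hp)
    (fun v hv => hpH (u * v) (H.mul_mem hu hv))
  rw [← h, leftDerivative, ← lineDeriv_eq_differential hp]
  simp [lineDeriv, mul_add]

variable [FiniteDimensional ℂ V]

theorem leftDerivative_mem (X : End ℂ V) {p : End ℂ V → ℂ} (hp : p ∈ polyFun (End ℂ V)) :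
    leftDerivative X p ∈ polyFun (End ℂ V) := by
  have := (isMorphism_differential hp).bilinear (LinearMap.id)
    (isMorphism_linear (LinearMap.mulRight ℂ X))
  exact isMorphism_iff_dual.1 this LinearMap.id

theorem isMorphism_nilExp_smul (X : End ℂ V) :
    IsMorphism (polyFun ℂ) (polyFun (End ℂ V)) (fun t : ℂ => nilExp (t • X)) :=
  IsMorphism.nilExp (IsMorphism.smul id_mem_polyFun (isMorphism_const X))

theorem hasDerivAt_nilExp_smul_comp {X : End ℂ V} (hX : IsNilpotent X) {p : End ℂ V → ℂ}
    (hp : p ∈ polyFun (End ℂ V)) (t : ℂ) :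
    HasDerivAt (fun s : ℂ => p (nilExp (s • X))) (leftDerivative X p (nilExp (t • X))) t :=
  hasDerivAt_comp_curve hp fun l => hasDerivAt_nilExp_smul hX l t

open Polynomial in
theorem X_pow_dvd_of_eval_eq_nilExp {X : End ℂ V} (hX : X ∈ tangentSpace H) (hnil : IsNilpotent X)
    (k : ℕ) {p : End ℂ V → ℂ} (hp : p ∈ polyFun (End ℂ V))
    (hpH : ∀ u : LinearMap.GeneralLinearGroup ℂ V, u ∈ H → p u = 0)
    {P : ℂ[X]} (hP : ∀ t, P.eval t = p (nilExp (t • X))) : Polynomial.X ^ k ∣ P := by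
  induction k generalizing p P with
  | zero => simp
  | succ k ih =>
    apply X_pow_succ_dvd_of_derivative
    · rw [coeff_zero_eq_eval_zero, hP]
      simpa [nilExp_zero] using hpH 1 H.one_mem
    · refine ih (leftDerivative_mem X hp) (leftDerivative_eq_zero hX hp hpH) fun t => ?_
      refine (P.hasDerivAt t).unique ?_
      simp only [hP]
      exact hasDerivAt_nilExp_smul_comp hnil hp t

open Polynomial in
theorem eq_zero_on_nilExp_smul {X : End ℂ V} (hX : X ∈ tangentSpace H) (hnil : IsNilpotent X)
    {p : End ℂ V → ℂ} (hp : p ∈ polyFun (End ℂ V))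
    (hpH : ∀ u : LinearMap.GeneralLinearGroup ℂ V, u ∈ H → p u = 0) (t : ℂ) :
    p (nilExp (t • X)) = 0 := by
  obtain ⟨P, hP⟩ := exists_polynomial_of_mem_polyFun (isMorphism_nilExp_smul X p hp)
  have hP0 : P = 0 := by
    by_contra h0
    have hdvd := X_pow_dvd_of_eval_eq_nilExp hX hnil (P.natDegree + 1) hp hpH hP
    have hdeg := natDegree_le_of_dvd hdvd h0
    rw [natDegree_X_pow] at hdeg
    omega
  rw [← Function.comp_apply (f := p) (g := fun t : ℂ => nilExp (t • X)), ← hP, hP0, eval_zero]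

theorem expGL_mem (hH : IsZariskiClosed H) {X : End ℂ V} (hX : X ∈ tangentSpace H)
    (hnil : IsNilpotent X) : expGL X hnil ∈ H := by
  obtain ⟨S, hS, hmem⟩ := hH
  refine (hmem _).2 fun p hp => ?_
  have := eq_zero_on_nilExp_smul hX hnil (hS hp) (fun u hu => (hmem u).1 hu p hp) 1
  rwa [one_smul] at this

open Polynomial in
theorem nilLog_mem_tangentSpace {u : LinearMap.GeneralLinearGroup ℂ V} (hu : u ∈ H)
    (hnil : IsNilpotent (u.val - 1)) : nilLog u.val ∈ tangentSpace H := by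
  intro p hp hpH
  have hN := isNilpotent_nilLog hnil
  obtain ⟨P, hP⟩ := exists_polynomial_of_mem_polyFun (isMorphism_nilExp_smul (nilLog u.val) p hp)
  have hP' : ∀ t : ℂ, P.eval t = p (nilExp (t • nilLog u.val)) := hP
  have hP0 : P = 0 := by
    refine eq_zero_of_infinite_isRoot P (Set.Infinite.mono ?_
      (Set.infinite_range_of_injective (Nat.cast_injective (R := ℂ))))
    rintro _ ⟨n, rfl⟩
    rw [Set.mem_ofPred_eq, IsRoot.def, hP', nilExp_natCast_smul hN, nilExp_nilLog hnil]
    simpa using hpH (u ^ n) (H.pow_mem hu n)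
  have hderiv : HasDerivAt (fun s => P.eval s) (differential p 1 (nilLog u.val)) 0 := by
    simp only [hP']
    simpa [nilExp_zero, leftDerivative] using hasDerivAt_nilExp_smul_comp hN hp 0
  rw [lineDeriv_eq_differential hp, ← (P.hasDerivAt 0).unique hderiv, hP0]
  simp

end TangentSpace

namespace ConnectedAlgebraicGroup

variable {g V : Type*} [LieRing g] [LieAlgebra ℂ g] [AddCommGroup V] [Module ℂ V]
variable (G : ConnectedAlgebraicGroup g V)

theorem lieMap_ad (x y : g) : (LinearMap.mulLeft ℂ (G.lieMap x) +
    LinearMap.mulRight ℂ (-G.lieMap x)) (G.lieMap y) = G.lieMap (LieAlgebra.ad ℂ g x y) := by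
  simp [G.lieMap_lie, sub_eq_add_neg]

theorem isNilpotent_ad_of_lieMap {x : g} (hx : IsNilpotent (G.lieMap x)) :
    IsNilpotent (LieAlgebra.ad ℂ g x) := by
  obtain ⟨n, hn⟩ := isNilpotent_mulLeft_add_mulRight_neg hx
  refine ⟨n, LinearMap.ext fun y => G.lieMap_injective ?_⟩
  have hcomm : (LinearMap.mulLeft ℂ (G.lieMap x) + LinearMap.mulRight ℂ (-G.lieMap x)) ∘ₗ G.lieMap =
      G.lieMap ∘ₗ LieAlgebra.ad ℂ g x := LinearMap.ext (G.lieMap_ad x)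
  have hpow := LinearMap.congr_fun (Module.End.commute_pow_left_of_commute hcomm n) y
  rw [hn] at hpow
  rw [← LinearMap.comp_apply, ← hpow]
  simp

variable {G} {M : Subgroup G.carrier} {m : LieSubalgebra ℂ g}

theorem regular_coord (M : Subgroup G.carrier) :
    IsMorphism (G.regSubgroup M) (polyFun (End ℂ V))
      (fun u : M => ((u : G.carrier) : LinearMap.GeneralLinearGroup ℂ V).val) :=
  isMorphism_iff_dual.2 fun l => ⟨_, Algebra.subset_adjoin (Or.inl ⟨l, rfl⟩), rfl⟩

theorem regular_coord_inv (M : Subgroup G.carrier) :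
    IsMorphism (G.regSubgroup M) (polyFun (End ℂ V))
      (fun u : M => ((u : G.carrier) : LinearMap.GeneralLinearGroup ℂ V)⁻¹.val) :=
  isMorphism_iff_dual.2 fun l => ⟨_, Algebra.subset_adjoin (Or.inr ⟨l, rfl⟩), rfl⟩

theorem isMorphism_to_subgroup {X : Type*} {A : Subalgebra ℂ (X → ℂ)} {φ : X → M}
    (h : IsMorphism A (polyFun (End ℂ V))
      (fun x => ((φ x : G.carrier) : LinearMap.GeneralLinearGroup ℂ V).val))
    (h' : IsMorphism A (polyFun (End ℂ V))
      (fun x => ((φ x : G.carrier) : LinearMap.GeneralLinearGroup ℂ V)⁻¹.val)) :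
    IsMorphism A (G.regSubgroup M) φ := by
  rintro _ ⟨F, hF, rfl⟩
  have : regGroup (G.toGL M) ≤ A.comap (pullback fun x =>
      (⟨(φ x).1.1, Subgroup.mem_map_of_mem _ (φ x).2⟩ : G.toGL M)) := by
    refine Algebra.adjoin_le ?_
    rintro _ (⟨l, rfl⟩ | ⟨l, rfl⟩)
    · exact isMorphism_iff_dual.1 h l
    · exact isMorphism_iff_dual.1 h' l
  exact this hF

variable [FiniteDimensional ℂ V]

theorem exists_coe_eq_expGL (hM : G.IsUnipotentSubgroup M m)
    (hnil : ∀ x ∈ m, IsNilpotent (G.lieMap x)) (x : m) :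
    ∃ u : M, ((u : G.carrier) : LinearMap.GeneralLinearGroup ℂ V) =
      expGL (G.lieMap x) (hnil x x.2) := by
  have h : expGL (G.lieMap x) (hnil x x.2) ∈ G.toGL M :=
    expGL_mem hM.closed (hM.lie ▸ ⟨x, x.2, rfl⟩) _
  obtain ⟨u, hu, hu'⟩ := h
  exact ⟨⟨u, hu⟩, hu'⟩

theorem exists_lieMap_eq_nilLog (hM : G.IsUnipotentSubgroup M m) (u : M) :
    ∃ x : m, nilLog ((u : G.carrier) : LinearMap.GeneralLinearGroup ℂ V).val = G.lieMap x := by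
  have h := nilLog_mem_tangentSpace (H := G.toGL M) (Subgroup.mem_map_of_mem _ u.2)
    (hM.unipotent u u.2)
  rw [hM.lie] at h
  obtain ⟨x, hx, hx'⟩ := h
  exact ⟨⟨x, hx⟩, hx'.symm⟩

/-- The exponential parametrization of a connected unipotent subgroup by its Lie algebra. -/
def expEquiv (hM : G.IsUnipotentSubgroup M m) (hnil : ∀ x ∈ m, IsNilpotent (G.lieMap x)) :
    m ≃ M where
  toFun x := (exists_coe_eq_expGL hM hnil x).choose
  invFun u := (exists_lieMap_eq_nilLog hM u).choose
  left_inv x := by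
    apply Subtype.ext
    apply G.lieMap_injective
    rw [← (exists_lieMap_eq_nilLog hM _).choose_spec, (exists_coe_eq_expGL hM hnil x).choose_spec,
      expGL_val, nilLog_nilExp (hnil x x.2)]
  right_inv u := by
    apply Subtype.ext
    apply Subtype.ext
    apply Units.ext
    rw [(exists_coe_eq_expGL hM hnil _).choose_spec, expGL_val,
      ← (exists_lieMap_eq_nilLog hM _).choose_spec, nilExp_nilLog (hM.unipotent u u.2)]

variable (hM : G.IsUnipotentSubgroup M m) (hnil : ∀ x ∈ m, IsNilpotent (G.lieMap x))

theorem coe_expEquiv (x : m) : ((expEquiv hM hnil x : G.carrier) :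
    LinearMap.GeneralLinearGroup ℂ V) = expGL (G.lieMap x) (hnil x x.2) :=
  (exists_coe_eq_expGL hM hnil x).choose_spec

theorem isMorphism_expEquiv : IsMorphism (polyFun m) (G.regSubgroup M) (expEquiv hM hnil) := by
  have h : IsMorphism (polyFun m) (polyFun (End ℂ V)) (fun x : m => G.lieMap (x : g)) :=
    isMorphism_linear (G.lieMap ∘ₗ (m.incl : m →ₗ[ℂ] g))
  apply isMorphism_to_subgroup
  · simp only [coe_expEquiv]
    exact h.nilExp
  · simp only [coe_expEquiv]
    exact h.neg.nilExp

variable [FiniteDimensional ℂ g]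

theorem Ad_expEquiv (x : m) (y : g) :
    G.Ad (expEquiv hM hnil x) y = nilExp (LieAlgebra.ad ℂ g (x : g)) y := by
  apply G.lieMap_injective
  have hx := hnil x x.2
  rw [lieMap_Ad, coe_expEquiv, ← nilExp_intertwine (G.isNilpotent_ad_of_lieMap hx)
    (isNilpotent_mulLeft_add_mulRight_neg hx) G.lieMap (G.lieMap_ad x) y, nilExp_conj hx]
  rfl

theorem Ad_expEquiv_inv (x : m) (y : g) :
    G.Ad (expEquiv hM hnil x : G.carrier)⁻¹ y = nilExp (-LieAlgebra.ad ℂ g (x : g)) y := by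
  have hx := G.isNilpotent_ad_of_lieMap (hnil x x.2)
  have h : G.Ad (expEquiv hM hnil x) (nilExp (-LieAlgebra.ad ℂ g (x : g)) y) = y := by
    rw [Ad_expEquiv, ← Module.End.mul_apply, nilExp_mul_nilExp_neg hx, Module.End.one_apply]
  rw [← h, ← Module.End.mul_apply, ← map_mul, inv_mul_cancel, map_one, h, Module.End.one_apply]

theorem coAd_expEquiv_apply (x : m) (ξ : Dual ℂ g) (y : g) :
    G.coAd (expEquiv hM hnil x) ξ y = ξ (nilExp (-LieAlgebra.ad ℂ g (x : g)) y) := by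
  rw [← Ad_expEquiv_inv hM hnil]
  rfl

theorem isMorphism_coAd (M : Subgroup G.carrier) :
    IsMorphism (regProd (G.regSubgroup M) (polyFun (Dual ℂ g))) (polyFun (Dual ℂ g))
      (fun z : M × Dual ℂ g => G.coAd (z.1 : G.carrier) z.2) := by
  refine isMorphism_iff_dual.2 fun l => ?_
  obtain ⟨y, rfl⟩ := (evalEquiv ℂ g).surjective l
  obtain ⟨π, hπ⟩ := G.lieMap.exists_leftInverse_of_injective
    (LinearMap.ker_eq_bot.2 G.lieMap_injective)
  have hAd : IsMorphism (G.regSubgroup M) (polyFun g) (fun u : M => G.Ad (u : G.carrier)⁻¹ y) := by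
    have := (((regular_coord_inv M).mul (isMorphism_const (G.lieMap y))).mul
      (regular_coord M)).linear π
    convert this using 2 with u
    have hAd_eq := LinearMap.congr_fun hπ (G.Ad (u : G.carrier)⁻¹ y)
    simp only [LinearMap.comp_apply, G.lieMap_Ad, LinearMap.id_apply] at hAd_eq
    rw [← hAd_eq]
    simp
  have hpair := (isMorphism_snd (A := G.regSubgroup M) (B := polyFun (Dual ℂ g))).bilinear
    LinearMap.id (hAd.comp isMorphism_fst)
  exact isMorphism_iff_dual.1 hpair LinearMap.id

end ConnectedAlgebraicGroup

/-! ### Graded vector spaces -/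

section Filtration

variable {E E' E'' : Type*} [AddCommGroup E] [Module ℂ E] [AddCommGroup E'] [Module ℂ E']
  [AddCommGroup E''] [Module ℂ E'']

/-- The decreasing filtration attached to a `ℤ`-indexed family of subspaces; `filt Γ 1` is the
positive part of a grading. -/
def filt (Γ : ℤ → Submodule ℂ E) (d : ℤ) : Submodule ℂ E := ⨆ i : {i : ℤ // d ≤ i}, Γ i

variable {Γ : ℤ → Submodule ℂ E} {Γ' : ℤ → Submodule ℂ E'} {Γ'' : ℤ → Submodule ℂ E''}

theorem le_filt {d j : ℤ} (h : d ≤ j) : Γ j ≤ filt Γ d :=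
  le_iSup (fun i : {i : ℤ // d ≤ i} => Γ i) ⟨j, h⟩

theorem filt_le {d : ℤ} {p : Submodule ℂ E} (h : ∀ j, d ≤ j → Γ j ≤ p) : filt Γ d ≤ p :=
  iSup_le fun i => h i i.2

theorem filt_antitone {d d' : ℤ} (h : d ≤ d') : filt Γ d' ≤ filt Γ d :=
  filt_le fun _ hj => le_filt (h.trans hj)

theorem map_mem_filt {T : E →ₗ[ℂ] E'} {i : ℤ} (hT : ∀ j, ∀ x ∈ Γ j, T x ∈ Γ' (i + j)) {d : ℤ}
    {x : E} (hx : x ∈ filt Γ d) : T x ∈ filt Γ' (i + d) := by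
  have : filt Γ d ≤ (filt Γ' (i + d)).comap T :=
    filt_le fun j hj y hy => le_filt (by omega) (hT j y hy)
  exact this hx

theorem bilinear_mem_filt {T : E →ₗ[ℂ] E' →ₗ[ℂ] E''}
    (hT : ∀ i j, ∀ x ∈ Γ i, ∀ y ∈ Γ' j, T x y ∈ Γ'' (i + j)) {a b : ℤ} {x : E} {y : E'}
    (hx : x ∈ filt Γ a) (hy : y ∈ filt Γ' b) : T x y ∈ filt Γ'' (a + b) := by
  have : filt Γ a ≤ (filt Γ'' (a + b)).comap (T.flip y) := by
    refine filt_le fun i hi x hx => ?_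
    exact filt_antitone (by omega) (map_mem_filt (T := T x) (fun j y hy => hT i j x hx y hy) hy)
  exact this hx

theorem exists_filt_eq_bot [FiniteDimensional ℂ E] (h : iSupIndep Γ) :
    ∃ n : ℕ, filt Γ n = ⊥ := by
  have hfin := WellFoundedGT.finite_ne_bot_of_iSupIndep h
  obtain ⟨b, hb⟩ := hfin.bddAbove
  refine ⟨(b + 1).toNat, ?_⟩
  rw [eq_bot_iff]
  refine filt_le fun j hj => ?_
  by_contra hne
  have := hb (show Γ j ≠ ⊥ from fun h0 => hne h0.le)
  omega

theorem mul_mem_eigenspace_commutator {W : Type*} [AddCommGroup W] [Module ℂ W] (Q : End ℂ W)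
    {a b : ℂ} {X Y : End ℂ W}
    (hX : X ∈ Module.End.eigenspace (LinearMap.mulLeft ℂ Q - LinearMap.mulRight ℂ Q) a)
    (hY : Y ∈ Module.End.eigenspace (LinearMap.mulLeft ℂ Q - LinearMap.mulRight ℂ Q) b) :
    X * Y ∈ Module.End.eigenspace (LinearMap.mulLeft ℂ Q - LinearMap.mulRight ℂ Q) (a + b) := by
  simp only [Module.End.mem_eigenspace_iff, LinearMap.sub_apply, LinearMap.mulLeft_apply,
    LinearMap.mulRight_apply] at hX hY ⊢
  have hleib : Q * (X * Y) - X * Y * Q = (Q * X - X * Q) * Y + X * (Q * Y - Y * Q) := by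
    noncomm_ring
  rw [hleib, hX, hY, smul_mul_assoc, mul_smul_comm, ← add_smul]

-- The commutator eigenspaces of `Q` grade `End W`, and only finitely many of them are nonzero.
theorem isNilpotent_of_mem_filt {W : Type*} [AddCommGroup W] [Module ℂ W] [FiniteDimensional ℂ W]
    (ρ : E →ₗ[ℂ] End ℂ W) (Q : End ℂ W)
    (hρ : ∀ j : ℤ, ∀ x ∈ Γ j, Q * ρ x - ρ x * Q = (j : ℂ) • ρ x) {x : E} (hx : x ∈ filt Γ 1) :
    IsNilpotent (ρ x) := by
  let T : End ℂ (End ℂ W) := LinearMap.mulLeft ℂ Q - LinearMap.mulRight ℂ Q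
  let Δ : ℤ → Submodule ℂ (End ℂ W) := fun j => T.eigenspace (j : ℂ)
  have hind : iSupIndep Δ := T.eigenspaces_iSupIndep.comp Int.cast_injective
  have hmul : ∀ i j, ∀ X ∈ Δ i, ∀ Y ∈ Δ j, LinearMap.mul ℂ (End ℂ W) X Y ∈ Δ (i + j) := by
    intro i j X hX Y hY
    simpa only [Δ, Int.cast_add] using! mul_mem_eigenspace_commutator Q hX hY
  have hx1 : ρ x ∈ filt Δ 1 := by
    have := map_mem_filt (Γ' := Δ) (T := ρ) (i := 0) (fun j y hy => by
      rw [zero_add]; exact Module.End.mem_eigenspace_iff.2 (hρ j y hy)) hx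
    simpa using this
  have hpow : ∀ k : ℕ, ρ x ^ (k + 1) ∈ filt Δ ((k : ℤ) + 1) := by
    intro k
    induction k with
    | zero => simpa using hx1
    | succ k ih =>
      rw [pow_succ]
      push_cast
      exact bilinear_mem_filt hmul ih hx1
  obtain ⟨n, hn⟩ := exists_filt_eq_bot hind
  refine ⟨n + 1, ?_⟩
  have := filt_antitone (show (n : ℤ) ≤ n + 1 by omega) (hpow n)
  rwa [hn, Submodule.mem_bot] at this

variable (hΓ : DirectSum.IsInternal Γ)

/-- The projection to the homogeneous component `Γ j`, as an endomorphism of the whole space. -/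
def gproj (j : ℤ) : E →ₗ[ℂ] E :=
  (Γ j).subtype ∘ₗ DirectSum.component ℂ ℤ (fun i => Γ i) j ∘ₗ
    ((LinearEquiv.ofBijective (DirectSum.coeLinearMap Γ) hΓ).symm : E →ₗ[ℂ] _)

theorem gproj_mem (j : ℤ) (x : E) : gproj hΓ j x ∈ Γ j := Subtype.property _

theorem gproj_of_mem {i : ℤ} (j : ℤ) {x : E} (hx : x ∈ Γ i) :
    gproj hΓ j x = if i = j then x else 0 := by
  have h : (LinearEquiv.ofBijective (DirectSum.coeLinearMap Γ) hΓ).symm x =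
      DirectSum.lof ℂ ℤ (fun i => Γ i) i ⟨x, hx⟩ := by
    rw [LinearEquiv.symm_apply_eq]
    exact (DirectSum.coeLinearMap_lof Γ i ⟨x, hx⟩).symm
  simp only [gproj, LinearMap.comp_apply, LinearEquiv.coe_coe, h, DirectSum.component.of]
  split_ifs with hij
  · subst hij
    rfl
  · rfl

theorem gproj_same {j : ℤ} {x : E} (hx : x ∈ Γ j) : gproj hΓ j x = x := by
  simp [gproj_of_mem hΓ j hx]

theorem gproj_of_ne {i j : ℤ} (h : i ≠ j) {x : E} (hx : x ∈ Γ i) : gproj hΓ j x = 0 := by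
  simp [gproj_of_mem hΓ j hx, h]

include hΓ in
theorem linearMap_ext_of_homogeneous {S T : E →ₗ[ℂ] E'} (h : ∀ j, ∀ x ∈ Γ j, S x = T x) :
    S = T := by
  have : (⊤ : Submodule ℂ E) ≤ LinearMap.eqLocus S T := by
    rw [← hΓ.submodule_iSup_eq_top]
    exact iSup_le fun j x hx => h j x hx
  exact LinearMap.ext fun x => this trivial

theorem exists_sum_gproj [FiniteDimensional ℂ E] :
    ∃ s : Finset ℤ, ∀ x, ∑ j ∈ s, gproj hΓ j x = x := by
  have hfin := WellFoundedGT.finite_ne_bot_of_iSupIndep hΓ.submodule_iSupIndep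
  refine ⟨hfin.toFinset, fun x => ?_⟩
  have : ∑ j ∈ hfin.toFinset, gproj hΓ j = LinearMap.id := by
    refine linearMap_ext_of_homogeneous hΓ fun i x hx => ?_
    simp only [LinearMap.sum_apply, gproj_of_mem hΓ _ hx, Finset.sum_ite_eq, LinearMap.id_apply,
      Set.Finite.mem_toFinset]
    split_ifs with h
    · rfl
    · have h0 : Γ i = ⊥ := by simpa using h
      rw [h0, Submodule.mem_bot] at hx
      exact hx.symm
  simpa using LinearMap.congr_fun this x

theorem mem_of_forall_gproj_mem [FiniteDimensional ℂ E] {p : Submodule ℂ E} {x : E}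
    (h : ∀ j, gproj hΓ j x ∈ p) : x ∈ p := by
  obtain ⟨s, hs⟩ := exists_sum_gproj hΓ
  rw [← hs x]
  exact p.sum_mem fun j _ => h j

theorem gproj_eq_zero_of_mem_filt {d j : ℤ} (hj : j < d) {x : E} (hx : x ∈ filt Γ d) :
    gproj hΓ j x = 0 := by
  have : filt Γ d ≤ LinearMap.ker (gproj hΓ j) :=
    filt_le fun i hi y hy => gproj_of_ne hΓ (by omega) hy
  exact this hx

theorem mem_filt_of_gproj_eq_zero [FiniteDimensional ℂ E] {d : ℤ} {x : E}
    (h : ∀ j < d, gproj hΓ j x = 0) : x ∈ filt Γ d := by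
  refine mem_of_forall_gproj_mem hΓ fun j => ?_
  rcases lt_or_ge j d with hj | hj
  · rw [h j hj]
    exact zero_mem _
  · exact le_filt hj (gproj_mem hΓ j x)

/-- Graded subspaces: those containing the homogeneous components of their elements. -/
def IsHomogeneousSub (p : Submodule ℂ E) : Prop := ∀ j, ∀ x ∈ p, gproj hΓ j x ∈ p

theorem isHomogeneousSub_filt (d : ℤ) : IsHomogeneousSub hΓ (filt Γ d) := by
  intro j x hx
  rcases lt_or_ge j d with hj | hj
  · rw [gproj_eq_zero_of_mem_filt hΓ hj hx]
    exact zero_mem _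
  · exact le_filt hj (gproj_mem hΓ j x)

theorem IsHomogeneousSub.inf {p p' : Submodule ℂ E} (hp : IsHomogeneousSub hΓ p)
    (hp' : IsHomogeneousSub hΓ p') : IsHomogeneousSub hΓ (p ⊓ p') :=
  fun j x hx => ⟨hp j x hx.1, hp' j x hx.2⟩

theorem IsHomogeneousSub.sup {p p' : Submodule ℂ E} (hp : IsHomogeneousSub hΓ p)
    (hp' : IsHomogeneousSub hΓ p') : IsHomogeneousSub hΓ (p ⊔ p') := by
  intro j x hx
  obtain ⟨y, hy, z, hz, rfl⟩ := Submodule.mem_sup.1 hx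
  rw [map_add]
  exact Submodule.add_mem_sup (hp j y hy) (hp' j z hz)

theorem isHomogeneousSub_of_le {i : ℤ} {p : Submodule ℂ E} (hp : p ≤ Γ i) :
    IsHomogeneousSub hΓ p := by
  intro j x hx
  rw [gproj_of_mem hΓ j (hp hx)]
  split_ifs
  · exact hx
  · exact zero_mem _

theorem isHomogeneousSub_bot : IsHomogeneousSub hΓ (⊥ : Submodule ℂ E) := by
  intro j x hx
  rw [Submodule.mem_bot] at hx
  simp [hx]

theorem gproj_map {Γ' : ℤ → Submodule ℂ E'} (hΓ' : DirectSum.IsInternal Γ') (T : E →ₗ[ℂ] E')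
    {i : ℤ} (hT : ∀ j, ∀ x ∈ Γ j, T x ∈ Γ' (i + j)) (j : ℤ) (x : E) :
    gproj hΓ' (i + j) (T x) = T (gproj hΓ j x) := by
  have : gproj hΓ' (i + j) ∘ₗ T = T ∘ₗ gproj hΓ j := by
    refine linearMap_ext_of_homogeneous hΓ fun k x hx => ?_
    simp only [LinearMap.comp_apply, gproj_of_mem hΓ j hx, gproj_of_mem hΓ' _ (hT k x hx),
      add_right_inj]
    split_ifs <;> simp
  exact LinearMap.congr_fun this x

include hΓ in
theorem eq_zero_of_mem_filt_of_map_eq_zero [FiniteDimensional ℂ E] {T : E →ₗ[ℂ] E} {i : ℤ}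
    (hT : ∀ j, ∀ x ∈ Γ j, T x ∈ Γ (i + j)) {d : ℤ}
    (hinj : ∀ j, d ≤ j → ∀ x ∈ Γ j, T x = 0 → x = 0) {x : E} (hx : x ∈ filt Γ d)
    (hTx : T x = 0) : x = 0 := by
  rw [← Submodule.mem_bot ℂ]
  refine mem_of_forall_gproj_mem hΓ fun j => ?_
  rw [Submodule.mem_bot]
  rcases lt_or_ge j d with hj | hj
  · exact gproj_eq_zero_of_mem_filt hΓ hj hx
  · refine hinj j hj _ (gproj_mem hΓ j x) ?_
    rw [← gproj_map hΓ hΓ T hT, hTx, map_zero]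

theorem exists_gproj_eq_aeval [FiniteDimensional ℂ E] {T : End ℂ E}
    (hT : ∀ j : ℤ, ∀ x ∈ Γ j, T x = (j : ℂ) • x) (j : ℤ) :
    ∃ P : Polynomial ℂ, gproj hΓ j = Polynomial.aeval T P := by
  classical
  have hfin := WellFoundedGT.finite_ne_bot_of_iSupIndep hΓ.submodule_iSupIndep
  set s : Finset ℤ := insert j hfin.toFinset
  have hinj : Set.InjOn (fun i : ℤ => (i : ℂ)) s := Int.cast_injective.injOn
  refine ⟨Lagrange.basis s (fun i : ℤ => (i : ℂ)) j, ?_⟩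
  refine linearMap_ext_of_homogeneous hΓ fun i x hx => ?_
  by_cases h0 : x = 0
  · simp [h0]
  rw [gproj_of_mem hΓ j hx, Module.End.aeval_apply_of_hasEigenvector
    ⟨Module.End.mem_eigenspace_iff.2 (hT i x hx), h0⟩]
  split_ifs with hij
  · subst hij
    rw [Lagrange.eval_basis_self hinj (Finset.mem_insert_self _ _), one_smul]
  · have hi : Γ i ≠ ⊥ := fun h => h0 (by rwa [h, Submodule.mem_bot] at hx)
    rw [Lagrange.eval_basis_of_ne (Ne.symm hij)
      (Finset.mem_insert_of_mem (hfin.mem_toFinset.2 hi)), zero_smul]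

theorem isHomogeneousSub_of_stable [FiniteDimensional ℂ E] (T : End ℂ E)
    (hT : ∀ j : ℤ, ∀ x ∈ Γ j, T x = (j : ℂ) • x) {p : Submodule ℂ E} (hp : ∀ x ∈ p, T x ∈ p) :
    IsHomogeneousSub hΓ p := by
  intro j x hx
  obtain ⟨P, hP⟩ := exists_gproj_eq_aeval hΓ hT j
  rw [hP]
  exact Polynomial.aeval_apply_smul_mem_of_le_comap hx P T hp

-- As for Maschke's theorem, the homogeneous part of degree `0` of any projection onto `p` is again
-- a projection onto `p`.
theorem exists_isCompl_homogeneous [FiniteDimensional ℂ E] {p : Submodule ℂ E}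
    (hp : IsHomogeneousSub hΓ p) : ∃ C, IsHomogeneousSub hΓ C ∧ IsCompl p C := by
  obtain ⟨s, hs⟩ := exists_sum_gproj hΓ
  obtain ⟨π, hπ⟩ := p.subtype.exists_leftInverse_of_injective p.ker_subtype
  let σ : E →ₗ[ℂ] E := ∑ j ∈ s, gproj hΓ j ∘ₗ p.subtype ∘ₗ π ∘ₗ gproj hΓ j
  have hσ (x : E) : σ x = ∑ j ∈ s, gproj hΓ j (π (gproj hΓ j x)) := by
    simp [σ, LinearMap.sum_apply]
  have hσp (x : E) : σ x ∈ p := by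
    rw [hσ]
    exact p.sum_mem fun j _ => hp j _ (Subtype.property _)
  have hσid (x : p) : σ x = x := by
    rw [hσ]
    refine (Finset.sum_congr rfl fun j _ => ?_).trans (hs x)
    have hπj : (π (gproj hΓ j x) : E) = gproj hΓ j x :=
      congrArg Subtype.val (LinearMap.congr_fun hπ ⟨_, hp j x x.2⟩)
    rw [hπj, gproj_same hΓ (gproj_mem hΓ j _)]
  have hσg (k : ℤ) (x : E) : σ (gproj hΓ k x) = gproj hΓ k (σ x) := by
    rw [hσ, hσ, map_sum]
    refine Finset.sum_congr rfl fun j _ => ?_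
    rw [gproj_of_mem hΓ j (gproj_mem hΓ k x), gproj_of_mem hΓ k (gproj_mem hΓ j _)]
    by_cases hjk : j = k
    · subst hjk
      simp
    · simp [hjk, Ne.symm hjk]
  refine ⟨LinearMap.ker σ, fun j x hx => ?_, ?_⟩
  · rw [LinearMap.mem_ker] at hx ⊢
    rw [hσg, hx, map_zero]
  · rw [← LinearMap.ker_codRestrict p σ hσp]
    exact LinearMap.isCompl_of_proj fun x => Subtype.ext (hσid x)

end Filtration

section Exponential

variable {E : Type*} [AddCommGroup E] [Module ℂ E]

theorem nilExp_sub_mem {N : End ℂ E} {p : Submodule ℂ E} (hp : ∀ x ∈ p, N x ∈ p) {x : E}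
    (hx : N x ∈ p) : nilExp N x - x ∈ p := by
  have hpow (k : ℕ) : (N ^ (k + 1)) x ∈ p := by
    induction k with
    | zero => simpa using hx
    | succ k ih =>
      rw [pow_succ']
      exact hp _ ih
  rw [nilExp, Finset.sum_range_succ', LinearMap.add_apply]
  simp only [Nat.factorial_zero, Nat.cast_one, inv_one, pow_zero, one_smul, Module.End.one_apply,
    add_sub_cancel_right, LinearMap.sum_apply, LinearMap.smul_apply]
  exact p.sum_mem fun k _ => p.smul_mem _ (hpow k)

end Exponential

/-! ### The adjoint action on a graded Lie algebra -/

section LieFiltration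

variable {g : Type*} [LieRing g] [LieAlgebra ℂ g] {Γ : ℤ → Submodule ℂ g}

theorem lie_mem_filt (hlie : ∀ i j, ∀ x ∈ Γ i, ∀ y ∈ Γ j, ⁅x, y⁆ ∈ Γ (i + j)) {a b c : ℤ} {x y : g}
    (hx : x ∈ filt Γ a) (hy : y ∈ filt Γ b) (hc : c ≤ a + b) : ⁅x, y⁆ ∈ filt Γ c :=
  filt_antitone hc (bilinear_mem_filt (T := (LieAlgebra.ad ℂ g : g →ₗ[ℂ] End ℂ g)) hlie hx hy)

theorem ad_pow_mem_filt (hlie : ∀ i j, ∀ x ∈ Γ i, ∀ y ∈ Γ j, ⁅x, y⁆ ∈ Γ (i + j)) {d : ℤ} {x w : g}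
    (hx : x ∈ filt Γ 1) (hw : w ∈ filt Γ d) (k : ℕ) :
    (LieAlgebra.ad ℂ g x ^ k) w ∈ filt Γ (d + k) := by
  induction k with
  | zero => simpa using hw
  | succ k ih =>
    rw [pow_succ']
    exact lie_mem_filt hlie hx ih (by push_cast; omega)

theorem ad_pow_sub_mem_filt (hlie : ∀ i j, ∀ x ∈ Γ i, ∀ y ∈ Γ j, ⁅x, y⁆ ∈ Γ (i + j)) {d : ℤ}
    {x x' w w' : g} (hx : x ∈ filt Γ 1) (hx' : x' ∈ filt Γ 1) (hxx' : x - x' ∈ filt Γ (d + 2))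
    (hw : w ∈ filt Γ (-2)) (hww' : w - w' ∈ filt Γ d) (k : ℕ) :
    (LieAlgebra.ad ℂ g x ^ k) w - (LieAlgebra.ad ℂ g x' ^ k) w' ∈ filt Γ (d + k - 1) := by
  induction k with
  | zero => exact filt_antitone (by simp) hww'
  | succ k ih =>
    have h : (LieAlgebra.ad ℂ g x ^ (k + 1)) w - (LieAlgebra.ad ℂ g x' ^ (k + 1)) w' =
        ⁅x - x', (LieAlgebra.ad ℂ g x ^ k) w⁆ +
          ⁅x', (LieAlgebra.ad ℂ g x ^ k) w - (LieAlgebra.ad ℂ g x' ^ k) w'⁆ := by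
      rw [pow_succ', pow_succ']
      simp [lie_sub, sub_lie]
    rw [h]
    exact add_mem (lie_mem_filt hlie hxx' (ad_pow_mem_filt hlie hx hw k) (by push_cast; omega))
      (lie_mem_filt hlie hx' ih (by push_cast; omega))

theorem gproj_lie_of_mem (hΓ : DirectSum.IsInternal Γ)
    (hlie : ∀ i j, ∀ x ∈ Γ i, ∀ y ∈ Γ j, ⁅x, y⁆ ∈ Γ (i + j)) {i : ℤ} {f : g} (hf : f ∈ Γ i)
    (j : ℤ) (x : g) : gproj hΓ (i + j) ⁅f, x⁆ = ⁅f, gproj hΓ j x⁆ :=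
  gproj_map hΓ hΓ (LieAlgebra.ad ℂ g f) (fun j x hx => hlie i j f hf x hx) j x

variable [FiniteDimensional ℂ g]

theorem isNilpotent_ad_of_mem_filt {q : g} (hq : IsGradingElement Γ q) {x : g}
    (hx : x ∈ filt Γ 1) : IsNilpotent (LieAlgebra.ad ℂ g x) := by
  refine isNilpotent_of_mem_filt (Γ := Γ) (LieAlgebra.ad ℂ g : g →ₗ[ℂ] End ℂ g)
    (LieAlgebra.ad ℂ g q) (fun j y hy => ?_) hx
  have h := (hq j y).1 hy
  rw [← map_smul, ← h]
  ext z
  simp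

theorem nilExp_ad_sub_mem_filt (hlie : ∀ i j, ∀ x ∈ Γ i, ∀ y ∈ Γ j, ⁅x, y⁆ ∈ Γ (i + j)) {q : g}
    (hq : IsGradingElement Γ q) {d : ℤ} {f x x' w w' : g} (hf : f ∈ Γ (-2))
    (hx : x ∈ filt Γ 1) (hx' : x' ∈ filt Γ 1) (hxx' : x - x' ∈ filt Γ (d + 2))
    (hw : w - f ∈ filt Γ (-1)) (hww' : w - w' ∈ filt Γ d) :
    nilExp (LieAlgebra.ad ℂ g x) w - nilExp (LieAlgebra.ad ℂ g x') w' -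
      ((w - w') + ⁅x - x', f⁆) ∈ filt Γ (d + 1) := by
  obtain ⟨n, hn⟩ := isNilpotent_ad_of_mem_filt hq hx
  obtain ⟨n', hn'⟩ := isNilpotent_ad_of_mem_filt hq hx'
  have hw2 : w ∈ filt Γ (-2) := by
    rw [← sub_add_cancel w f]
    exact add_mem (filt_antitone (by omega) hw) (le_filt le_rfl hf)
  rw [nilExp_eq_sum (n := n + n' + 2) (pow_eq_zero_of_le (by omega) hn),
    nilExp_eq_sum (n := n + n' + 2) (pow_eq_zero_of_le (by omega) hn'), LinearMap.sum_apply,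
    LinearMap.sum_apply, ← Finset.sum_sub_distrib, Finset.sum_range_succ', Finset.sum_range_succ',
    add_assoc, add_sub_assoc]
  refine add_mem (Submodule.sum_mem _ fun k _ => ?_) ?_
  · rw [LinearMap.smul_apply, LinearMap.smul_apply, ← smul_sub]
    refine Submodule.smul_mem _ _ (filt_antitone ?_
      (ad_pow_sub_mem_filt hlie hx hx' hxx' hw2 hww' (k + 1 + 1)))
    push_cast
    omega
  · have h : ⁅x - x', w - f⁆ + ⁅x', w - w'⁆ ∈ filt Γ (d + 1) :=
      add_mem (lie_mem_filt hlie hxx' hw (by omega)) (lie_mem_filt hlie hx' hww' (by omega))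
    convert h using 1
    simp [lie_sub, sub_lie]
    abel

end LieFiltration

section AdjointMap

variable {g : Type*} [LieRing g] [LieAlgebra ℂ g] (Γ : ℤ → Submodule ℂ g) (f : g)
  (a b C : Submodule ℂ g)

/-- The displacement of `f` by the adjoint action: `(x, y, s) ↦ exp (ad x) exp (ad y) (f + s) - f`
on `a × b × C`. -/
def adjointMap (v : a × b × C) : g :=
  nilExp (LieAlgebra.ad ℂ g v.1) (nilExp (LieAlgebra.ad ℂ g v.2.1) (f + v.2.2)) - f

/-- The leading part `(x, y, s) ↦ s - [f, x] - [f, y]` of `adjointMap`. -/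
def adjointLin : a × b × C →ₗ[ℂ] g :=
  (-(LieAlgebra.ad ℂ g f ∘ₗ a.subtype)).coprod
    ((-(LieAlgebra.ad ℂ g f ∘ₗ b.subtype)).coprod C.subtype)

/-- The filtration of `a × b × C` by degree. The degree in `a` and `b` is shifted by `2`, the
degree lost by `ad f`, and the numbering is such that the filtration starts at `0`. -/
def degreeFilt (k : ℕ) : Submodule ℂ (a × b × C) :=
  ((filt Γ (k + 1)).comap a.subtype).prod
    (((filt Γ (k + 1)).comap b.subtype).prod ((filt Γ (k - 1)).comap C.subtype))

variable {Γ f a b C}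

theorem adjointLin_apply (v : a × b × C) :
    adjointLin f a b C v = (v.2.2 : g) + ⁅(v.1 : g), f⁆ + ⁅(v.2.1 : g), f⁆ := by
  rw [← lie_skew, ← lie_skew _ f]
  simp only [adjointLin, LinearMap.coprod_apply, LinearMap.neg_apply, LinearMap.comp_apply,
    Submodule.subtype_apply, LieAlgebra.ad_apply]
  abel

theorem mem_degreeFilt {k : ℕ} {v : a × b × C} : v ∈ degreeFilt Γ a b C k ↔
    (v.1 : g) ∈ filt Γ (k + 1) ∧ (v.2.1 : g) ∈ filt Γ (k + 1) ∧ (v.2.2 : g) ∈ filt Γ (k - 1) :=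
  Iff.rfl

theorem degreeFilt_zero (ha : a ≤ filt Γ 1) (hb : b ≤ filt Γ 1) (hC : C ≤ filt Γ (-1)) :
    degreeFilt Γ a b C 0 = ⊤ :=
  eq_top_iff.2 fun v _ => mem_degreeFilt.2
    ⟨by simpa using ha v.1.2, by simpa using hb v.2.1.2, by simpa using hC v.2.2.2⟩

theorem isMorphism_adjointMap [FiniteDimensional ℂ g] :
    IsMorphism (polyFun (a × b × C)) (polyFun g) (adjointMap f a b C) := by
  have hfst : IsMorphism (polyFun (a × b × C)) (polyFun g) fun v => (v.1 : g) :=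
    isMorphism_linear (a.subtype ∘ₗ LinearMap.fst ℂ a (b × C))
  have hsnd : IsMorphism (polyFun (a × b × C)) (polyFun g) fun v => (v.2.1 : g) :=
    isMorphism_linear (b.subtype ∘ₗ LinearMap.fst ℂ b C ∘ₗ LinearMap.snd ℂ a (b × C))
  have hthd : IsMorphism (polyFun (a × b × C)) (polyFun g) fun v => (v.2.2 : g) :=
    isMorphism_linear (C.subtype ∘ₗ LinearMap.snd ℂ b C ∘ₗ LinearMap.snd ℂ a (b × C))
  exact ((hfst.linear (LieAlgebra.ad ℂ g : g →ₗ[ℂ] End ℂ g)).nilExp.apply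
    ((hsnd.linear (LieAlgebra.ad ℂ g : g →ₗ[ℂ] End ℂ g)).nilExp.apply
      ((isMorphism_const f).add hthd))).sub (isMorphism_const f)

variable [FiniteDimensional ℂ g] (hΓ : DirectSum.IsInternal Γ)
  (hlie : ∀ i j, ∀ x ∈ Γ i, ∀ y ∈ Γ j, ⁅x, y⁆ ∈ Γ (i + j)) (hf : f ∈ Γ (-2))

include hΓ in
theorem exists_degreeFilt_eq_bot : ∃ n, degreeFilt Γ a b C n = ⊥ := by
  obtain ⟨n, hn⟩ := exists_filt_eq_bot hΓ.submodule_iSupIndep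
  refine ⟨n + 1, eq_bot_iff.2 fun v hv => ?_⟩
  have hbot {d : ℤ} (hd : (n : ℤ) ≤ d) : filt Γ d = ⊥ := eq_bot_iff.2 (hn ▸ filt_antitone hd)
  rw [mem_degreeFilt, hbot (by omega), hbot (by omega)] at hv
  simp only [Submodule.mem_bot, ZeroMemClass.coe_eq_zero] at hv
  exact Prod.ext hv.1 (Prod.ext hv.2.1 hv.2.2)

include hlie hf in
theorem mem_degreeFilt_succ_of_adjointLin_mem (ha : IsHomogeneousSub hΓ a)
    (hb : IsHomogeneousSub hΓ b) (hC : IsHomogeneousSub hΓ C)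
    (hinj : Function.Injective (adjointLin f a b C)) {k : ℕ} {v : a × b × C}
    (hv : adjointLin f a b C v ∈ filt Γ k) : v ∈ degreeFilt Γ a b C (k + 1) := by
  have hcomp (j : ℤ) (hj : j < k) : gproj hΓ (j + 2) (v.1 : g) = 0 ∧
      gproj hΓ (j + 2) (v.2.1 : g) = 0 ∧ gproj hΓ j (v.2.2 : g) = 0 := by
    have hproj (x : g) : gproj hΓ j ⁅x, f⁆ = ⁅gproj hΓ (j + 2) x, f⁆ := by
      rw [← lie_skew, map_neg, ← lie_skew _ f, ← gproj_lie_of_mem hΓ hlie hf]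
      congr 3
      omega
    let w : a × b × C := (⟨_, ha (j + 2) _ v.1.2⟩, ⟨_, hb (j + 2) _ v.2.1.2⟩, ⟨_, hC j _ v.2.2.2⟩)
    have hw : adjointLin f a b C w = 0 := by
      rw [← gproj_eq_zero_of_mem_filt hΓ hj hv, adjointLin_apply, adjointLin_apply, map_add,
        map_add, hproj, hproj]
    have hw0 : w = 0 := hinj (hw.trans (map_zero _).symm)
    exact ⟨congrArg (fun u : a × b × C => (u.1 : g)) hw0,
      congrArg (fun u : a × b × C => (u.2.1 : g)) hw0,
      congrArg (fun u : a × b × C => (u.2.2 : g)) hw0⟩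
  rw [mem_degreeFilt]
  push_cast
  refine ⟨mem_filt_of_gproj_eq_zero hΓ fun j hj => ?_,
    mem_filt_of_gproj_eq_zero hΓ fun j hj => ?_, mem_filt_of_gproj_eq_zero hΓ fun j hj => ?_⟩
  · simpa using (hcomp (j - 2) (by omega)).1
  · simpa using (hcomp (j - 2) (by omega)).2.1
  · exact (hcomp j (by omega)).2.2

include hlie hf in
theorem adjointMap_sub_adjointMap_sub_mem_filt {q : g} (hq : IsGradingElement Γ q)
    (ha : a ≤ filt Γ 1) (hb : b ≤ filt Γ 1) (hC : C ≤ filt Γ (-1)) {k : ℕ} {v v' : a × b × C}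
    (hv : v - v' ∈ degreeFilt Γ a b C k) :
    adjointMap f a b C v - adjointMap f a b C v' - adjointLin f a b C (v - v') ∈ filt Γ k := by
  obtain ⟨hx, hy, hs⟩ := mem_degreeFilt.1 hv
  have hk : (k : ℤ) - 1 + 2 = k + 1 := by omega
  simp only [Prod.fst_sub, Prod.snd_sub, Submodule.coe_sub, ← hk] at hx hy hs
  have hf' : f ∈ filt Γ (-2) := le_filt le_rfl hf
  have hfs : (f + v.2.2 : g) - f ∈ filt Γ (-1) := by simpa using hC v.2.2.2
  have hss : (f + v.2.2 : g) - (f + v'.2.2) ∈ filt Γ (k - 1) := by simpa using hs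
  have hinner := nilExp_ad_sub_mem_filt hlie hq hf (hb v.2.1.2) (hb v'.2.1.2) hy hfs hss
  set w := nilExp (LieAlgebra.ad ℂ g (v.2.1 : g)) (f + v.2.2)
  set w' := nilExp (LieAlgebra.ad ℂ g (v'.2.1 : g)) (f + v'.2.2)
  have hw : w - f ∈ filt Γ (-1) := by
    rw [← sub_add_sub_cancel w (f + v.2.2 : g) f]
    refine add_mem (nilExp_sub_mem (fun y hy => lie_mem_filt hlie (hb v.2.1.2) hy (by omega))
      (lie_mem_filt hlie (hb v.2.1.2) (add_mem hf' ?_) (by omega))) hfs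
    exact filt_antitone (by omega) (hC v.2.2.2)
  have hww : w - w' ∈ filt Γ (k - 1) := by
    simpa using add_mem (filt_antitone (by omega) hinner)
      (add_mem hss (lie_mem_filt hlie hy hf' (by omega)))
  have houter := nilExp_ad_sub_mem_filt hlie hq hf (ha v.1.2) (ha v'.1.2) hx hw hww
  rw [sub_add_cancel] at hinner houter
  convert add_mem hinner houter using 1
  rw [adjointLin_apply]
  simp only [adjointMap, Prod.fst_sub, Prod.snd_sub, Submodule.coe_sub, w, w']
  abel

include hlie hf in
theorem exists_inverse_adjointMap {q : g} (hq : IsGradingElement Γ q)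
    (ha : a ≤ filt Γ 1) (hb : b ≤ filt Γ 1) (hC : C ≤ filt Γ (-1)) (ha' : IsHomogeneousSub hΓ a)
    (hb' : IsHomogeneousSub hΓ b) (hC' : IsHomogeneousSub hΓ C)
    (hinj : Function.Injective (adjointLin f a b C))
    (hmem : ∀ v, adjointMap f a b C v ∈ LinearMap.range (adjointLin f a b C)) :
    ∃ T : g → a × b × C, IsMorphism (polyFun g) (polyFun (a × b × C)) T ∧
      (∀ z ∈ LinearMap.range (adjointLin f a b C), adjointMap f a b C (T z) = z) ∧
      ∀ v, T (adjointMap f a b C v) = v := by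
  obtain ⟨n, hn⟩ := exists_degreeFilt_eq_bot (a := a) (b := b) (C := C) hΓ
  exact exists_inverse_of_leadingPart (F := fun k => filt Γ k) (degreeFilt_zero ha hb hC) hn hinj
    (fun _ _ => mem_degreeFilt_succ_of_adjointLin_mem hΓ hlie hf ha' hb' hC' hinj)
    isMorphism_adjointMap hmem
    fun _ _ _ => adjointMap_sub_adjointMap_sub_mem_filt hlie hf hq ha hb hC

end AdjointMap

/-! ### Invariant forms and good algebras -/

section InvariantForm

variable {g : Type*} [LieRing g] [LieAlgebra ℂ g] {B : LinearMap.BilinForm ℂ g}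

theorem form_lie_left (hBinv : B.lieInvariant g) (x y z : g) : B ⁅x, y⁆ z = B x ⁅y, z⁆ := by
  rw [← lie_skew, map_neg, LinearMap.neg_apply, hBinv, neg_neg]

variable (B) in
/-- The orthogonal of a subspace for the form `B`. -/
def perp (a : Submodule ℂ g) : Submodule ℂ g := a.dualAnnihilator.comap B

theorem mem_perp {a : Submodule ℂ g} {z : g} : z ∈ perp B a ↔ ∀ x ∈ a, B z x = 0 := by
  simp [perp, Submodule.mem_dualAnnihilator]

variable {Γ : ℤ → Submodule ℂ g} {q : g}

theorem form_eq_zero_of_mem (hBinv : B.lieInvariant g) (hq : IsGradingElement Γ q) {i j : ℤ}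
    (hij : i + j ≠ 0) {x y : g} (hx : x ∈ Γ i) (hy : y ∈ Γ j) : B x y = 0 := by
  have h := hBinv q x y
  rw [(hq i x).1 hx, (hq j y).1 hy, map_smul, map_smul, LinearMap.smul_apply, smul_eq_mul,
    smul_eq_mul, eq_neg_iff_add_eq_zero, ← add_mul] at h
  refine (mul_eq_zero.1 h).resolve_left ?_
  exact_mod_cast hij

theorem form_eq_zero_of_mem_filt (hBinv : B.lieInvariant g) (hq : IsGradingElement Γ q) {i d : ℤ}
    (hid : 0 < i + d) {x y : g} (hx : x ∈ Γ i) (hy : y ∈ filt Γ d) : B x y = 0 := by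
  have : filt Γ d ≤ LinearMap.ker (B x) :=
    filt_le fun j hj y hy => form_eq_zero_of_mem hBinv hq (by omega) hx hy
  exact this hy

theorem form_gproj (hBinv : B.lieInvariant g) (hq : IsGradingElement Γ q)
    (hΓ : DirectSum.IsInternal Γ) (j : ℤ) (x y : g) :
    B (gproj hΓ j x) y = B x (gproj hΓ (-j) y) := by
  have : B ∘ₗ gproj hΓ j = B.compl₂ (gproj hΓ (-j)) := by
    refine linearMap_ext_of_homogeneous hΓ fun i x hx => ?_
    refine linearMap_ext_of_homogeneous hΓ fun k y hy => ?_
    simp only [LinearMap.comp_apply, LinearMap.compl₂_apply, gproj_of_mem hΓ _ hx,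
      gproj_of_mem hΓ _ hy]
    split_ifs with h1 h2 h2
    · rfl
    · rw [map_zero]
      exact form_eq_zero_of_mem hBinv hq (by omega) hx hy
    · rw [map_zero, LinearMap.zero_apply]
      exact (form_eq_zero_of_mem hBinv hq (by omega) hx hy).symm
    · simp
  exact LinearMap.congr_fun (LinearMap.congr_fun this x) y

theorem isHomogeneousSub_perp (hBinv : B.lieInvariant g) (hq : IsGradingElement Γ q)
    (hΓ : DirectSum.IsInternal Γ) {a : Submodule ℂ g} (ha : IsHomogeneousSub hΓ a) :
    IsHomogeneousSub hΓ (perp B a) := by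
  intro j x hx
  rw [mem_perp] at hx ⊢
  intro y hy
  rw [form_gproj hBinv hq]
  exact hx _ (ha _ _ hy)

end InvariantForm

section SlTwo

variable {L M : Type*} [LieRing L] [LieAlgebra ℂ L] [AddCommGroup M] [Module ℂ M]
  [LieRingModule L M] [LieModule ℂ L M] {h e f : L}

theorem isNilpotent_toEnd_of_lie_eq_smul [FiniteDimensional ℂ M] {q x : L} {j : ℤ} (hj : 1 ≤ j)
    (hx : ⁅q, x⁆ = (j : ℂ) • x) : IsNilpotent (LieModule.toEnd ℂ L M x) := by
  refine isNilpotent_of_mem_filt (Γ := fun i : ℤ => (LieAlgebra.ad ℂ L q).eigenspace (i : ℂ))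
    (LieModule.toEnd ℂ L M : L →ₗ[ℂ] End ℂ M) (LieModule.toEnd ℂ L M q) (fun i y hy => ?_)
    (le_filt hj (Module.End.mem_eigenspace_iff.2 hx))
  rw [← map_smul, ← Module.End.mem_eigenspace_iff.1 hy]
  ext z
  simp

theorem lie_f_toEnd_e_pow_succ (hsl : IsSl2Triple h e f) {u : M} {c : ℂ} (hu : ⁅h, u⁆ = c • u)
    (hefu : ⁅e, ⁅f, u⁆⁆ = 0) (k : ℕ) : ⁅f, (LieModule.toEnd ℂ L M e ^ (k + 1)) u⁆ =
      -(((k : ℂ) + 1) * (c + k)) • (LieModule.toEnd ℂ L M e ^ k) u := by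
  have hcomm (y : M) : ⁅f, ⁅e, y⁆⁆ = ⁅e, ⁅f, y⁆⁆ - ⁅h, y⁆ := by
    rw [leibniz_lie e f y, hsl.lie_e_f]
    abel
  induction k with
  | zero => simp [hcomm, hefu, hu]
  | succ k ih =>
    rw [pow_succ' _ (k + 1), Module.End.mul_apply, LieModule.toEnd_apply_apply, hcomm, ih, lie_smul,
      hsl.lie_h_pow_toEnd_e hu, IsSl2Triple.lie_e_pow_toEnd_e, ← sub_smul]
    congr 1
    push_cast
    ring

-- If `⁅f, u⁆` were nonzero, it would be a highest weight vector, so `c ≥ 2`, and then no power of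
-- `e` would annihilate `u`.
theorem lie_f_eq_zero_of_lie_e_lie_f_eq_zero [FiniteDimensional ℂ M] (hsl : IsSl2Triple h e f)
    {u : M} {c : ℂ} (hu : ⁅h, u⁆ = c • u) (hefu : ⁅e, ⁅f, u⁆⁆ = 0) : ⁅f, u⁆ = 0 := by
  by_contra hfu
  have hprim : hsl.HasPrimitiveVectorWith ⁅f, u⁆ (c - 2) := by
    refine ⟨hfu, ?_, hefu⟩
    rw [leibniz_lie, hsl.lie_lie_smul_f ℂ, hu, lie_smul, neg_lie, smul_lie, sub_smul]
    abel
  obtain ⟨n, hn⟩ := hprim.exists_nat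
  have hpow (k : ℕ) : (LieModule.toEnd ℂ L M e ^ k) u ≠ 0 := by
    induction k with
    | zero =>
      rintro h0
      exact hfu (by rw [show u = 0 from h0, lie_zero])
    | succ k ih =>
      intro h0
      have hcoeff : -(((k : ℂ) + 1) * (c + k)) = -(((k + 1) * (n + 2 + k) : ℕ) : ℂ) := by
        rw [sub_eq_iff_eq_add.1 hn]
        push_cast
        ring
      have hlie := lie_f_toEnd_e_pow_succ hsl hu hefu k
      rw [h0, lie_zero, eq_comm, smul_eq_zero, hcoeff, neg_eq_zero, Nat.cast_eq_zero] at hlie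
      exact hlie.elim (by positivity) ih
  obtain ⟨k, hk⟩ := isNilpotent_toEnd_of_lie_eq_smul (M := M) (q := h) (x := e) (j := 2)
    (by omega) (by rw [hsl.lie_h_e_smul ℂ, Int.cast_ofNat])
  exact hpow k (by rw [hk, LinearMap.zero_apply])

end SlTwo

section GoodAlgebras

variable {g : Type*} [LieRing g] [LieAlgebra ℂ g] {B : LinearMap.BilinForm ℂ g}
variable {Γ : ℤ → Submodule ℂ g} {f q : g} {m : LieSubalgebra ℂ g}

theorem IsGoodAlgebra.le_filt_one {χ : Dual ℂ g} (hm : IsGoodAlgebra Γ χ m) :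
    m.toSubmodule ≤ filt Γ 1 := by
  obtain ⟨l, hl, hm⟩ := hm
  rw [hm]
  refine sup_le (fun x hx => le_filt le_rfl ((hl x).1 hx).1) (filt_antitone (by omega))

theorem IsGoodAlgebra.filt_two_le {χ : Dual ℂ g} (hm : IsGoodAlgebra Γ χ m) :
    filt Γ 2 ≤ m.toSubmodule := by
  obtain ⟨_, _, hm⟩ := hm
  rw [hm]
  exact le_sup_right

theorem IsGoodAlgebra.isHomogeneousSub {χ : Dual ℂ g} (hm : IsGoodAlgebra Γ χ m)
    (hΓ : DirectSum.IsInternal Γ) : IsHomogeneousSub hΓ m.toSubmodule := by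
  obtain ⟨l, hl, hm⟩ := hm
  rw [hm]
  exact IsHomogeneousSub.sup hΓ (isHomogeneousSub_of_le hΓ fun x hx => ((hl x).1 hx).1)
    (isHomogeneousSub_filt hΓ 2)

theorem IsGoodAlgebra.form_lie_eq_zero (hm : IsGoodAlgebra Γ (B f) m) (hBinv : B.lieInvariant g)
    (hq : IsGradingElement Γ q) (hΓ : IsGoodGrading Γ f) {x y : g} (hx : x ∈ m) (hy : y ∈ m) :
    B f ⁅x, y⁆ = 0 := by
  have hx1 := hm.le_filt_one hx
  obtain ⟨l, hl, hm'⟩ := hm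
  rw [← LieSubalgebra.mem_toSubmodule, hm'] at hx hy
  obtain ⟨u, hu, v, hv, rfl⟩ := Submodule.mem_sup.1 hx
  obtain ⟨u', hu', v', hv', rfl⟩ := Submodule.mem_sup.1 hy
  have hv2 : v ∈ filt Γ 2 := hv
  have hv2' : v' ∈ filt Γ 2 := hv'
  have hu1 := ((hl u').1 hu').1
  rw [lie_add, map_add, add_lie, map_add, ((hl u).1 hu).2 u' hu',
    form_eq_zero_of_mem_filt hBinv hq (d := 3) (by omega) hΓ.mem
      (lie_mem_filt hΓ.lie_mem hv2 (le_filt le_rfl hu1) (by omega)),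
    form_eq_zero_of_mem_filt hBinv hq (d := 3) (by omega) hΓ.mem
      (lie_mem_filt hΓ.lie_mem hx1 hv2' (by omega))]
  simp

theorem lie_mem_perp_of_mem (hBinv : B.lieInvariant g) {x z : g} (hx : x ∈ m)
    (hz : z ∈ perp B m.toSubmodule) : ⁅x, z⁆ ∈ perp B m.toSubmodule := by
  rw [mem_perp] at hz ⊢
  intro y hy
  rw [hBinv, hz _ (m.lie_mem hx hy), neg_zero]

theorem IsGoodAlgebra.lie_mem_perp (hm : IsGoodAlgebra Γ (B f) m) (hBinv : B.lieInvariant g)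
    (hq : IsGradingElement Γ q) (hΓ : IsGoodGrading Γ f) {x : g} (hx : x ∈ m) :
    ⁅x, f⁆ ∈ perp B m.toSubmodule := by
  rw [mem_perp]
  intro y hy
  rw [hBinv, hm.form_lie_eq_zero hBinv hq hΓ hx hy, neg_zero]

theorem IsGoodAlgebra.nilExp_sub_mem_perp (hm : IsGoodAlgebra Γ (B f) m)
    (hBinv : B.lieInvariant g) (hq : IsGradingElement Γ q) (hΓ : IsGoodGrading Γ f) {x z : g}
    (hx : x ∈ m) (hz : z - f ∈ perp B m.toSubmodule) :
    nilExp (LieAlgebra.ad ℂ g x) z - f ∈ perp B m.toSubmodule := by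
  have h : nilExp (LieAlgebra.ad ℂ g x) z - z ∈ perp B m.toSubmodule := by
    refine nilExp_sub_mem (fun y hy => lie_mem_perp_of_mem hBinv hx hy) ?_
    have := add_mem (lie_mem_perp_of_mem hBinv hx hz) (hm.lie_mem_perp hBinv hq hΓ hx)
    rwa [← lie_add, sub_add_cancel] at this
  simpa using add_mem h hz

variable {e h : g}

theorem IsGradedTriple.isSl2Triple (ht : IsGradedTriple Γ e h f) (hf : f ≠ 0) :
    IsSl2Triple h e f := by
  refine ⟨?_, ht.lie_e_f, by rw [ht.lie_h_e, two_smul, two_nsmul],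
    by rw [ht.lie_h_f, two_smul, two_nsmul]⟩
  rintro rfl
  have hlie := ht.lie_h_f
  rw [zero_lie, eq_comm, neg_eq_zero, smul_eq_zero] at hlie
  exact hf (hlie.resolve_left two_ne_zero)

theorem IsGradedTriple.isHomogeneousSub_ker (ht : IsGradedTriple Γ e h f)
    (hΓ : IsGoodGrading Γ f) :
    IsHomogeneousSub hΓ.internal (LinearMap.ker (LieAlgebra.ad ℂ g e)) := by
  intro j x hx
  rw [LinearMap.mem_ker, LieAlgebra.ad_apply] at hx ⊢
  rw [← gproj_lie_of_mem hΓ.internal hΓ.lie_mem ht.e_mem, hx, map_zero]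

theorem IsGradedTriple.lie_lie_mem (ht : IsGradedTriple Γ e h f) (hΓ : IsGoodGrading Γ f) {j : ℤ}
    {x : g} (hx : x ∈ Γ j) : ⁅e, ⁅f, x⁆⁆ ∈ Γ j := by
  simpa using hΓ.lie_mem _ _ e ht.e_mem _ (hΓ.lie_mem _ _ f hΓ.mem x hx)

theorem IsGradedTriple.lie_lie_lie_eq_zero (ht : IsGradedTriple Γ e h f) {x : g}
    (hx : ⁅e, ⁅f, x⁆⁆ = 0) : ⁅e, ⁅f, ⁅h, x⁆⁆⁆ = 0 := by
  have hfh : ⁅f, ⁅h, x⁆⁆ = ⁅h, ⁅f, x⁆⁆ + (2 : ℂ) • ⁅f, x⁆ := by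
    rw [leibniz_lie h f x, ht.lie_h_f, neg_lie, smul_lie]
    abel
  have heh := leibniz_lie h e ⁅f, x⁆
  rw [ht.lie_h_e, smul_lie, hx, lie_zero, smul_zero, zero_add] at heh
  rw [hfh, lie_add, lie_smul, ← heh, hx, smul_zero, add_zero]

variable [FiniteDimensional ℂ g]

theorem IsGoodGrading.eq_zero_of_lie_eq_zero (hΓ : IsGoodGrading Γ f) {x : g} (hx : x ∈ filt Γ 1)
    (h : ⁅f, x⁆ = 0) : x = 0 :=
  eq_zero_of_mem_filt_of_map_eq_zero hΓ.internal (T := LieAlgebra.ad ℂ g f)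
    (fun _ x hx => hΓ.lie_mem _ _ f hΓ.mem x hx) hΓ.injective hx h

theorem IsGoodAlgebra.perp_le (hm : IsGoodAlgebra Γ (B f) m) (hB : B.Nondegenerate)
    (hBinv : B.lieInvariant g) (hq : IsGradingElement Γ q) (hΓ : DirectSum.IsInternal Γ) :
    perp B m.toSubmodule ≤ filt Γ (-1) := by
  intro z hz
  refine mem_filt_of_gproj_eq_zero hΓ fun j hj => ?_
  refine hB.1 _ fun y => ?_
  rw [form_gproj hBinv hq]
  exact mem_perp.1 hz _ (hm.filt_two_le (le_filt (by omega) (gproj_mem hΓ (-j) y)))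

-- `ad h` has an eigenvector in the kernel of `ad e ∘ ad f` on `Γ j`, if this is nonzero.
theorem IsGradedTriple.eq_zero_of_lie_lie_eq_zero (ht : IsGradedTriple Γ e h f)
    (hΓ : IsGoodGrading Γ f) {j : ℤ} (hj : 1 ≤ j) {x : g} (hx : x ∈ Γ j)
    (hefx : ⁅e, ⁅f, x⁆⁆ = 0) : x = 0 := by
  by_cases hf : f = 0
  · exact hΓ.injective j hj x hx (by rw [hf, zero_lie])
  by_contra hx0
  let W : Submodule ℂ g := Γ j ⊓ LinearMap.ker (LieAlgebra.ad ℂ g e ∘ₗ LieAlgebra.ad ℂ g f)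
  have hW (y : g) : y ∈ W ↔ y ∈ Γ j ∧ ⁅e, ⁅f, y⁆⁆ = 0 := by
    simp [W]
  have hstable : ∀ y ∈ W, LieAlgebra.ad ℂ g h y ∈ W := by
    intro y hy
    rw [hW] at hy ⊢
    exact ⟨by simpa using hΓ.lie_mem 0 j h ht.h_mem y hy.1, ht.lie_lie_lie_eq_zero hy.2⟩
  have : Nontrivial W :=
    ⟨⟨x, (hW x).2 ⟨hx, hefx⟩⟩, 0, fun h0 => hx0 (congrArg Subtype.val h0)⟩
  obtain ⟨c, hc⟩ := Module.End.exists_eigenvalue ((LieAlgebra.ad ℂ g h).restrict hstable)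
  obtain ⟨⟨u, huW⟩, hu⟩ := hc.exists_hasEigenvector
  obtain ⟨huj, hefu⟩ := (hW u).1 huW
  have hhu : ⁅h, u⁆ = c • u := congrArg Subtype.val hu.apply_eq_smul
  exact hu.2 (Subtype.ext (hΓ.injective j hj u huj
    (lie_f_eq_zero_of_lie_e_lie_f_eq_zero (ht.isSl2Triple hf) hhu hefu)))

theorem IsGradedTriple.exists_lie_lie_eq (ht : IsGradedTriple Γ e h f) (hΓ : IsGoodGrading Γ f)
    {j : ℤ} (hj : 1 ≤ j) {y : g} (hy : y ∈ Γ j) : ∃ x ∈ Γ j, ⁅e, ⁅f, x⁆⁆ = y := by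
  have hstable : ∀ x ∈ Γ j, (LieAlgebra.ad ℂ g e ∘ₗ LieAlgebra.ad ℂ g f) x ∈ Γ j :=
    fun x hx => ht.lie_lie_mem hΓ hx
  have hinj : Function.Injective
      ((LieAlgebra.ad ℂ g e ∘ₗ LieAlgebra.ad ℂ g f).restrict hstable) := by
    rw [← LinearMap.ker_eq_bot, LinearMap.ker_eq_bot']
    intro x hx
    exact Subtype.ext (ht.eq_zero_of_lie_lie_eq_zero hΓ hj x.2 (congrArg Subtype.val hx))
  obtain ⟨x, hx⟩ := LinearMap.surjective_of_injective hinj ⟨y, hy⟩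
  exact ⟨x, x.2, congrArg Subtype.val hx⟩

theorem IsGradedTriple.ker_le_perp (ht : IsGradedTriple Γ e h f) (hΓ : IsGoodGrading Γ f)
    (hm : IsGoodAlgebra Γ (B f) m) (hBinv : B.lieInvariant g) :
    LinearMap.ker (LieAlgebra.ad ℂ g e) ≤ perp B m.toSubmodule := by
  intro z hz
  rw [mem_perp]
  intro x hx
  have : filt Γ 1 ≤ LinearMap.ker (B z) := by
    refine filt_le fun j hj x hx => ?_
    obtain ⟨y, -, rfl⟩ := ht.exists_lie_lie_eq hΓ hj hx
    have hz' : ⁅e, z⁆ = 0 := hz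
    rw [LinearMap.mem_ker, ← neg_neg (B z _), ← hBinv, hz']
    simp
  exact this (hm.le_filt_one hx)

theorem IsGradedTriple.perp_le_sup (ht : IsGradedTriple Γ e h f) (hΓ : IsGoodGrading Γ f)
    (hm : IsGoodAlgebra Γ (B f) m) (hB : B.Nondegenerate) (hBinv : B.lieInvariant g)
    (hq : IsGradingElement Γ q) :
    perp B m.toSubmodule ≤ LinearMap.ker (LieAlgebra.ad ℂ g e) ⊔
      m.toSubmodule.map (LieAlgebra.ad ℂ g f) := by
  intro z hz
  have hgr := isHomogeneousSub_perp hBinv hq hΓ.internal (hm.isHomogeneousSub hΓ.internal)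
  refine mem_of_forall_gproj_mem hΓ.internal fun j => ?_
  have hzj := gproj_mem hΓ.internal j z
  have hzp := hgr j z hz
  set y := gproj hΓ.internal j z
  rcases lt_or_ge j (-1) with hj | hj
  · have : y = 0 := gproj_eq_zero_of_mem_filt hΓ.internal hj
      (hm.perp_le hB hBinv hq hΓ.internal hz)
    rw [this]
    exact zero_mem _
  rcases hj.eq_or_lt with hj | hj
  · refine Submodule.mem_sup_right ?_
    subst hj
    obtain ⟨w, hw, hwy⟩ := hΓ.surjective 1 le_rfl y hzj
    refine ⟨w, ?_, hwy⟩
    obtain ⟨l, hl, hm'⟩ := hm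
    rw [hm', SetLike.mem_coe]
    refine Submodule.mem_sup_left ((hl w).2 ⟨hw, fun v hv => ?_⟩)
    rw [← form_lie_left hBinv, hwy]
    exact mem_perp.1 hzp v (hm' ▸ Submodule.mem_sup_left hv)
  · obtain ⟨w, hw, hwy⟩ := ht.exists_lie_lie_eq hΓ (show 1 ≤ 2 + j by omega)
      (hΓ.lie_mem _ _ e ht.e_mem y hzj)
    refine Submodule.mem_sup.2 ⟨y - ⁅f, w⁆, ?_, ⁅f, w⁆, ⟨w, ?_, rfl⟩, by abel⟩
    · rw [LinearMap.mem_ker, LieAlgebra.ad_apply, lie_sub, hwy, sub_self]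
    · exact hm.filt_two_le (le_filt (by omega) hw)

theorem IsGradedTriple.disjoint (ht : IsGradedTriple Γ e h f) (hΓ : IsGoodGrading Γ f)
    {x : g} (hx : x ∈ filt Γ 1) (hefx : ⁅e, ⁅f, x⁆⁆ = 0) : x = 0 :=
  eq_zero_of_mem_filt_of_map_eq_zero hΓ.internal (i := 0)
    (T := LieAlgebra.ad ℂ g e ∘ₗ LieAlgebra.ad ℂ g f)
    (fun j x hx => by simpa using ht.lie_lie_mem hΓ hx)
    (fun _ hj _ hx => ht.eq_zero_of_lie_lie_eq_zero hΓ hj hx) hx hefx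

end GoodAlgebras

section GradedComplement

variable {g : Type*} [LieRing g] [LieAlgebra ℂ g] {B : LinearMap.BilinForm ℂ g}
  {Γ : ℤ → Submodule ℂ g} {f q e h : g} {m : LieSubalgebra ℂ g} {a b C : Submodule ℂ g}

/-- `C` is a graded complement of `⁅f, m⁆` in the orthogonal of `m`. The field `eq_zero` combines
the injectivity of `ad f` on `m` with the independence of `C` and `⁅f, m⁆`. -/
structure IsGradedComplement (hΓ : DirectSum.IsInternal Γ) (B : LinearMap.BilinForm ℂ g) (f : g)
    (m : LieSubalgebra ℂ g) (C : Submodule ℂ g) : Prop where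
  isHomogeneousSub : IsHomogeneousSub hΓ C
  le_perp : C ≤ perp B m.toSubmodule
  perp_le : perp B m.toSubmodule ≤ C ⊔ m.toSubmodule.map (LieAlgebra.ad ℂ g f)
  eq_zero : ∀ x ∈ m, ⁅f, x⁆ ∈ C → x = 0

theorem IsGradedComplement.adjointLin_injective {hΓ : DirectSum.IsInternal Γ}
    (hC : IsGradedComplement hΓ B f m C) (hsum : a ⊔ b = m.toSubmodule) (hdisj : Disjoint a b) :
    Function.Injective (adjointLin f a b C) := by
  rw [← LinearMap.ker_eq_bot, LinearMap.ker_eq_bot']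
  rintro ⟨x, y, s⟩ hker
  rw [adjointLin_apply, ← lie_skew, ← lie_skew _ f, add_assoc, ← neg_add, ← lie_add,
    ← sub_eq_add_neg, sub_eq_zero] at hker
  have hxy : (x : g) + y = 0 := by
    refine hC.eq_zero _ ?_ (hker ▸ s.2)
    rw [← LieSubalgebra.mem_toSubmodule, ← hsum]
    exact Submodule.add_mem_sup x.2 y.2
  have hx : (x : g) = 0 := by
    refine Submodule.disjoint_def.1 hdisj x x.2 ?_
    rw [eq_neg_of_add_eq_zero_left hxy]
    exact b.neg_mem y.2
  rw [hxy, lie_zero] at hker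
  rw [hx, zero_add] at hxy
  exact Prod.ext (Subtype.ext hx) (Prod.ext (Subtype.ext hxy) (Subtype.ext hker))

theorem IsGradedComplement.range_adjointLin (hΓ : IsGoodGrading Γ f)
    (hC : IsGradedComplement hΓ.internal B f m C) (hm : IsGoodAlgebra Γ (B f) m)
    (hBinv : B.lieInvariant g) (hq : IsGradingElement Γ q) (hsum : a ⊔ b = m.toSubmodule) :
    LinearMap.range (adjointLin f a b C) = perp B m.toSubmodule := by
  have ham : a ≤ m.toSubmodule := hsum ▸ le_sup_left
  have hbm : b ≤ m.toSubmodule := hsum ▸ le_sup_right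
  apply le_antisymm
  · rintro _ ⟨⟨x, y, s⟩, rfl⟩
    rw [adjointLin_apply]
    exact add_mem (add_mem (hC.le_perp s.2) (hm.lie_mem_perp hBinv hq hΓ (ham x.2)))
      (hm.lie_mem_perp hBinv hq hΓ (hbm y.2))
  · intro z hz
    obtain ⟨s, hs, _, ⟨w, hw, rfl⟩, rfl⟩ := Submodule.mem_sup.1 (hC.perp_le hz)
    rw [← hsum] at hw
    obtain ⟨x, hx, y, hy, rfl⟩ := Submodule.mem_sup.1 hw
    refine ⟨(-⟨x, hx⟩, -⟨y, hy⟩, ⟨s, hs⟩), ?_⟩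
    rw [adjointLin_apply, LieAlgebra.ad_apply, lie_add, add_assoc]
    simp

theorem IsGradedComplement.adjointMap_mem_perp (hΓ : IsGoodGrading Γ f)
    (hC : IsGradedComplement hΓ.internal B f m C) (hm : IsGoodAlgebra Γ (B f) m)
    (hBinv : B.lieInvariant g) (hq : IsGradingElement Γ q) (ha : a ≤ m.toSubmodule)
    (hb : b ≤ m.toSubmodule) (v : a × b × C) :
    adjointMap f a b C v ∈ perp B m.toSubmodule := by
  refine hm.nilExp_sub_mem_perp hBinv hq hΓ (ha v.1.2)
    (hm.nilExp_sub_mem_perp hBinv hq hΓ (hb v.2.1.2) ?_)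
  simpa using hC.le_perp v.2.2.2

variable [FiniteDimensional ℂ g]

theorem IsGradedTriple.isGradedComplement (ht : IsGradedTriple Γ e h f) (hΓ : IsGoodGrading Γ f)
    (hm : IsGoodAlgebra Γ (B f) m) (hB : B.Nondegenerate) (hBinv : B.lieInvariant g)
    (hq : IsGradingElement Γ q) :
    IsGradedComplement hΓ.internal B f m (LinearMap.ker (LieAlgebra.ad ℂ g e)) where
  isHomogeneousSub := ht.isHomogeneousSub_ker hΓ
  le_perp := ht.ker_le_perp hΓ hm hBinv
  perp_le := ht.perp_le_sup hΓ hm hB hBinv hq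
  eq_zero _ hx hxC := ht.disjoint hΓ (hm.le_filt_one hx) hxC

theorem exists_isGradedComplement (hΓ : IsGoodGrading Γ f) (hq : IsGradingElement Γ q)
    (hBinv : B.lieInvariant g) (hm : IsGoodAlgebra Γ (B f) m) :
    ∃ C, IsGradedComplement hΓ.internal B f m C := by
  have hmg := hm.isHomogeneousSub hΓ.internal
  have hfm : IsHomogeneousSub hΓ.internal (m.toSubmodule.map (LieAlgebra.ad ℂ g f)) := by
    rintro j _ ⟨x, hx, rfl⟩
    refine ⟨gproj hΓ.internal (j + 2) x, hmg _ x hx, ?_⟩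
    rw [LieAlgebra.ad_apply, LieAlgebra.ad_apply,
      ← gproj_lie_of_mem hΓ.internal hΓ.lie_mem hΓ.mem]
    congr 2
    omega
  have hle : m.toSubmodule.map (LieAlgebra.ad ℂ g f) ≤ perp B m.toSubmodule := by
    rintro _ ⟨x, hx, rfl⟩
    rw [LieAlgebra.ad_apply, ← lie_skew]
    exact neg_mem (hm.lie_mem_perp hBinv hq hΓ hx)
  obtain ⟨C, hC, hcompl⟩ := exists_isCompl_homogeneous hΓ.internal hfm
  refine ⟨C ⊓ perp B m.toSubmodule, hC.inf hΓ.internal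
    (isHomogeneousSub_perp hBinv hq hΓ.internal hmg), inf_le_right, ?_, fun x hx hxC => ?_⟩
  · rw [inf_comm, inf_sup_assoc_of_le _ hle, sup_comm, hcompl.sup_eq_top, inf_top_eq]
  · exact hΓ.eq_zero_of_lie_eq_zero (hm.le_filt_one hx)
      (Submodule.disjoint_def.1 hcompl.disjoint ⁅f, x⁆ ⟨x, hx, rfl⟩ hxC.1)

end GradedComplement

/-! ### The coadjoint action -/

section CoadjointMap

variable {g : Type*} [LieRing g] [LieAlgebra ℂ g] {B : LinearMap.BilinForm ℂ g}

/-- The coadjoint action of the exponential of `x`. -/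
def coexp (x : g) : Dual ℂ g →ₗ[ℂ] Dual ℂ g := (nilExp (-LieAlgebra.ad ℂ g x)).dualMap

theorem form_ad_pow (hBinv : B.lieInvariant g) (x w y : g) (k : ℕ) :
    B ((LieAlgebra.ad ℂ g x ^ k) w) y = B w (((-LieAlgebra.ad ℂ g x) ^ k) y) := by
  induction k generalizing w with
  | zero => rfl
  | succ k ih =>
    rw [pow_succ, Module.End.mul_apply, ih, pow_succ', Module.End.mul_apply,
      LieAlgebra.ad_apply, hBinv, LinearMap.neg_apply, LieAlgebra.ad_apply, map_neg]

theorem coexp_form (hBinv : B.lieInvariant g) (x w : g) :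
    coexp x (B w) = B (nilExp (LieAlgebra.ad ℂ g x) w) := by
  ext y
  simp [coexp, nilExp, LinearMap.sum_apply, form_ad_pow hBinv]

theorem twistedRestriction_apply (χ : Dual ℂ g) (m : LieSubalgebra ℂ g) (ξ : Dual ℂ g) (x : m) :
    twistedRestriction χ m ξ x = ξ x - χ x := rfl

theorem mem_zeroFibre {χ : Dual ℂ g} {m : LieSubalgebra ℂ g} {ξ : Dual ℂ g} :
    ξ ∈ zeroFibre χ m ↔ ∀ x ∈ m, ξ x = χ x := by
  rw [zeroFibre, Set.mem_preimage, Set.mem_singleton_iff, LinearMap.ext_iff]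
  constructor
  · intro h x hx
    have := h ⟨x, hx⟩
    rwa [twistedRestriction_apply, LinearMap.zero_apply, sub_eq_zero] at this
  · rintro h ⟨x, hx⟩
    rw [twistedRestriction_apply, LinearMap.zero_apply, sub_eq_zero]
    exact h x hx

theorem form_mem_zeroFibre {f w : g} {m : LieSubalgebra ℂ g} :
    B w ∈ zeroFibre (B f) m ↔ w - f ∈ perp B m.toSubmodule := by
  rw [mem_zeroFibre, mem_perp]
  simp [sub_eq_zero]

theorem form_mem_slice (hB : B.Nondegenerate) (hBinv : B.lieInvariant g) {f e w : g} :
    B w ∈ slice (B f) e ↔ ⁅e, w - f⁆ = 0 := by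
  have hlie : ⁅e, B w - B f⁆ = B ⁅e, w - f⁆ := by
    ext y
    rw [← map_sub, Module.Dual.lie_apply, hBinv]
  change ⁅e, B w - B f⁆ = 0 ↔ _
  rw [hlie]
  constructor
  · intro hzero
    exact hB.1 _ fun y => by rw [hzero, LinearMap.zero_apply]
  · intro hzero
    rw [hzero, map_zero]

/-- The map `(x, y, s) ↦ Ad*(exp x) Ad*(exp y) (f + s | ·)`, the transport of `adjointMap` to the
dual. -/
def coadjointMap (B : LinearMap.BilinForm ℂ g) (f : g) (a b C : Submodule ℂ g) (v : a × b × C) :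
    Dual ℂ g :=
  coexp (v.1 : g) (coexp (v.2.1 : g) (B (f + v.2.2)))

variable {Γ : ℤ → Submodule ℂ g} {f e q : g} {m : LieSubalgebra ℂ g} {a b C : Submodule ℂ g}

theorem coadjointMap_eq (hBinv : B.lieInvariant g) (v : a × b × C) :
    coadjointMap B f a b C v = B (f + adjointMap f a b C v) := by
  rw [coadjointMap, coexp_form hBinv, coexp_form hBinv, adjointMap, add_sub_cancel]

theorem IsGradedComplement.coadjointMap_mem_zeroFibre (hΓ : IsGoodGrading Γ f)
    (hC : IsGradedComplement hΓ.internal B f m C) (hm : IsGoodAlgebra Γ (B f) m)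
    (hBinv : B.lieInvariant g) (hq : IsGradingElement Γ q) (ha : a ≤ m.toSubmodule)
    (hb : b ≤ m.toSubmodule) (v : a × b × C) :
    coadjointMap B f a b C v ∈ zeroFibre (B f) m := by
  rw [coadjointMap_eq hBinv, form_mem_zeroFibre, add_sub_cancel_left]
  exact hC.adjointMap_mem_perp hΓ hm hBinv hq ha hb v

variable [FiniteDimensional ℂ g]

theorem exists_form_eq (hB : B.Nondegenerate) (ξ : Dual ℂ g) : ∃ w, B w = ξ := by
  obtain ⟨w, rfl⟩ := (B.toDual hB).surjective ξ
  exact ⟨w, LinearMap.ext fun z => (LinearMap.BilinForm.toDual_def hB).symm⟩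

theorem slice_form (hB : B.Nondegenerate) (hBinv : B.lieInvariant g) :
    slice (B f) e = {ξ | ∃ s ∈ LinearMap.ker (LieAlgebra.ad ℂ g e), ξ = B (f + s)} := by
  refine Set.ext fun ξ => ⟨fun hξ => ?_, ?_⟩
  · obtain ⟨w, rfl⟩ := exists_form_eq hB ξ
    exact ⟨w - f, (form_mem_slice hB hBinv).1 hξ, by rw [add_sub_cancel]⟩
  · rintro ⟨s, hs, rfl⟩
    rw [form_mem_slice hB hBinv, add_sub_cancel_left]
    exact hs

theorem IsGradedComplement.exists_inverse_coadjointMap (hΓ : IsGoodGrading Γ f)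
    (hC : IsGradedComplement hΓ.internal B f m C) (hm : IsGoodAlgebra Γ (B f) m)
    (hB : B.Nondegenerate) (hBinv : B.lieInvariant g) (hq : IsGradingElement Γ q)
    (hsum : a ⊔ b = m.toSubmodule) (hdisj : Disjoint a b)
    (ha : IsHomogeneousSub hΓ.internal a) (hb : IsHomogeneousSub hΓ.internal b) :
    ∃ τ : Dual ℂ g → a × b × C, IsMorphism (polyFun (Dual ℂ g)) (polyFun (a × b × C)) τ ∧
      (∀ ξ ∈ zeroFibre (B f) m, coadjointMap B f a b C (τ ξ) = ξ) ∧
      ∀ v, τ (coadjointMap B f a b C v) = v := by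
  have ham : a ≤ m.toSubmodule := hsum ▸ le_sup_left
  have hbm : b ≤ m.toSubmodule := hsum ▸ le_sup_right
  have hrange := hC.range_adjointLin hΓ hm hBinv hq hsum
  obtain ⟨T, hT, hright, hleft⟩ := exists_inverse_adjointMap hΓ.internal hΓ.lie_mem hΓ.mem hq
    (ham.trans hm.le_filt_one) (hbm.trans hm.le_filt_one)
    (hC.le_perp.trans (hm.perp_le hB hBinv hq hΓ.internal)) ha hb hC.isHomogeneousSub
    (hC.adjointLin_injective hsum hdisj)
    fun v => hrange ▸ hC.adjointMap_mem_perp hΓ hm hBinv hq ham hbm v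
  have hsymm (w : g) : (B.toDual hB).symm (B w) = w :=
    (LinearEquiv.symm_apply_eq _).2 (LinearMap.ext fun z =>
      (LinearMap.BilinForm.toDual_def hB).symm)
  refine ⟨fun ξ => T ((B.toDual hB).symm ξ - f), hT.comp
    ((isMorphism_linear (B.toDual hB).symm.toLinearMap).sub (isMorphism_const f)), ?_, ?_⟩
  · intro ξ hξ
    obtain ⟨w, rfl⟩ := exists_form_eq hB ξ
    simp only [coadjointMap_eq hBinv, hsymm]
    rw [hright _ (hrange ▸ form_mem_zeroFibre.1 hξ), add_sub_cancel]
  · intro v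
    rw [coadjointMap_eq hBinv]
    simp only [hsymm, add_sub_cancel_left, hleft]

end CoadjointMap

/-! ### Poisson brackets -/

section PoissonAlgebra

variable {A : Type*} [CommRing A] [Algebra ℂ A] {β : A →ₗ[ℂ] A →ₗ[ℂ] A} {a b c : A}

theorem jacobi_swap_right (hβ : β.IsAlt) (h : β a (β b c) = β (β a b) c + β b (β a c)) :
    β a (β c b) = β (β a c) b + β c (β a b) := by
  rw [← hβ.neg b c, map_neg, h, ← hβ.neg b (β a c), ← hβ.neg (β a b) c]
  abel

theorem jacobi_swap_left (hβ : β.IsAlt) (h : β a (β b c) = β (β a b) c + β b (β a c)) :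
    β b (β a c) = β (β b a) c + β a (β b c) := by
  rw [h, ← hβ.neg a b, map_neg, LinearMap.neg_apply]
  abel

variable {s : Set A}

-- For fixed `a` and `b`, the failure of the Jacobi identity is a derivation in `c`.
theorem jacobi_of_adjoin_eq_top (hleib : ∀ a b c, β a (b * c) = β a b * c + b * β a c)
    (hs : Algebra.adjoin ℂ s = ⊤)
    (h : ∀ c ∈ s, β a (β b c) = β (β a b) c + β b (β a c)) (c : A) :
    β a (β b c) = β (β a b) c + β b (β a c) := by
  let D (a : A) : Derivation ℂ A A := Derivation.mk' (β a) fun b c => by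
    rw [hleib, smul_eq_mul, smul_eq_mul]
    ring
  have hD (a b : A) : D a b = β a b := rfl
  have hcomm : ⁅D a, D b⁆ = D (β a b) := by
    refine Derivation.ext_of_adjoin_eq_top s hs fun c hc => ?_
    simp only [Derivation.commutator_apply, hD]
    rw [h c hc, add_sub_cancel_right]
  have := DFunLike.congr_fun hcomm c
  simp only [Derivation.commutator_apply, hD] at this
  rw [← this, sub_add_cancel]

theorem jacobi_of_generators (hβ : β.IsAlt)
    (hleib : ∀ a b c, β a (b * c) = β a b * c + b * β a c) (hs : Algebra.adjoin ℂ s = ⊤)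
    (h : ∀ a ∈ s, ∀ b ∈ s, ∀ c ∈ s, β a (β b c) = β (β a b) c + β b (β a c)) (a b c : A) :
    β a (β b c) = β (β a b) c + β b (β a c) := by
  have hone : ∀ a ∈ s, ∀ b c, β a (β b c) = β (β a b) c + β b (β a c) := fun a ha b =>
    jacobi_of_adjoin_eq_top hleib hs fun c hc =>
      jacobi_swap_right hβ (jacobi_of_adjoin_eq_top hleib hs (h a ha c hc) b)
  exact jacobi_of_adjoin_eq_top hleib hs
    (fun c hc => jacobi_swap_right hβ (jacobi_swap_left hβ (hone c hc a b))) c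

end PoissonAlgebra

section KirillovKostant

variable {L : Type*} [LieRing L] [LieAlgebra ℂ L]

theorem eval_mem_polyFun (x : L) : (fun ξ : Dual ℂ L => ξ x) ∈ polyFun (Dual ℂ L) :=
  dual_mem_polyFun (Dual.eval ℂ L x)

variable [FiniteDimensional ℂ L]

theorem apply_dualGradient {F : Dual ℂ L → ℂ} (hF : F ∈ polyFun (Dual ℂ L)) (ξ η : Dual ℂ L) :
    η (dualGradient F ξ) = differential F ξ η := by
  have hη : η = ∑ i, η (finBasis ℂ L i) • (finBasis ℂ L).coord i := by
    refine (finBasis ℂ L).ext fun j => ?_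
    simp
  conv_rhs => rw [hη]
  simp only [dualGradient, map_sum, map_smul, smul_eq_mul, lineDeriv_eq_differential hF]
  exact Finset.sum_congr rfl fun i _ => mul_comm _ _

theorem dualGradient_eq {F : Dual ℂ L → ℂ} (hF : F ∈ polyFun (Dual ℂ L)) {ξ : Dual ℂ L} {x : L}
    (h : ∀ η : Dual ℂ L, HasDerivAt (fun t : ℂ => F (ξ + t • η)) (η x) 0) :
    dualGradient F ξ = x :=
  eval_apply_injective ℂ <| LinearMap.ext fun η => by
    rw [Dual.eval_apply, Dual.eval_apply, apply_dualGradient hF]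
    exact (hasDerivAt_comp_line hF ξ η).unique (h η)

theorem hasDerivAt_dualGradient {F : Dual ℂ L → ℂ} (hF : F ∈ polyFun (Dual ℂ L))
    (ξ η : Dual ℂ L) : HasDerivAt (fun t : ℂ => F (ξ + t • η)) (η (dualGradient F ξ)) 0 := by
  rw [apply_dualGradient hF]
  exact hasDerivAt_comp_line hF ξ η

variable {F H K : Dual ℂ L → ℂ}

theorem dualGradient_add (hF : F ∈ polyFun (Dual ℂ L)) (hH : H ∈ polyFun (Dual ℂ L))
    (ξ : Dual ℂ L) : dualGradient (F + H) ξ = dualGradient F ξ + dualGradient H ξ :=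
  dualGradient_eq (Subalgebra.add_mem _ hF hH) fun η => by
    rw [map_add]
    exact (hasDerivAt_dualGradient hF ξ η).add (hasDerivAt_dualGradient hH ξ η)

theorem dualGradient_smul (hF : F ∈ polyFun (Dual ℂ L)) (c : ℂ) (ξ : Dual ℂ L) :
    dualGradient (c • F) ξ = c • dualGradient F ξ :=
  dualGradient_eq (Subalgebra.smul_mem _ hF c) fun η => by
    rw [map_smul]
    exact (hasDerivAt_dualGradient hF ξ η).const_mul c

theorem dualGradient_mul (hF : F ∈ polyFun (Dual ℂ L)) (hH : H ∈ polyFun (Dual ℂ L))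
    (ξ : Dual ℂ L) :
    dualGradient (F * H) ξ = H ξ • dualGradient F ξ + F ξ • dualGradient H ξ :=
  dualGradient_eq (Subalgebra.mul_mem _ hF hH) fun η => by
    refine ((hasDerivAt_dualGradient hF ξ η).mul (hasDerivAt_dualGradient hH ξ η)).congr_deriv ?_
    simp only [map_add, map_smul, smul_eq_mul, zero_smul, add_zero]
    ring

theorem dualGradient_eval_sub (x : L) (c : ℂ) (ξ : Dual ℂ L) :
    dualGradient (fun ξ => ξ x - c) ξ = x :=
  dualGradient_eq (Subalgebra.sub_mem _ (eval_mem_polyFun x) (const_mem _ c)) fun η =>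
    (hasDerivAt_line (Dual.eval ℂ L x) ξ η 0).sub_const c

theorem dualGradient_eval (x : L) (ξ : Dual ℂ L) :
    dualGradient (fun ξ : Dual ℂ L => ξ x) ξ = x := by
  simpa using dualGradient_eval_sub x 0 ξ

theorem isMorphism_dualGradient (hF : F ∈ polyFun (Dual ℂ L)) :
    IsMorphism (polyFun (Dual ℂ L)) (polyFun L) (dualGradient F) :=
  isMorphism_iff_dual.2 fun l => by
    simp only [apply_dualGradient hF]
    exact differential_mem hF l

theorem kkBracket_mem (hF : F ∈ polyFun (Dual ℂ L)) (hH : H ∈ polyFun (Dual ℂ L)) :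
    kkBracket F H ∈ polyFun (Dual ℂ L) := by
  have hlie := (isMorphism_dualGradient hF).bilinear (LieAlgebra.ad ℂ L : L →ₗ[ℂ] End ℂ L)
    (isMorphism_dualGradient hH)
  exact isMorphism_iff_dual.1
    ((isMorphism_id (A := polyFun (Dual ℂ L))).bilinear LinearMap.id hlie) LinearMap.id

theorem kkBracket_self (F : Dual ℂ L → ℂ) : kkBracket F F = 0 := by
  funext ξ
  simp [kkBracket]

theorem kkBracket_add_left (hF : F ∈ polyFun (Dual ℂ L)) (hH : H ∈ polyFun (Dual ℂ L)) :
    kkBracket (F + H) K = kkBracket F K + kkBracket H K := by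
  funext ξ
  simp [kkBracket, dualGradient_add hF hH]

theorem kkBracket_add_right (hH : H ∈ polyFun (Dual ℂ L)) (hK : K ∈ polyFun (Dual ℂ L)) :
    kkBracket F (H + K) = kkBracket F H + kkBracket F K := by
  funext ξ
  simp [kkBracket, dualGradient_add hH hK]

theorem kkBracket_smul_left (hF : F ∈ polyFun (Dual ℂ L)) (c : ℂ) :
    kkBracket (c • F) H = c • kkBracket F H := by
  funext ξ
  simp [kkBracket, dualGradient_smul hF]

theorem kkBracket_smul_right (hH : H ∈ polyFun (Dual ℂ L)) (c : ℂ) :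
    kkBracket F (c • H) = c • kkBracket F H := by
  funext ξ
  simp [kkBracket, dualGradient_smul hH]

theorem kkBracket_mul (hH : H ∈ polyFun (Dual ℂ L)) (hK : K ∈ polyFun (Dual ℂ L)) :
    kkBracket F (H * K) = kkBracket F H * K + H * kkBracket F K := by
  funext ξ
  simp only [kkBracket, dualGradient_mul hH hK, lie_add, lie_smul, map_add, map_smul, smul_eq_mul,
    Pi.add_apply, Pi.mul_apply]
  ring

variable (L) in
/-- The Kirillov-Kostant bracket as a bilinear map on the algebra of polynomial functions. -/
def kkBilinear : polyFun (Dual ℂ L) →ₗ[ℂ] polyFun (Dual ℂ L) →ₗ[ℂ] polyFun (Dual ℂ L) :=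
  LinearMap.mk₂ ℂ (fun F H => ⟨kkBracket F.1 H.1, kkBracket_mem F.2 H.2⟩)
    (fun F F' _ => Subtype.ext (kkBracket_add_left F.2 F'.2))
    (fun c F _ => Subtype.ext (kkBracket_smul_left F.2 c))
    (fun _ H H' => Subtype.ext (kkBracket_add_right H.2 H'.2))
    (fun c _ H => Subtype.ext (kkBracket_smul_right H.2 c))

theorem kkBracket_eval_eval (x y : L) :
    kkBracket (fun ξ : Dual ℂ L => ξ x) (fun ξ => ξ y) = fun ξ => ξ ⁅x, y⁆ := by
  funext ξ
  simp only [kkBracket, dualGradient_eval]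

theorem kkBracket_jacobi (hF : F ∈ polyFun (Dual ℂ L)) (hH : H ∈ polyFun (Dual ℂ L))
    (hK : K ∈ polyFun (Dual ℂ L)) :
    kkBracket F (kkBracket H K) = kkBracket (kkBracket F H) K + kkBracket H (kkBracket F K) := by
  have h := jacobi_of_generators (β := kkBilinear L) (fun F => Subtype.ext (kkBracket_self F.1))
    (fun F H K => Subtype.ext (kkBracket_mul H.2 K.2)) (Algebra.adjoin_adjoin_coe_preimage (R := ℂ))
    (fun F hF H hH K hK => ?_) ⟨F, hF⟩ ⟨H, hH⟩ ⟨K, hK⟩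
  · exact congrArg Subtype.val h
  · obtain ⟨F, hF'⟩ := F
    obtain ⟨H, hH'⟩ := H
    obtain ⟨K, hK'⟩ := K
    obtain ⟨l, rfl⟩ := hF
    obtain ⟨l', rfl⟩ := hH
    obtain ⟨l'', rfl⟩ := hK
    obtain ⟨x, rfl⟩ := (evalEquiv ℂ L).surjective l
    obtain ⟨y, rfl⟩ := (evalEquiv ℂ L).surjective l'
    obtain ⟨z, rfl⟩ := (evalEquiv ℂ L).surjective l''
    apply Subtype.ext
    change kkBracket (fun ξ : Dual ℂ L => ξ x) (kkBracket (fun ξ : Dual ℂ L => ξ y) fun ξ => ξ z) =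
      kkBracket (kkBracket (fun ξ : Dual ℂ L => ξ x) fun ξ => ξ y) (fun ξ => ξ z) +
        kkBracket (fun ξ : Dual ℂ L => ξ y) (kkBracket (fun ξ : Dual ℂ L => ξ x) fun ξ => ξ z)
    simp only [kkBracket_eval_eval]
    funext ξ
    rw [Pi.add_apply, leibniz_lie, map_add]

end KirillovKostant

section CoadjointDerivative

variable {g : Type*} [LieRing g] [LieAlgebra ℂ g]

theorem coexp_apply_eq {p : Submodule ℂ g} {x y : g} {ξ : Dual ℂ g}
    (hp : ∀ z ∈ p, ⁅x, z⁆ ∈ p) (hy : ⁅x, y⁆ ∈ p) (hξ : ∀ z ∈ p, ξ z = 0) :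
    coexp x ξ y = ξ y := by
  have hmem : nilExp (-LieAlgebra.ad ℂ g x) y - y ∈ p :=
    nilExp_sub_mem (fun z hz => p.neg_mem (hp z hz)) (p.neg_mem hy)
  have heq := hξ _ hmem
  rwa [map_sub, sub_eq_zero] at heq

variable [FiniteDimensional ℂ g]

theorem hasDerivAt_coexp {x : g} (hx : IsNilpotent (LieAlgebra.ad ℂ g x)) {F : Dual ℂ g → ℂ}
    (hF : F ∈ polyFun (Dual ℂ g)) (ξ : Dual ℂ g) :
    HasDerivAt (fun t : ℂ => F (coexp (-t • x) ξ)) (ξ ⁅x, dualGradient F ξ⁆) 0 := by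
  have hcoexp (t : ℂ) : coexp (-t • x) ξ = (nilExp (t • LieAlgebra.ad ℂ g x)).dualMap ξ := by
    rw [coexp, map_smul, neg_smul, neg_neg]
  have hzero : coexp (-(0 : ℂ) • x) ξ = ξ := by
    rw [hcoexp, zero_smul, nilExp_zero]
    rfl
  have hcurve (l : Dual ℂ (Dual ℂ g)) :
      HasDerivAt (fun t : ℂ => l (coexp (-t • x) ξ)) (l ((LieAlgebra.ad ℂ g x).dualMap ξ)) 0 := by
    obtain ⟨y, rfl⟩ := (evalEquiv ℂ g).surjective l
    have hderiv := hasDerivAt_nilExp_smul hx (ξ ∘ₗ LinearMap.applyₗ y) 0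
    rw [zero_smul, nilExp_zero, one_mul] at hderiv
    simp only [hcoexp]
    exact hderiv
  have hderiv := hasDerivAt_comp_curve hF hcurve
  simp only [hzero] at hderiv
  rwa [← apply_dualGradient hF] at hderiv

end CoadjointDerivative

namespace ConnectedAlgebraicGroup

variable {g V : Type*} [LieRing g] [LieAlgebra ℂ g] [AddCommGroup V] [Module ℂ V]
variable {G : ConnectedAlgebraicGroup g V}

theorem coAd_apply (u : G.carrier) (ξ : Dual ℂ g) (y : g) : G.coAd u ξ y = ξ (G.Ad u⁻¹ y) := rfl

theorem coAd_mul (u v : G.carrier) (ξ : Dual ℂ g) : G.coAd (u * v) ξ = G.coAd u (G.coAd v ξ) := by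
  rw [map_mul, Module.End.mul_apply]

theorem lieMap_Ad_eq_conj (u : G.carrier) (x : g) :
    G.lieMap (G.Ad u x) = conj (u : LinearMap.GeneralLinearGroup ℂ V) (G.lieMap x) :=
  G.lieMap_adFun u x

theorem Ad_lie (u : G.carrier) (x y : g) : G.Ad u ⁅x, y⁆ = ⁅G.Ad u x, G.Ad u y⁆ := by
  apply G.lieMap_injective
  have hconj (X Y : End ℂ V) : conj (u : LinearMap.GeneralLinearGroup ℂ V) X *
      conj (u : LinearMap.GeneralLinearGroup ℂ V) Y =
        conj (u : LinearMap.GeneralLinearGroup ℂ V) (X * Y) := by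
    simp only [conj_apply, mul_assoc, Units.inv_mul_cancel_left]
  simp only [lieMap_lie, lieMap_Ad_eq_conj, hconj, map_sub]

theorem isNilpotent_lieMap_of_mem_filt [FiniteDimensional ℂ V] {Γ : ℤ → Submodule ℂ g} {q : g}
    (hq : IsGradingElement Γ q) {x : g} (hx : x ∈ filt Γ 1) : IsNilpotent (G.lieMap x) := by
  refine isNilpotent_of_mem_filt G.lieMap (G.lieMap q) (fun j y hy => ?_) hx
  rw [← G.lieMap_lie, (hq j y).1 hy, map_smul]

section Exponentials

variable [FiniteDimensional ℂ V] {M : Subgroup G.carrier} {m : LieSubalgebra ℂ g}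
variable (hM : G.IsUnipotentSubgroup M m) (hnil : ∀ x ∈ m, IsNilpotent (G.lieMap x))

theorem conj_expEquiv (u : G.carrier) (x y : m) (hxy : G.Ad u x = y) :
    u * expEquiv hM hnil x * u⁻¹ = expEquiv hM hnil y := by
  apply Subtype.ext
  apply Units.ext
  rw [coe_expEquiv, expGL_val, ← hxy, lieMap_Ad]
  simp only [Subgroup.coe_mul, Units.val_mul, coe_expEquiv, expGL_val, Subgroup.coe_inv, nilExp,
    Units.conj_pow, Finset.mul_sum, Finset.sum_mul, mul_smul_comm, smul_mul_assoc]

variable [FiniteDimensional ℂ g]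

theorem coAd_expEquiv (x : m) : G.coAd (expEquiv hM hnil x) = coexp (x : g) := by
  ext ξ y
  exact coAd_expEquiv_apply hM hnil x ξ y

end Exponentials

variable [FiniteDimensional ℂ g] {F H : Dual ℂ g → ℂ}

theorem dualGradient_comp_coAd (hF : F ∈ polyFun (Dual ℂ g)) (u : G.carrier) (ξ : Dual ℂ g) :
    dualGradient (F ∘ G.coAd u) ξ = G.Ad u⁻¹ (dualGradient F (G.coAd u ξ)) :=
  dualGradient_eq (polyFun_comp _ hF) fun η => by
    have hderiv := hasDerivAt_dualGradient hF (G.coAd u ξ) (G.coAd u η)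
    rw [coAd_apply u η] at hderiv
    simpa only [Function.comp_apply, map_add, map_smul] using hderiv

theorem kkBracket_comp_coAd (hF : F ∈ polyFun (Dual ℂ g)) (hH : H ∈ polyFun (Dual ℂ g))
    (u : G.carrier) (ξ : Dual ℂ g) :
    kkBracket (F ∘ G.coAd u) (H ∘ G.coAd u) ξ = kkBracket F H (G.coAd u ξ) := by
  rw [kkBracket, dualGradient_comp_coAd hF, dualGradient_comp_coAd hH, ← Ad_lie]
  rfl

end ConnectedAlgebraicGroup

/-! ### Poisson reduction -/

section ReducedBracket

variable {g V : Type*} [LieRing g] [LieAlgebra ℂ g]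
  [AddCommGroup V] [Module ℂ V] {G : ConnectedAlgebraicGroup g V}
variable {χ : Dual ℂ g} {m : LieSubalgebra ℂ g} {M : Subgroup G.carrier}

/-- A polynomial function on `g*` which represents a given function on `μ⁻¹(0) / M`. -/
structure IsLift (F : Reduced G χ m M → ℂ) (F' : Dual ℂ g → ℂ) : Prop where
  mem : F' ∈ polyFun (Dual ℂ g)
  eq : ∀ ξ : zeroFibre χ m, F' ξ = F (cls G χ m M ξ)

theorem IsLift.mem_regReduced {F : Reduced G χ m M → ℂ} {F' : Dual ℂ g → ℂ} (h : IsLift F F') :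
    F ∈ regReduced G χ m M :=
  ⟨F', h.mem, funext h.eq⟩

theorem exists_isLift {F : Reduced G χ m M → ℂ} (hF : F ∈ regReduced G χ m M) :
    ∃ F', IsLift F F' := by
  obtain ⟨F', hF', h⟩ := hF
  exact ⟨F', hF', fun ξ => congrFun h ξ⟩

theorem cls_coAd (u : M) (ξ : zeroFibre χ m)
    (h : G.coAd (u : G.carrier) (ξ : Dual ℂ g) ∈ zeroFibre χ m) :
    cls G χ m M ⟨_, h⟩ = cls G χ m M ξ :=
  (Quotient.sound (s := G.orbitSetoid M (zeroFibre χ m)) ⟨u, rfl⟩).symm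

theorem exists_coAd_of_cls_eq {ξ η : zeroFibre χ m} (h : cls G χ m M ξ = cls G χ m M η) :
    ∃ u : M, G.coAd (u : G.carrier) (ξ : Dual ℂ g) = η :=
  Quotient.exact h

theorem IsLift.add {F H : Reduced G χ m M → ℂ} {F' H' : Dual ℂ g → ℂ} (hF : IsLift F F')
    (hH : IsLift H H') : IsLift (F + H) (F' + H') :=
  ⟨Subalgebra.add_mem _ hF.mem hH.mem, fun ξ => congrArg₂ (· + ·) (hF.eq ξ) (hH.eq ξ)⟩

theorem IsLift.mul {F H : Reduced G χ m M → ℂ} {F' H' : Dual ℂ g → ℂ} (hF : IsLift F F')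
    (hH : IsLift H H') : IsLift (F * H) (F' * H') :=
  ⟨Subalgebra.mul_mem _ hF.mem hH.mem, fun ξ => congrArg₂ (· * ·) (hF.eq ξ) (hH.eq ξ)⟩

theorem IsLift.smul {F : Reduced G χ m M → ℂ} {F' : Dual ℂ g → ℂ} (c : ℂ) (hF : IsLift F F') :
    IsLift (c • F) (c • F') :=
  ⟨Subalgebra.smul_mem _ hF.mem c, fun ξ => congrArg (c * ·) (hF.eq ξ)⟩

theorem regReduced_ext {F H : regReduced G χ m M} {F' : Dual ℂ g → ℂ}
    (hF : IsLift (F : Reduced G χ m M → ℂ) F') (hH : IsLift (H : Reduced G χ m M → ℂ) F') :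
    F = H := by
  apply Subtype.ext
  funext p
  obtain ⟨ξ, rfl⟩ := Quotient.exists_rep p
  exact (hF.eq ξ).symm.trans (hH.eq ξ)

variable [FiniteDimensional ℂ g]

theorem dualGradient_sub_mem {F' F'' : Dual ℂ g → ℂ} (hF' : F' ∈ polyFun (Dual ℂ g))
    (hF'' : F'' ∈ polyFun (Dual ℂ g)) (h : ∀ ξ ∈ zeroFibre χ m, F' ξ = F'' ξ) {ξ : Dual ℂ g}
    (hξ : ξ ∈ zeroFibre χ m) : dualGradient F' ξ - dualGradient F'' ξ ∈ m := by
  rw [← LieSubalgebra.mem_toSubmodule, ← Subspace.dualAnnihilator_dualCoannihilator_eq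
    (W := m.toSubmodule), Submodule.mem_dualCoannihilator]
  intro η hη
  rw [Submodule.mem_dualAnnihilator] at hη
  have hline : (fun t : ℂ => F' (ξ + t • η)) = fun t => F'' (ξ + t • η) := by
    funext t
    refine h _ (mem_zeroFibre.2 fun x hx => ?_)
    rw [LinearMap.add_apply, LinearMap.smul_apply, hη x hx, smul_zero, add_zero,
      mem_zeroFibre.1 hξ x hx]
  have hderiv := hasDerivAt_dualGradient hF' ξ η
  rw [hline] at hderiv
  rw [map_sub, hderiv.unique (hasDerivAt_dualGradient hF'' ξ η), sub_self]

theorem IsLift.dualGradient_sub_mem {F : Reduced G χ m M → ℂ} {F' F'' : Dual ℂ g → ℂ}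
    (hF' : IsLift F F') (hF'' : IsLift F F'') {ξ : Dual ℂ g} (hξ : ξ ∈ zeroFibre χ m) :
    dualGradient F' ξ - dualGradient F'' ξ ∈ m :=
  SlodowyStages.dualGradient_sub_mem hF'.mem hF''.mem
    (fun η hη => (hF'.eq ⟨η, hη⟩).trans (hF''.eq ⟨η, hη⟩).symm) hξ

variable (G χ m M) in
/-- The conditions under which the bracket of `g*` descends to `μ⁻¹(0) / M`: the fibre is stable
under `M`, and the functions on the quotient Poisson commute on the fibre with the elements of `m`,
viewed as linear functions on `g*`. -/
structure IsPoissonReducible : Prop where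
  coAd_mem : ∀ u : M, ∀ ξ ∈ zeroFibre χ m, G.coAd (u : G.carrier) ξ ∈ zeroFibre χ m
  apply_lie_dualGradient : ∀ (F : Reduced G χ m M → ℂ) (F' : Dual ℂ g → ℂ), IsLift F F' →
    ∀ x ∈ m, ∀ ξ ∈ zeroFibre χ m, ξ ⁅x, dualGradient F' ξ⁆ = 0

namespace IsPoissonReducible

theorem kkBracket_congr (h : IsPoissonReducible G χ m M) {F H : Reduced G χ m M → ℂ}
    {F' F'' H' H'' : Dual ℂ g → ℂ} (hF' : IsLift F F') (hF'' : IsLift F F'') (hH' : IsLift H H')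
    (hH'' : IsLift H H'') {ξ : Dual ℂ g} (hξ : ξ ∈ zeroFibre χ m) :
    kkBracket F' H' ξ = kkBracket F'' H'' ξ := by
  have hleft := h.apply_lie_dualGradient H H' hH' _ (hF'.dualGradient_sub_mem hF'' hξ) ξ hξ
  have hright := h.apply_lie_dualGradient F F'' hF'' _ (hH'.dualGradient_sub_mem hH'' hξ) ξ hξ
  rw [sub_lie, map_sub, sub_eq_zero] at hleft
  rw [← lie_skew, lie_sub, map_neg, neg_eq_zero, map_sub, sub_eq_zero] at hright
  exact hleft.trans hright

theorem isLift_comp_coAd (h : IsPoissonReducible G χ m M) {F : Reduced G χ m M → ℂ}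
    {F' : Dual ℂ g → ℂ} (hF : IsLift F F') (u : M) : IsLift F (F' ∘ G.coAd (u : G.carrier)) :=
  ⟨polyFun_comp _ hF.mem, fun ξ => by
    rw [Function.comp_apply, hF.eq ⟨_, h.coAd_mem u ξ ξ.2⟩, cls_coAd]⟩

theorem exists_bracket (h : IsPoissonReducible G χ m M) (F H : regReduced G χ m M) :
    ∃ K : regReduced G χ m M,
      ∀ F' H', IsLift (F : Reduced G χ m M → ℂ) F' → IsLift (H : Reduced G χ m M → ℂ) H' →
        IsLift (K : Reduced G χ m M → ℂ) (kkBracket F' H') := by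
  obtain ⟨F', hF'⟩ := exists_isLift F.2
  obtain ⟨H', hH'⟩ := exists_isLift H.2
  let K : Reduced G χ m M → ℂ := Quotient.lift (fun ξ : zeroFibre χ m => kkBracket F' H' ξ) (by
    rintro ξ η ⟨u, hu⟩
    rw [← hu, ← ConnectedAlgebraicGroup.kkBracket_comp_coAd hF'.mem hH'.mem]
    exact h.kkBracket_congr hF' (h.isLift_comp_coAd hF' u) hH' (h.isLift_comp_coAd hH' u) ξ.2)
  have hK : IsLift K (kkBracket F' H') := ⟨kkBracket_mem hF'.mem hH'.mem, fun ξ => rfl⟩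
  refine ⟨⟨K, hK.mem_regReduced⟩, fun F'' H'' hF'' hH'' =>
    ⟨kkBracket_mem hF''.mem hH''.mem, fun ξ => ?_⟩⟩
  exact (h.kkBracket_congr hF'' hF' hH'' hH' ξ.2).trans (hK.eq ξ)

/-- The function on `μ⁻¹(0) / M` which is lifted by the brackets of the lifts of `F` and `H`. -/
def bracketFun (h : IsPoissonReducible G χ m M) (F H : regReduced G χ m M) : regReduced G χ m M :=
  (h.exists_bracket F H).choose

theorem isLift_bracketFun (h : IsPoissonReducible G χ m M) {F H : regReduced G χ m M}
    {F' H' : Dual ℂ g → ℂ} (hF : IsLift (F : Reduced G χ m M → ℂ) F')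
    (hH : IsLift (H : Reduced G χ m M → ℂ) H') :
    IsLift (h.bracketFun F H : Reduced G χ m M → ℂ) (kkBracket F' H') :=
  (h.exists_bracket F H).choose_spec F' H' hF hH

/-- `bracketFun` as a bilinear map. -/
def bracketLin (h : IsPoissonReducible G χ m M) :
    regReduced G χ m M →ₗ[ℂ] regReduced G χ m M →ₗ[ℂ] regReduced G χ m M :=
  LinearMap.mk₂ ℂ h.bracketFun
    (fun F₁ F₂ H => by
      obtain ⟨F₁', hF₁⟩ := exists_isLift F₁.2
      obtain ⟨F₂', hF₂⟩ := exists_isLift F₂.2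
      obtain ⟨H', hH⟩ := exists_isLift H.2
      refine regReduced_ext (h.isLift_bracketFun (hF₁.add hF₂) hH) ?_
      rw [kkBracket_add_left hF₁.mem hF₂.mem]
      exact (h.isLift_bracketFun hF₁ hH).add (h.isLift_bracketFun hF₂ hH))
    (fun c F H => by
      obtain ⟨F', hF⟩ := exists_isLift F.2
      obtain ⟨H', hH⟩ := exists_isLift H.2
      refine regReduced_ext (h.isLift_bracketFun (hF.smul c) hH) ?_
      rw [kkBracket_smul_left hF.mem]
      exact (h.isLift_bracketFun hF hH).smul c)
    (fun F H₁ H₂ => by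
      obtain ⟨F', hF⟩ := exists_isLift F.2
      obtain ⟨H₁', hH₁⟩ := exists_isLift H₁.2
      obtain ⟨H₂', hH₂⟩ := exists_isLift H₂.2
      refine regReduced_ext (h.isLift_bracketFun hF (hH₁.add hH₂)) ?_
      rw [kkBracket_add_right hH₁.mem hH₂.mem]
      exact (h.isLift_bracketFun hF hH₁).add (h.isLift_bracketFun hF hH₂))
    (fun c F H => by
      obtain ⟨F', hF⟩ := exists_isLift F.2
      obtain ⟨H', hH⟩ := exists_isLift H.2
      refine regReduced_ext (h.isLift_bracketFun hF (hH.smul c)) ?_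
      rw [kkBracket_smul_right hH.mem]
      exact (h.isLift_bracketFun hF hH).smul c)

theorem isLift_bracketLin (h : IsPoissonReducible G χ m M) {F H : regReduced G χ m M}
    {F' H' : Dual ℂ g → ℂ} (hF : IsLift (F : Reduced G χ m M → ℂ) F')
    (hH : IsLift (H : Reduced G χ m M → ℂ) H') :
    IsLift (h.bracketLin F H : Reduced G χ m M → ℂ) (kkBracket F' H') :=
  h.isLift_bracketFun hF hH

/-- The Poisson bracket on `μ⁻¹(0) / M` induced by the Kirillov-Kostant bracket. -/
def reducedBracket (h : IsPoissonReducible G χ m M) : PoissonBracket (regReduced G χ m M) where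
  bracket := h.bracketLin
  self F := by
    obtain ⟨F', hF⟩ := exists_isLift F.2
    refine regReduced_ext (h.isLift_bracketLin hF hF) ?_
    rw [kkBracket_self]
    exact ⟨Subalgebra.zero_mem _, fun _ => rfl⟩
  jacobi F H K := by
    obtain ⟨F', hF⟩ := exists_isLift F.2
    obtain ⟨H', hH⟩ := exists_isLift H.2
    obtain ⟨K', hK⟩ := exists_isLift K.2
    refine regReduced_ext (h.isLift_bracketLin hF (h.isLift_bracketLin hH hK)) ?_
    rw [kkBracket_jacobi hF.mem hH.mem hK.mem]
    exact (h.isLift_bracketLin (h.isLift_bracketLin hF hH) hK).add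
      (h.isLift_bracketLin hH (h.isLift_bracketLin hF hK))
  leibniz F H K := by
    obtain ⟨F', hF⟩ := exists_isLift F.2
    obtain ⟨H', hH⟩ := exists_isLift H.2
    obtain ⟨K', hK⟩ := exists_isLift K.2
    refine regReduced_ext (h.isLift_bracketLin hF (hH.mul hK)) ?_
    rw [kkBracket_mul hH.mem hK.mem]
    exact ((h.isLift_bracketLin hF hH).mul hK).add (hH.mul (h.isLift_bracketLin hF hK))

theorem isReducedBracket_reducedBracket (h : IsPoissonReducible G χ m M) :
    IsReducedBracket G χ m M h.reducedBracket :=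
  fun _ _ F' hF' H' hH' hF hH ξ => ((h.isLift_bracketLin (F' := F') (H' := H') ⟨hF', hF⟩
    ⟨hH', hH⟩).eq ξ).symm

end IsPoissonReducible

end ReducedBracket

section Slice

variable {g V : Type*} [LieRing g] [LieAlgebra ℂ g]
  [AddCommGroup V] [Module ℂ V] {G : ConnectedAlgebraicGroup g V}
variable {χ : Dual ℂ g} {m : LieSubalgebra ℂ g} {M : Subgroup G.carrier}
variable {T : Set (Dual ℂ g)} {S : Dual ℂ g → Dual ℂ g}

variable (G χ m M T S) in
/-- `T` is a slice to the orbits of `M` on `μ⁻¹(0)`: every orbit meets `T` in exactly one point, and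
that point is a polynomial function `S` of the point of `μ⁻¹(0)`. -/
structure IsSlice : Prop where
  isMorphism : IsMorphism (polyFun (Dual ℂ g)) (polyFun (Dual ℂ g)) S
  mem : ∀ ξ, S ξ ∈ T
  exists_coAd : ∀ ξ ∈ zeroFibre χ m, ∃ u : M, G.coAd (u : G.carrier) (S ξ) = ξ
  coAd_mem : ∀ η ∈ T, ∀ u : M, G.coAd (u : G.carrier) η ∈ zeroFibre χ m
  map_coAd : ∀ η ∈ T, ∀ u : M, S (G.coAd (u : G.carrier) η) = η

theorem isMorphism_cls (hT : ∀ η ∈ T, η ∈ zeroFibre χ m) :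
    IsMorphism (regSub (polyFun (Dual ℂ g)) T) (regReduced G χ m M)
      (fun η => cls G χ m M ⟨η, hT η η.2⟩) := fun F hF => by
  obtain ⟨F', hF'⟩ := exists_isLift hF
  exact ⟨F', hF'.mem, funext fun η => hF'.eq ⟨η, hT η η.2⟩⟩

namespace IsSlice

theorem mem_zeroFibre (h : IsSlice G χ m M T S) : ∀ η ∈ T, η ∈ zeroFibre χ m := fun η hη => by
  simpa using h.coAd_mem η hη 1

theorem map_eq_self (h : IsSlice G χ m M T S) {η : Dual ℂ g} (hη : η ∈ T) : S η = η := by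
  simpa using h.map_coAd η hη 1

theorem map_coAd_of_mem_zeroFibre (h : IsSlice G χ m M T S) {ξ : Dual ℂ g}
    (hξ : ξ ∈ zeroFibre χ m) (u : M) : S (G.coAd (u : G.carrier) ξ) = S ξ := by
  obtain ⟨v, hv⟩ := h.exists_coAd ξ hξ
  have hmap := h.map_coAd _ (h.mem ξ) (u * v)
  rwa [Subgroup.coe_mul, ConnectedAlgebraicGroup.coAd_mul, hv] at hmap

/-- The bijection between a slice and the quotient `μ⁻¹(0) / M`. -/
def equiv (h : IsSlice G χ m M T S) : T ≃ Reduced G χ m M where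
  toFun η := cls G χ m M ⟨η, h.mem_zeroFibre η η.2⟩
  invFun := Quotient.lift (fun ξ : zeroFibre χ m => (⟨S ξ, h.mem ξ⟩ : T)) (by
    rintro ξ η ⟨u, hu⟩
    exact Subtype.ext ((h.map_coAd_of_mem_zeroFibre ξ.2 u).symm.trans (congrArg S hu)))
  left_inv η := Subtype.ext (h.map_eq_self η.2)
  right_inv p := by
    obtain ⟨ξ, rfl⟩ := Quotient.exists_rep p
    obtain ⟨u, hu⟩ := h.exists_coAd ξ ξ.2
    exact Quotient.sound ⟨u, hu⟩

theorem isIsomorphism_equiv (h : IsSlice G χ m M T S) :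
    IsIsomorphism (regSub (polyFun (Dual ℂ g)) T) (regReduced G χ m M) h.equiv := by
  refine ⟨isMorphism_cls h.mem_zeroFibre, ?_⟩
  rintro _ ⟨p, hp, rfl⟩
  exact IsLift.mem_regReduced (F' := p ∘ S) ⟨h.isMorphism p hp, fun ξ => rfl⟩

theorem isMorphism_equiv_symm (h : IsSlice G χ m M T S) :
    IsMorphism (regReduced G χ m M) (polyFun (Dual ℂ g)) (fun p => (h.equiv.symm p : Dual ℂ g)) :=
  (isMorphism_id.restrict _).comp h.isIsomorphism_equiv.2

theorem cls_equiv_symm (h : IsSlice G χ m M T S) (p : Reduced G χ m M) :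
    cls G χ m M ⟨h.equiv.symm p, h.mem_zeroFibre _ (h.equiv.symm p).2⟩ = p :=
  h.equiv.apply_symm_apply p

end IsSlice

end Slice

section Exponential

open ConnectedAlgebraicGroup

variable {g V : Type*} [LieRing g] [LieAlgebra ℂ g] [AddCommGroup V] [Module ℂ V]
  {G : ConnectedAlgebraicGroup g V}
variable {χ : Dual ℂ g} {m n : LieSubalgebra ℂ g}

/-- The kernel of `χ` on `m`. -/
def charKer (χ : Dual ℂ g) (m : LieSubalgebra ℂ g) : Submodule ℂ g :=
  m.toSubmodule ⊓ LinearMap.ker χ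

theorem apply_eq_zero_of_mem_charKer {ξ : Dual ℂ g} (hξ : ξ ∈ zeroFibre χ m) :
    ∀ z ∈ charKer χ m, ξ z = 0 :=
  fun z hz => (mem_zeroFibre.1 hξ z hz.1).trans hz.2

theorem coexp_mem_zeroFibre {x : g} (hx : ∀ y ∈ m, ⁅x, y⁆ ∈ charKer χ m) {ξ : Dual ℂ g}
    (hξ : ξ ∈ zeroFibre χ m) : coexp x ξ ∈ zeroFibre χ m :=
  mem_zeroFibre.2 fun y hy =>
    (coexp_apply_eq (fun z hz => hx z hz.1) (hx y hy) (apply_eq_zero_of_mem_charKer hξ)).trans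
      (mem_zeroFibre.1 hξ y hy)

variable {M : Subgroup G.carrier}

/-- `M` is the connected unipotent subgroup with Lie algebra `m`, and `m` acts nilpotently on `V`:
the polynomial map `exp : m → M` is then an isomorphism of varieties. -/
structure IsExponential (M : Subgroup G.carrier) (m : LieSubalgebra ℂ g) : Prop where
  unipotent : G.IsUnipotentSubgroup M m
  nilpotent : ∀ x ∈ m, IsNilpotent (G.lieMap x)

namespace IsExponential

variable [FiniteDimensional ℂ V]

/-- The exponential map of a connected unipotent subgroup. -/
def exp (hM : IsExponential M m) : m ≃ M := expEquiv hM.unipotent hM.nilpotent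

variable [FiniteDimensional ℂ g]

theorem coAd_exp (hM : IsExponential M m) (x : m) : G.coAd (hM.exp x) = coexp (x : g) :=
  coAd_expEquiv _ _ x

theorem Ad_mem (hM : IsExponential M m) {p : Submodule ℂ g} (hp : ∀ x ∈ m, ∀ y ∈ p, ⁅x, y⁆ ∈ p)
    (u : M) {y : g} (hy : y ∈ p) : G.Ad (u : G.carrier) y ∈ p := by
  obtain ⟨x, rfl⟩ := hM.exp.surjective u
  have hmem : nilExp (LieAlgebra.ad ℂ g (x : g)) y - y ∈ p :=
    nilExp_sub_mem (hp x x.2) (hp x x.2 y hy)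
  rw [exp, Ad_expEquiv]
  simpa using p.add_mem hmem hy

theorem coAd_mem_zeroFibre (hM : IsExponential M n) (hn : ∀ x ∈ n, ∀ y ∈ m, ⁅x, y⁆ ∈ charKer χ m)
    (u : M) {ξ : Dual ℂ g} (hξ : ξ ∈ zeroFibre χ m) :
    G.coAd (u : G.carrier) ξ ∈ zeroFibre χ m := by
  obtain ⟨x, rfl⟩ := hM.exp.surjective u
  rw [hM.coAd_exp]
  exact coexp_mem_zeroFibre (hn x x.2) hξ

theorem hasDerivAt (hM : IsExponential M m) (x : m) {F : Dual ℂ g → ℂ}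
    (hF : F ∈ polyFun (Dual ℂ g)) (ξ : Dual ℂ g) :
    HasDerivAt (fun t : ℂ => F (G.coAd (hM.exp (-t • x)) ξ)) (ξ ⁅(x : g), dualGradient F ξ⁆) 0 := by
  simp only [hM.coAd_exp]
  exact hasDerivAt_coexp (G.isNilpotent_ad_of_lieMap (hM.nilpotent x x.2)) hF ξ

theorem isPoissonReducible (hM : IsExponential M m) (hχ : ∀ x ∈ m, ∀ y ∈ m, χ ⁅x, y⁆ = 0) :
    IsPoissonReducible G χ m M where
  coAd_mem u ξ hξ := hM.coAd_mem_zeroFibre (fun x hx y hy => ⟨m.lie_mem hx hy, hχ x hx y hy⟩) u hξ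
  apply_lie_dualGradient F F' hF x hx ξ hξ := by
    have hconst : (fun t : ℂ => F' (G.coAd (hM.exp (-t • ⟨x, hx⟩)) ξ)) = fun _ => F' ξ := by
      funext t
      have hmem := hM.coAd_mem_zeroFibre (fun x hx y hy => ⟨m.lie_mem hx hy, hχ x hx y hy⟩)
        (hM.exp (-t • ⟨x, hx⟩)) hξ
      rw [hF.eq ⟨_, hmem⟩, cls_coAd _ ⟨ξ, hξ⟩, ← hF.eq ⟨ξ, hξ⟩]
    have hderiv := hM.hasDerivAt ⟨x, hx⟩ hF.mem ξ
    rw [hconst] at hderiv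
    exact hderiv.unique (hasDerivAt_const 0 _)

end IsExponential

end Exponential

/-! ### Reduction in stages -/

section Stages

open ConnectedAlgebraicGroup

variable {g V : Type*} [LieRing g] [LieAlgebra ℂ g] [AddCommGroup V] [Module ℂ V]
  {G : ConnectedAlgebraicGroup g V}
variable {χ₁ χ₂ : Dual ℂ g} {m₁ m₀ : LieSubalgebra ℂ g} {M₁ M₀ : Subgroup G.carrier}

/-- The compatibilities between two successive reductions: `m₀` normalizes `m₁` and the character
`χ₁` of `m₁`, and `χ₂` is a character of `m₀`. -/
structure IsStageDatum (χ₁ χ₂ : Dual ℂ g) (m₁ m₀ : LieSubalgebra ℂ g) : Prop where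
  lie_mem : ∀ x ∈ m₀, ∀ y ∈ m₁, ⁅x, y⁆ ∈ m₁
  character₁ : ∀ x ∈ m₁, ∀ y ∈ m₁, χ₁ ⁅x, y⁆ = 0
  invariant : ∀ x ∈ m₀, ∀ y ∈ m₁, χ₁ ⁅x, y⁆ = 0
  character₂ : ∀ x ∈ m₀, ∀ y ∈ m₀, χ₂ ⁅x, y⁆ = 0

theorem isMorphism_twistedRestriction :
    IsMorphism (polyFun (Dual ℂ g)) (polyFun (Dual ℂ m₀)) (twistedRestriction χ₂ m₀) :=
  (isMorphism_linear (m₀.incl : m₀ →ₗ[ℂ] g).dualMap).sub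
    (isMorphism_const ((m₀.incl : m₀ →ₗ[ℂ] g).dualMap χ₂))

theorem dualGradient_comp_twistedRestriction [FiniteDimensional ℂ g] {F : Dual ℂ m₀ → ℂ}
    (hF : F ∈ polyFun (Dual ℂ m₀)) (ξ : Dual ℂ g) :
    dualGradient (F ∘ twistedRestriction χ₂ m₀) ξ =
      ((dualGradient F (twistedRestriction χ₂ m₀ ξ) : m₀) : g) := by
  refine dualGradient_eq (isMorphism_twistedRestriction F hF) fun η => ?_
  have hline (t : ℂ) : twistedRestriction χ₂ m₀ (ξ + t • η) =
      twistedRestriction χ₂ m₀ ξ + t • (m₀.incl : m₀ →ₗ[ℂ] g).dualMap η := by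
    ext y
    change (ξ + t • η) y - χ₂ y = (ξ y - χ₂ y) + t • η y
    rw [LinearMap.add_apply, LinearMap.smul_apply]
    ring
  simp only [Function.comp_apply, hline]
  exact hasDerivAt_dualGradient hF _ _

theorem IsReducedBracket.bracket_cls [FiniteDimensional ℂ g] {χ : Dual ℂ g}
    {m : LieSubalgebra ℂ g} {M : Subgroup G.carrier} {P : PoissonBracket (regReduced G χ m M)}
    (hP : IsReducedBracket G χ m M P) {F H : regReduced G χ m M} {F' H' : Dual ℂ g → ℂ}
    (hF : IsLift (F : Reduced G χ m M → ℂ) F') (hH : IsLift (H : Reduced G χ m M → ℂ) H')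
    (ξ : zeroFibre χ m) :
    (P.bracket F H : Reduced G χ m M → ℂ) (cls G χ m M ξ) = kkBracket F' H' ξ :=
  hP F H F' hF.mem H' hH.mem hF.eq hH.eq ξ

variable [FiniteDimensional ℂ g] [FiniteDimensional ℂ V]

namespace IsStageDatum

variable (hS : IsStageDatum χ₁ χ₂ m₁ m₀)
variable (hM₁ : IsExponential M₁ m₁) (hM₀ : IsExponential M₀ m₀)

include hS hM₀ in
theorem coAd_mem (u : M₀) {ξ : Dual ℂ g} (hξ : ξ ∈ zeroFibre χ₁ m₁) :
    G.coAd (u : G.carrier) ξ ∈ zeroFibre χ₁ m₁ :=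
  hM₀.coAd_mem_zeroFibre (fun x hx y hy => ⟨hS.lie_mem x hx y hy, hS.invariant x hx y hy⟩) u hξ

include hS hM₁ in
theorem coAd_apply_of_mem (v : M₁) {ξ : Dual ℂ g} (hξ : ξ ∈ zeroFibre χ₁ m₁) {y : g}
    (hy : y ∈ m₀) : G.coAd (v : G.carrier) ξ y = ξ y := by
  obtain ⟨x, rfl⟩ := hM₁.exp.surjective v
  have hxy : ⁅(x : g), y⁆ ∈ charKer χ₁ m₁ := by
    rw [← lie_skew]
    exact neg_mem ⟨hS.lie_mem y hy x x.2, hS.invariant y hy x x.2⟩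
  rw [hM₁.coAd_exp]
  exact coexp_apply_eq (p := charKer χ₁ m₁)
    (fun z hz => ⟨m₁.lie_mem x.2 hz.1, hS.character₁ x x.2 z hz.1⟩) hxy
    (apply_eq_zero_of_mem_charKer hξ)

include hS hM₀ in
theorem coAd_character (u : M₀) {y : g} (hy : y ∈ m₀) : G.coAd (u : G.carrier) χ₂ y = χ₂ y := by
  obtain ⟨x, rfl⟩ := hM₀.exp.surjective u
  have hlie : ∀ z ∈ m₀, ⁅(x : g), z⁆ ∈ charKer χ₂ m₀ := fun z hz =>
    ⟨m₀.lie_mem x.2 hz, hS.character₂ x x.2 z hz⟩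
  rw [hM₀.coAd_exp]
  exact coexp_apply_eq (fun z hz => hlie z hz.1) (hlie y hy) fun _ hz => hz.2

include hS hM₁ hM₀ in
theorem conj_mem (u : M₀) (v : M₁) : (u : G.carrier) * v * (u : G.carrier)⁻¹ ∈ M₁ := by
  obtain ⟨y, rfl⟩ := hM₁.exp.surjective v
  have hmem : G.Ad (u : G.carrier) y ∈ m₁.toSubmodule := hM₀.Ad_mem hS.lie_mem u y.2
  have hconj := conj_expEquiv hM₁.unipotent hM₁.nilpotent (u : G.carrier) y ⟨_, hmem⟩ rfl
  exact hconj ▸ Subtype.property _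

/-- The action of `M₀` on `μ₁⁻¹(0) / M₁`. -/
abbrev action : MulAction M₀ (Reduced G χ₁ m₁ M₁) where
  smul u := Quotient.map (fun ξ => ⟨G.coAd (u : G.carrier) ξ, hS.coAd_mem hM₀ u ξ.2⟩) (by
    rintro ξ η ⟨v, hv⟩
    refine ⟨⟨_, hS.conj_mem hM₁ hM₀ u v⟩, ?_⟩
    change G.coAd ((u : G.carrier) * v * (u : G.carrier)⁻¹) (G.coAd (u : G.carrier) ξ) =
      G.coAd (u : G.carrier) η
    rw [← hv, ← coAd_mul, ← coAd_mul, inv_mul_cancel_right])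
  one_smul p := by
    obtain ⟨ξ, rfl⟩ := Quotient.exists_rep p
    refine congrArg (Quotient.mk _) (Subtype.ext ?_)
    simp
  mul_smul u v p := by
    obtain ⟨ξ, rfl⟩ := Quotient.exists_rep p
    exact congrArg (Quotient.mk _) (Subtype.ext (coAd_mul (u : G.carrier) v ξ))

theorem smul_cls (u : M₀) (ξ : zeroFibre χ₁ m₁) :
    letI := hS.action hM₁ hM₀
    u • cls G χ₁ m₁ M₁ ξ =
      cls G χ₁ m₁ M₁ ⟨G.coAd (u : G.carrier) ξ, hS.coAd_mem hM₀ u ξ.2⟩ :=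
  rfl

theorem isLift_smul {F F₁ : Reduced G χ₁ m₁ M₁ → ℂ} {F' : Dual ℂ g → ℂ} (hF : IsLift F F')
    (u : M₀) (hF₁ : letI := hS.action hM₁ hM₀; ∀ p, F₁ p = F (u • p)) :
    IsLift F₁ (F' ∘ G.coAd (u : G.carrier)) :=
  ⟨polyFun_comp _ hF.mem, fun ξ => by
    rw [hF₁, smul_cls, ← hF.eq]
    rfl⟩

/-- The moment map on `μ₁⁻¹(0) / M₁`. -/
def moment : Reduced G χ₁ m₁ M₁ → Dual ℂ m₀ :=
  Quotient.lift (fun ξ : zeroFibre χ₁ m₁ => twistedRestriction χ₂ m₀ (ξ : Dual ℂ g)) (by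
    rintro ξ η ⟨v, hv⟩
    ext y
    rw [twistedRestriction_apply, twistedRestriction_apply, ← hv,
      hS.coAd_apply_of_mem hM₁ v ξ.2 y.2])

theorem moment_cls (ξ : zeroFibre χ₁ m₁) :
    hS.moment hM₁ (cls G χ₁ m₁ M₁ ξ) = twistedRestriction χ₂ m₀ (ξ : Dual ℂ g) := rfl

theorem isLift_comp_moment {F : Dual ℂ m₀ → ℂ} (hF : F ∈ polyFun (Dual ℂ m₀)) :
    IsLift (F ∘ hS.moment hM₁) (F ∘ twistedRestriction χ₂ m₀) :=
  ⟨isMorphism_twistedRestriction F hF, fun _ => rfl⟩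

theorem moment_smul (u : M₀) (y : m₀) (hy : G.Ad (u : G.carrier)⁻¹ y ∈ m₀)
    (p : Reduced G χ₁ m₁ M₁) :
    letI := hS.action hM₁ hM₀
    hS.moment hM₁ (u • p) y = hS.moment hM₁ p ⟨G.Ad (u : G.carrier)⁻¹ y, hy⟩ := by
  obtain ⟨ξ, rfl⟩ := Quotient.exists_rep p
  change G.coAd (u : G.carrier) ξ y - χ₂ y =
    G.coAd (u : G.carrier) ξ y - G.coAd (u : G.carrier) χ₂ y
  rw [hS.coAd_character hM₀ u y.2]

variable {P : PoissonBracket (regReduced G χ₁ m₁ M₁)}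

theorem bracket_smul (hP : IsReducedBracket G χ₁ m₁ M₁ P) (u : M₀)
    (F H F₁ H₁ : regReduced G χ₁ m₁ M₁) :
    letI := hS.action hM₁ hM₀
    (∀ p, (F₁ : Reduced G χ₁ m₁ M₁ → ℂ) p = (F : Reduced G χ₁ m₁ M₁ → ℂ) (u • p)) →
    (∀ p, (H₁ : Reduced G χ₁ m₁ M₁ → ℂ) p = (H : Reduced G χ₁ m₁ M₁ → ℂ) (u • p)) →
    ∀ p, (P.bracket F₁ H₁ : Reduced G χ₁ m₁ M₁ → ℂ) p =
      (P.bracket F H : Reduced G χ₁ m₁ M₁ → ℂ) (u • p) := by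
  intro hF₁ hH₁ p
  obtain ⟨ξ, rfl⟩ : ∃ ξ, cls G χ₁ m₁ M₁ ξ = p := Quotient.exists_rep p
  obtain ⟨F', hF'⟩ := exists_isLift F.2
  obtain ⟨H', hH'⟩ := exists_isLift H.2
  rw [smul_cls, hP.bracket_cls hF' hH', ← kkBracket_comp_coAd hF'.mem hH'.mem]
  exact hP.bracket_cls (hS.isLift_smul hM₁ hM₀ hF' u hF₁) (hS.isLift_smul hM₁ hM₀ hH' u hH₁) ξ

theorem bracket_comp_moment (hP : IsReducedBracket G χ₁ m₁ M₁ P) {F H : Dual ℂ m₀ → ℂ}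
    (hF : F ∈ polyFun (Dual ℂ m₀)) (hH : H ∈ polyFun (Dual ℂ m₀))
    {F₁ H₁ : regReduced G χ₁ m₁ M₁} (hF₁ : (F₁ : Reduced G χ₁ m₁ M₁ → ℂ) = F ∘ hS.moment hM₁)
    (hH₁ : (H₁ : Reduced G χ₁ m₁ M₁ → ℂ) = H ∘ hS.moment hM₁) :
    (P.bracket F₁ H₁ : Reduced G χ₁ m₁ M₁ → ℂ) = kkBracket F H ∘ hS.moment hM₁ := by
  funext p
  obtain ⟨ξ, rfl⟩ : ∃ ξ, cls G χ₁ m₁ M₁ ξ = p := Quotient.exists_rep p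
  rw [hP.bracket_cls (hF₁ ▸ hS.isLift_comp_moment hM₁ hF) (hH₁ ▸ hS.isLift_comp_moment hM₁ hH),
    Function.comp_apply, hS.moment_cls hM₁, kkBracket, kkBracket,
    dualGradient_comp_twistedRestriction hF, dualGradient_comp_twistedRestriction hH,
    twistedRestriction_apply, LieSubalgebra.coe_bracket,
    hS.character₂ _ (Subtype.property _) _ (Subtype.property _), sub_zero]

theorem hasDerivAt_exp_smul (hP : IsReducedBracket G χ₁ m₁ M₁ P) (x : m₀)
    {F X : regReduced G χ₁ m₁ M₁}
    (hX : ∀ p, (X : Reduced G χ₁ m₁ M₁ → ℂ) p = hS.moment hM₁ p x) (p : Reduced G χ₁ m₁ M₁) :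
    letI := hS.action hM₁ hM₀
    HasDerivAt (fun t : ℂ => (F : Reduced G χ₁ m₁ M₁ → ℂ) (hM₀.exp (-t • x) • p))
      ((P.bracket X F : Reduced G χ₁ m₁ M₁ → ℂ) p) 0 := by
  obtain ⟨ξ, rfl⟩ : ∃ ξ, cls G χ₁ m₁ M₁ ξ = p := Quotient.exists_rep p
  obtain ⟨F', hF'⟩ := exists_isLift F.2
  have hX' : IsLift (X : Reduced G χ₁ m₁ M₁ → ℂ) (fun ξ => ξ (x : g) - χ₂ x) :=
    ⟨Subalgebra.sub_mem _ (eval_mem_polyFun (x : g)) (const_mem _ _), fun ξ => by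
      rw [hX, hS.moment_cls hM₁, twistedRestriction_apply]⟩
  rw [hP.bracket_cls hX' hF', kkBracket, dualGradient_eval_sub]
  refine (hM₀.hasDerivAt x hF'.mem ξ).congr_of_eventuallyEq (.of_forall fun t => ?_)
  exact (hF'.eq ⟨_, hS.coAd_mem hM₀ (hM₀.exp (-t • x)) ξ.2⟩).symm

theorem isHamiltonian (hP : IsReducedBracket G χ₁ m₁ M₁ P) :
    letI := hS.action hM₁ hM₀
    IsHamiltonian G (regReduced G χ₁ m₁ M₁) P M₀ m₀ (hS.moment hM₁) :=
  letI := hS.action hM₁ hM₀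
  { poisson := hS.bracket_smul hM₁ hM₀ hP
    morphism := fun _ hF => (hS.isLift_comp_moment hM₁ hF).mem_regReduced
    equivariant := fun u y =>
      have hy : G.Ad (u : G.carrier)⁻¹ y ∈ m₀ :=
        hM₀.Ad_mem (p := m₀.toSubmodule) (fun _ hx _ hy => m₀.lie_mem hx hy) u⁻¹ y.2
      ⟨⟨_, hy⟩, rfl, hS.moment_smul hM₁ hM₀ u y hy⟩
    comap_bracket := fun _ hF _ hH _ _ hF₁ hH₁ => hS.bracket_comp_moment hM₁ hP hF hH hF₁ hH₁
    infinitesimal := fun x => ⟨fun t => hM₀.exp (t • x), fun t => by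
      rw [IsExponential.exp, coe_expEquiv, expGL_val]
      exact congrArg nilExp (map_smul G.lieMap t (x : g)),
      fun _ _ hX p => hS.hasDerivAt_exp_smul hM₁ hM₀ hP x hX p⟩ }

theorem isAlgebraicAction {T : Set (Dual ℂ g)} {S : Dual ℂ g → Dual ℂ g}
    (hT : IsSlice G χ₁ m₁ M₁ T S) :
    letI := hS.action hM₁ hM₀
    IsAlgebraicAction G (regReduced G χ₁ m₁ M₁) M₀ := by
  let := hS.action hM₁ hM₀
  intro F hF
  obtain ⟨F', hF'⟩ := exists_isLift hF
  have hmem := (isMorphism_coAd (G := G) M₀).comp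
    ((isMorphism_fst (A := G.regSubgroup M₀) (B := regReduced G χ₁ m₁ M₁)).prodMk
      (hT.isMorphism_equiv_symm.comp isMorphism_snd)) F' hF'.mem
  convert hmem using 1
  funext ⟨u, p⟩
  change F (u • p) = F' (G.coAd (u : G.carrier) (hT.equiv.symm p))
  have hsymm := hT.mem_zeroFibre _ (hT.equiv.symm p).2
  rw [hF'.eq ⟨_, hS.coAd_mem hM₀ u hsymm⟩, ← hS.smul_cls hM₁ hM₀ u ⟨_, hsymm⟩, hT.cls_equiv_symm]

end IsStageDatum

end Stages

section Cartan

variable {g : Type*} [LieRing g] [LieAlgebra ℂ g]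

theorem exists_ad_pow_eq_zero (h : LieSubalgebra ℂ g) [LieRing.IsNilpotent h] {x y : g}
    (hx : x ∈ h) (hy : y ∈ h) : ∃ n, (LieAlgebra.ad ℂ g x ^ n) y = 0 := by
  obtain ⟨n, hn⟩ := LieModule.exists_forall_pow_toEnd_eq_zero ℂ h h
  have hcoe (k : ℕ) : (((LieModule.toEnd ℂ h h ⟨x, hx⟩ ^ k) ⟨y, hy⟩ : h) : g) =
      (LieAlgebra.ad ℂ g x ^ k) y := by
    induction k with
    | zero => rfl
    | succ k ih =>
      rw [pow_succ', pow_succ', Module.End.mul_apply, Module.End.mul_apply, ← ih]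
      rfl
  refine ⟨n, ?_⟩
  rw [← hcoe n, hn]
  rfl

theorem IsGradingElement.ad_pow_apply {Γ : ℤ → Submodule ℂ g} {q : g} (hq : IsGradingElement Γ q)
    {j : ℤ} {x : g} (hx : x ∈ Γ j) (n : ℕ) :
    (LieAlgebra.ad ℂ g q ^ n) x = (j : ℂ) ^ n • x := by
  induction n with
  | zero => simp
  | succ n ih =>
    rw [pow_succ', Module.End.mul_apply, ih, map_smul, LieAlgebra.ad_apply, (hq j x).1 hx,
      smul_smul, pow_succ]

theorem IsGradingElement.mem_zero_of_ad_pow_eq_zero [FiniteDimensional ℂ g]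
    {Γ : ℤ → Submodule ℂ g} {q x : g} (hq : IsGradingElement Γ q) (hΓ : DirectSum.IsInternal Γ)
    {n : ℕ} (hx : (LieAlgebra.ad ℂ g q ^ n) x = 0) : x ∈ Γ 0 := by
  refine mem_of_forall_gproj_mem hΓ fun j => ?_
  obtain rfl | hj := eq_or_ne j 0
  · exact gproj_mem hΓ 0 x
  · have hcomm := gproj_map hΓ hΓ (LieAlgebra.ad ℂ g q ^ n) (i := 0) (fun i y hy => by
      rw [hq.ad_pow_apply hy, zero_add]
      exact (Γ i).smul_mem _ hy) j x
    rw [hx, map_zero, hq.ad_pow_apply (gproj_mem hΓ j x), eq_comm, smul_eq_zero] at hcomm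
    rw [hcomm.resolve_left (pow_ne_zero _ (Int.cast_ne_zero.2 hj))]
    exact zero_mem _

theorem IsGradingElement.lie_eq_zero_of_mem [FiniteDimensional ℂ g] {Γ : ℤ → Submodule ℂ g}
    {q q' : g} (hq : IsGradingElement Γ q) (hΓ : DirectSum.IsInternal Γ) {h : LieSubalgebra ℂ g}
    [LieRing.IsNilpotent h] (hqh : q ∈ h) (hqh' : q' ∈ h) : ⁅q, q'⁆ = 0 := by
  obtain ⟨n, hn⟩ := exists_ad_pow_eq_zero h hqh hqh'
  simpa using (hq 0 q').1 (hq.mem_zero_of_ad_pow_eq_zero hΓ hn)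

end Cartan

section SingleStage

open ConnectedAlgebraicGroup

variable {g V : Type*} [LieRing g] [LieAlgebra ℂ g] [FiniteDimensional ℂ g]
  [AddCommGroup V] [Module ℂ V] [FiniteDimensional ℂ V] {G : ConnectedAlgebraicGroup g V}
variable {B : LinearMap.BilinForm ℂ g} {Γ : ℤ → Submodule ℂ g} {f q : g} {m : LieSubalgebra ℂ g}
  {M : Subgroup G.carrier}

theorem coexp_zero : coexp (0 : g) = LinearMap.id := by
  rw [coexp, map_zero, neg_zero, nilExp_zero]
  rfl

omit [FiniteDimensional ℂ g] in
theorem IsMorphism.form_add {X : Type*} {A : Subalgebra ℂ (X → ℂ)} {a b C : Submodule ℂ g}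
    {τ : X → a × b × C} (hτ : IsMorphism A (polyFun (a × b × C)) τ) :
    IsMorphism A (polyFun (Dual ℂ g)) (fun x => B (f + (τ x).2.2)) :=
  ((isMorphism_const f).add
    (hτ.linear (C.subtype ∘ₗ LinearMap.snd ℂ b C ∘ₗ LinearMap.snd ℂ a (b × C)))).linear B

theorem IsExponential.coAd_exp_form (hM : IsExponential M m) {C : Submodule ℂ g}
    (v : m.toSubmodule × (⊥ : Submodule ℂ g) × C) :
    G.coAd (hM.exp v.1) (B (f + v.2.2)) = coadjointMap B f m.toSubmodule ⊥ C v := by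
  rw [hM.coAd_exp, coadjointMap, (Submodule.mem_bot ℂ).1 v.2.1.2, coexp_zero, LinearMap.id_apply]

theorem IsGradedComplement.exists_isSlice (hΓ : IsGoodGrading Γ f) {C : Submodule ℂ g}
    (hC : IsGradedComplement hΓ.internal B f m C) (hq : IsGradingElement Γ q)
    (hB : B.Nondegenerate) (hBinv : B.lieInvariant g) (hm : IsGoodAlgebra Γ (B f) m)
    (hM : IsExponential M m) :
    ∃ S, IsSlice G (B f) m M {ξ | ∃ s ∈ C, ξ = B (f + s)} S := by
  obtain ⟨τ, hτ, hright, hleft⟩ := hC.exists_inverse_coadjointMap hΓ hm hB hBinv hq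
    (a := m.toSubmodule) (b := ⊥) (by simp) disjoint_bot_right (hm.isHomogeneousSub hΓ.internal)
    (isHomogeneousSub_bot hΓ.internal)
  have hparam (s : C) (x : m) : G.coAd (hM.exp x) (B (f + s)) =
      coadjointMap B f m.toSubmodule ⊥ C (x, 0, s) := hM.coAd_exp_form (x, 0, s)
  refine ⟨fun ξ => B (f + (τ ξ).2.2),
    { isMorphism := hτ.form_add
      mem := fun ξ => ⟨_, (τ ξ).2.2.2, rfl⟩
      exists_coAd := fun ξ hξ => ⟨hM.exp (τ ξ).1, (hM.coAd_exp_form (τ ξ)).trans (hright ξ hξ)⟩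
      coAd_mem := ?_
      map_coAd := ?_ }⟩
  · rintro _ ⟨s, hs, rfl⟩ u
    obtain ⟨x, rfl⟩ := hM.exp.surjective u
    rw [hparam ⟨s, hs⟩]
    exact hC.coadjointMap_mem_zeroFibre hΓ hm hBinv hq le_rfl bot_le _
  · rintro _ ⟨s, hs, rfl⟩ u
    obtain ⟨x, rfl⟩ := hM.exp.surjective u
    simp only [hparam ⟨s, hs⟩, hleft]

theorem IsGradedTriple.exists_isSlice {e h : g} (ht : IsGradedTriple Γ e h f)
    (hΓ : IsGoodGrading Γ f) (hq : IsGradingElement Γ q) (hB : B.Nondegenerate)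
    (hBinv : B.lieInvariant g) (hm : IsGoodAlgebra Γ (B f) m) (hM : IsExponential M m) :
    ∃ S, IsSlice G (B f) m M (slice (B f) e) S := by
  rw [slice_form hB hBinv]
  exact (ht.isGradedComplement hΓ hm hB hBinv hq).exists_isSlice hΓ hq hB hBinv hm hM

end SingleStage

section StageSlice

open ConnectedAlgebraicGroup

variable {g V : Type*} [LieRing g] [LieAlgebra ℂ g] [AddCommGroup V] [Module ℂ V]
  {G : ConnectedAlgebraicGroup g V}
variable {χ₁ χ₂ : Dual ℂ g} {m₁ m₀ : LieSubalgebra ℂ g} {M₁ M₀ : Subgroup G.carrier}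
variable {T : Set (Dual ℂ g)} {Y : Dual ℂ g → M₀} {S : Dual ℂ g → Dual ℂ g}

variable (G χ₁ χ₂ m₁ m₀ M₁ M₀ T Y S) in
/-- `T` is a slice to the action of `M₁ M₀` on `μ₁⁻¹(0) ∩ {ξ | ξ = χ₂ on m₀}`: every point `ξ` is
`Ad*(v u) η` for unique `v ∈ M₁`, `u ∈ M₀` and `η ∈ T`, and `u = Y ξ` and `η = S ξ` are polynomial
functions of `ξ`. -/
structure IsStageSlice : Prop where
  isMorphism_left : IsMorphism (polyFun (Dual ℂ g)) (G.regSubgroup M₀) Y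
  isMorphism_right : IsMorphism (polyFun (Dual ℂ g)) (polyFun (Dual ℂ g)) S
  mem : ∀ ξ, S ξ ∈ T
  exists_coAd : ∀ ξ ∈ zeroFibre χ₁ m₁, ξ ∈ zeroFibre χ₂ m₀ →
    ∃ v : M₁, G.coAd (v : G.carrier) (G.coAd (Y ξ : G.carrier) (S ξ)) = ξ
  coAd_mem : ∀ (v : M₁) (u : M₀), ∀ η ∈ T,
    G.coAd (v : G.carrier) (G.coAd (u : G.carrier) η) ∈ zeroFibre χ₁ m₁ ∧
      G.coAd (v : G.carrier) (G.coAd (u : G.carrier) η) ∈ zeroFibre χ₂ m₀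
  left_coAd : ∀ (v : M₁) (u : M₀), ∀ η ∈ T,
    Y (G.coAd (v : G.carrier) (G.coAd (u : G.carrier) η)) = u
  right_coAd : ∀ (v : M₁) (u : M₀), ∀ η ∈ T,
    S (G.coAd (v : G.carrier) (G.coAd (u : G.carrier) η)) = η

namespace IsStageSlice

theorem mem_zeroFibre (hT : IsStageSlice G χ₁ χ₂ m₁ m₀ M₁ M₀ T Y S) :
    ∀ η ∈ T, η ∈ zeroFibre χ₁ m₁ := fun η hη => by
  simpa using (hT.coAd_mem 1 1 η hη).1

variable [FiniteDimensional ℂ g] [FiniteDimensional ℂ V]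
variable (hT : IsStageSlice G χ₁ χ₂ m₁ m₀ M₁ M₀ T Y S) (hS : IsStageDatum χ₁ χ₂ m₁ m₀)
  (hM₁ : IsExponential M₁ m₁) (hM₀ : IsExponential M₀ m₀)

theorem moment_smul_cls (u : M₀) (η : T) :
    letI := hS.action hM₁ hM₀
    hS.moment hM₁ (u • cls G χ₁ m₁ M₁ ⟨η, hT.mem_zeroFibre η η.2⟩) = 0 := by
  simpa using! (hT.coAd_mem 1 u η η.2).2

variable {T₁ : Set (Dual ℂ g)} {S₁ : Dual ℂ g → Dual ℂ g} (hT₁ : IsSlice G χ₁ m₁ M₁ T₁ S₁)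

/-- The inverse of `(u, η) ↦ u • [η]`, computed on the representatives in a slice for `M₁`. -/
def factor (p : Reduced G χ₁ m₁ M₁) : M₀ × T :=
  (Y (hT₁.equiv.symm p), ⟨S (hT₁.equiv.symm p), hT.mem _⟩)

include hS in
theorem factor_smul_cls (u : M₀) (η : T) :
    letI := hS.action hM₁ hM₀
    hT.factor hT₁ (u • cls G χ₁ m₁ M₁ ⟨η, hT.mem_zeroFibre η η.2⟩) = (u, η) := by
  let := hS.action hM₁ hM₀
  obtain ⟨v, hv⟩ := exists_coAd_of_cls_eq ((hS.smul_cls hM₁ hM₀ u _).symm.trans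
    (hT₁.cls_equiv_symm (u • cls G χ₁ m₁ M₁ ⟨η, hT.mem_zeroFibre η η.2⟩)).symm)
  refine Prod.ext ?_ (Subtype.ext ?_)
  · exact (congrArg Y hv).symm.trans (hT.left_coAd v u η η.2)
  · exact (congrArg S hv).symm.trans (hT.right_coAd v u η η.2)

theorem factor_smul_factor {p : Reduced G χ₁ m₁ M₁} (hp : hS.moment hM₁ p = 0) :
    letI := hS.action hM₁ hM₀
    (hT.factor hT₁ p).1 •
      cls G χ₁ m₁ M₁ ⟨(hT.factor hT₁ p).2, hT.mem_zeroFibre _ (hT.factor hT₁ p).2.2⟩ = p := by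
  let := hS.action hM₁ hM₀
  have hσ := hT₁.mem_zeroFibre _ (hT₁.equiv.symm p).2
  rw [← hT₁.cls_equiv_symm p, hS.moment_cls hM₁] at hp
  obtain ⟨v, hv⟩ := hT.exists_coAd _ hσ hp
  rw [hS.smul_cls hM₁ hM₀]
  exact (Quotient.sound (s := G.orbitSetoid M₁ (zeroFibre χ₁ m₁)) ⟨v, hv⟩).trans
    (hT₁.cls_equiv_symm p)

/-- The bijection `(u, η) ↦ u • [η]` onto the zero fibre of the moment map. -/
def equiv : M₀ × T ≃ ↥(hS.moment hM₁ ⁻¹' {0}) :=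
  letI := hS.action hM₁ hM₀
  { toFun := fun z => ⟨z.1 • cls G χ₁ m₁ M₁ ⟨z.2, hT.mem_zeroFibre z.2 z.2.2⟩,
      hT.moment_smul_cls hS hM₁ hM₀ z.1 z.2⟩
    invFun := fun p => hT.factor hT₁ p
    left_inv := fun z => hT.factor_smul_cls hS hM₁ hM₀ hT₁ z.1 z.2
    right_inv := fun p => Subtype.ext (hT.factor_smul_factor hS hM₁ hM₀ hT₁ p.2) }

theorem coe_equiv (u : M₀) (η : T) :
    letI := hS.action hM₁ hM₀
    (hT.equiv hS hM₁ hM₀ hT₁ (u, η) : Reduced G χ₁ m₁ M₁) =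
      u • cls G χ₁ m₁ M₁ ⟨η, hT.mem_zeroFibre η η.2⟩ :=
  rfl

theorem equiv_mul (u v : M₀) (η : T) :
    letI := hS.action hM₁ hM₀
    (hT.equiv hS hM₁ hM₀ hT₁ (u * v, η) : Reduced G χ₁ m₁ M₁) =
      u • (hT.equiv hS hM₁ hM₀ hT₁ (v, η)).val := by
  let := hS.action hM₁ hM₀
  rw [coe_equiv, coe_equiv, mul_smul]

theorem isIsomorphism_equiv :
    IsIsomorphism (regProd (G.regSubgroup M₀) (regSub (polyFun (Dual ℂ g)) T))
      (regSub (regReduced G χ₁ m₁ M₁) (hS.moment hM₁ ⁻¹' {0})) (hT.equiv hS hM₁ hM₀ hT₁) := by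
  let := hS.action hM₁ hM₀
  have hsection := hT₁.isMorphism_equiv_symm
  refine ⟨?_, ?_⟩
  · exact ((hS.isAlgebraicAction hM₁ hM₀ hT₁).comp (isMorphism_fst.prodMk
      ((isMorphism_cls hT.mem_zeroFibre).comp isMorphism_snd))).codRestrict _
        fun z => hT.moment_smul_cls hS hM₁ hM₀ z.1 z.2
  · exact ((hT.isMorphism_left.comp hsection).prodMk
      ((hT.isMorphism_right.comp hsection).codRestrict T fun _ => hT.mem _)).restrict _

end IsStageSlice

end StageSlice

section GoodPair

open ConnectedAlgebraicGroup

variable {g V : Type*} [LieRing g] [LieAlgebra ℂ g] [AddCommGroup V] [Module ℂ V]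
  {G : ConnectedAlgebraicGroup g V}

theorem IsExponential.of_le_filt [FiniteDimensional ℂ V] {m : LieSubalgebra ℂ g}
    {M : Subgroup G.carrier} (hM : G.IsUnipotentSubgroup M m) {Γ : ℤ → Submodule ℂ g} {q : g}
    (hq : IsGradingElement Γ q) (hm : m.toSubmodule ≤ filt Γ 1) : IsExponential M m :=
  ⟨hM, fun _ hx => isNilpotent_lieMap_of_mem_filt hq (hm hx)⟩

theorem IsGradingElement.isHomogeneousSub [FiniteDimensional ℂ g] {Γ : ℤ → Submodule ℂ g} {q : g}
    (hq : IsGradingElement Γ q) (hΓ : DirectSum.IsInternal Γ) {p : Submodule ℂ g}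
    (hp : ∀ x ∈ p, ⁅q, x⁆ ∈ p) : IsHomogeneousSub hΓ p :=
  isHomogeneousSub_of_stable hΓ (LieAlgebra.ad ℂ g q) (fun j x hx => (hq j x).1 hx) hp

theorem IsGradingElement.lie_mem_of_lie_eq_zero {Γ : ℤ → Submodule ℂ g} {q q' : g}
    (hq : IsGradingElement Γ q) (hqq' : ⁅q, q'⁆ = 0) {j : ℤ} {x : g} (hx : x ∈ Γ j) :
    ⁅q', x⁆ ∈ Γ j := by
  rw [hq, leibniz_lie, hqq', zero_lie, zero_add, (hq j x).1 hx, lie_smul]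

variable {B : LinearMap.BilinForm ℂ g} {Γ₁ Γ₂ : ℤ → Submodule ℂ g} {f₁ f₂ q₁ q₂ : g}
  {m₁ m₂ m₀ : LieSubalgebra ℂ g} {M₁ M₀ : Subgroup G.carrier}

/-- Good algebras `m₁` and `m₂ = m₁ ⊕ m₀` for which the reduction by `m₂` splits into the stages
`m₁` and `m₀`. -/
structure IsGoodPair (B : LinearMap.BilinForm ℂ g) (Γ₁ Γ₂ : ℤ → Submodule ℂ g) (f₁ f₂ : g)
    (m₁ m₂ m₀ : LieSubalgebra ℂ g) : Prop where
  good₁ : IsGoodAlgebra Γ₁ (B f₁) m₁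
  good₂ : IsGoodAlgebra Γ₂ (B f₂) m₂
  sup_eq : m₁.toSubmodule ⊔ m₀.toSubmodule = m₂.toSubmodule
  lie_mem : ∀ x ∈ m₂, ∀ y ∈ m₁, ⁅x, y⁆ ∈ m₁
  sub_mem : f₂ - f₁ ∈ Γ₁ 0
  le_zero : m₀.toSubmodule ≤ Γ₁ 0

namespace IsGoodPair

variable (h : IsGoodPair B Γ₁ Γ₂ f₁ f₂ m₁ m₂ m₀)
include h

theorem le₁ : m₁ ≤ m₂ := show m₁.toSubmodule ≤ m₂.toSubmodule from h.sup_eq ▸ le_sup_left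

theorem le₀ : m₀ ≤ m₂ := show m₀.toSubmodule ≤ m₂.toSubmodule from h.sup_eq ▸ le_sup_right

theorem exists_add_eq {z : g} (hz : z ∈ m₂) : ∃ x ∈ m₁, ∃ y ∈ m₀, x + y = z := by
  rw [← LieSubalgebra.mem_toSubmodule, ← h.sup_eq] at hz
  exact Submodule.mem_sup.1 hz

theorem eq_inf_filt (hΓ₁ : DirectSum.IsInternal Γ₁) :
    m₁.toSubmodule = m₂.toSubmodule ⊓ filt Γ₁ 1 := by
  refine le_antisymm (le_inf h.le₁ h.good₁.le_filt_one) ?_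
  rintro z ⟨hz, hz_pos⟩
  obtain ⟨x, hx, y, hy, rfl⟩ := h.exists_add_eq hz
  have hy_pos : y ∈ filt Γ₁ 1 := (Submodule.add_mem_iff_right _ (h.good₁.le_filt_one hx)).1 hz_pos
  have hy_zero : y = 0 :=
    (gproj_same hΓ₁ (h.le_zero hy)).symm.trans (gproj_eq_zero_of_mem_filt hΓ₁ one_pos hy_pos)
  rwa [hy_zero, add_zero]

theorem eq_inf_zero (hΓ₁ : DirectSum.IsInternal Γ₁) :
    m₀.toSubmodule = m₂.toSubmodule ⊓ Γ₁ 0 := by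
  refine le_antisymm (le_inf h.le₀ h.le_zero) ?_
  rintro z ⟨hz, hz_zero⟩
  obtain ⟨x, hx, y, hy, rfl⟩ := h.exists_add_eq hz
  have hx_zero : x ∈ Γ₁ 0 := (Submodule.add_mem_iff_left _ (h.le_zero hy)).1 hz_zero
  have hx_eq : x = 0 :=
    (gproj_same hΓ₁ hx_zero).symm.trans
      (gproj_eq_zero_of_mem_filt hΓ₁ one_pos (h.good₁.le_filt_one hx))
  rwa [hx_eq, zero_add]

theorem disjoint (hΓ₁ : DirectSum.IsInternal Γ₁) : Disjoint m₁.toSubmodule m₀.toSubmodule := by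
  refine Submodule.disjoint_def.2 fun x hx hx' => ?_
  exact (gproj_same hΓ₁ (h.le_zero hx')).symm.trans
      (gproj_eq_zero_of_mem_filt hΓ₁ one_pos (h.good₁.le_filt_one hx))

theorem form_apply_eq (hBinv : B.lieInvariant g) (hq₁ : IsGradingElement Γ₁ q₁) {x : g}
    (hx : x ∈ m₁) : B f₁ x = B f₂ x := by
  have hzero := form_eq_zero_of_mem_filt hBinv hq₁ (by omega) h.sub_mem (h.good₁.le_filt_one hx)
  rw [map_sub, LinearMap.sub_apply, sub_eq_zero] at hzero
  exact hzero.symm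

theorem isStageDatum (hBinv : B.lieInvariant g) (hq₁ : IsGradingElement Γ₁ q₁)
    (hq₂ : IsGradingElement Γ₂ q₂) (hΓ₁ : IsGoodGrading Γ₁ f₁) (hΓ₂ : IsGoodGrading Γ₂ f₂) :
    IsStageDatum (B f₁) (B f₂) m₁ m₀ where
  lie_mem x hx y hy := h.lie_mem x (h.le₀ hx) y hy
  character₁ x hx y hy := h.good₁.form_lie_eq_zero hBinv hq₁ hΓ₁ hx hy
  invariant x hx y hy := by
    rw [h.form_apply_eq hBinv hq₁ (h.lie_mem x (h.le₀ hx) y hy)]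
    exact h.good₂.form_lie_eq_zero hBinv hq₂ hΓ₂ (h.le₀ hx) (h.le₁ hy)
  character₂ x hx y hy := h.good₂.form_lie_eq_zero hBinv hq₂ hΓ₂ (h.le₀ hx) (h.le₀ hy)

theorem mem_zeroFibre_iff (hBinv : B.lieInvariant g) (hq₁ : IsGradingElement Γ₁ q₁)
    {ξ : Dual ℂ g} : ξ ∈ zeroFibre (B f₂) m₂ ↔
      ξ ∈ zeroFibre (B f₁) m₁ ∧ ξ ∈ zeroFibre (B f₂) m₀ := by
  simp only [mem_zeroFibre]
  refine ⟨fun hξ => ⟨fun x hx => (hξ x (h.le₁ hx)).trans (h.form_apply_eq hBinv hq₁ hx).symm,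
    fun x hx => hξ x (h.le₀ hx)⟩, fun ⟨hξ₁, hξ₀⟩ z hz => ?_⟩
  obtain ⟨x, hx, y, hy, rfl⟩ := h.exists_add_eq hz
  rw [map_add, map_add, hξ₁ x hx, hξ₀ y hy, h.form_apply_eq hBinv hq₁ hx]

variable [FiniteDimensional ℂ g]

theorem isHomogeneousSub₁ (hΓ₁ : DirectSum.IsInternal Γ₁) (hΓ₂ : DirectSum.IsInternal Γ₂)
    (hq₁ : IsGradingElement Γ₁ q₁) (hq₂ : IsGradingElement Γ₂ q₂) (hq : ⁅q₁, q₂⁆ = 0) :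
    IsHomogeneousSub hΓ₂ m₁.toSubmodule := by
  rw [h.eq_inf_filt hΓ₁]
  refine (h.good₂.isHomogeneousSub hΓ₂).inf hΓ₂
    (hq₂.isHomogeneousSub hΓ₂ fun x hx => ?_)
  have hmem := map_mem_filt (T := LieAlgebra.ad ℂ g q₂) (i := 0) (fun j y hy => by
    rw [zero_add]
    exact hq₁.lie_mem_of_lie_eq_zero hq hy) hx
  rwa [zero_add] at hmem

theorem isHomogeneousSub₀ (hΓ₁ : DirectSum.IsInternal Γ₁) (hΓ₂ : DirectSum.IsInternal Γ₂)
    (hq₁ : IsGradingElement Γ₁ q₁) (hq₂ : IsGradingElement Γ₂ q₂) (hq : ⁅q₁, q₂⁆ = 0) :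
    IsHomogeneousSub hΓ₂ m₀.toSubmodule := by
  rw [h.eq_inf_zero hΓ₁]
  exact (h.good₂.isHomogeneousSub hΓ₂).inf hΓ₂
    (hq₂.isHomogeneousSub hΓ₂ fun x hx => hq₁.lie_mem_of_lie_eq_zero hq hx)

variable [FiniteDimensional ℂ V]

theorem exists_isStageSlice (hΓ₁ : DirectSum.IsInternal Γ₁) (hΓ₂ : IsGoodGrading Γ₂ f₂)
    {C : Submodule ℂ g} (hC : IsGradedComplement hΓ₂.internal B f₂ m₂ C)
    (hB : B.Nondegenerate) (hBinv : B.lieInvariant g) (hq₁ : IsGradingElement Γ₁ q₁)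
    (hq₂ : IsGradingElement Γ₂ q₂) (hq : ⁅q₁, q₂⁆ = 0) (hM₁ : IsExponential M₁ m₁)
    (hM₀ : IsExponential M₀ m₀) :
    ∃ Y S, IsStageSlice G (B f₁) (B f₂) m₁ m₀ M₁ M₀ {ξ | ∃ s ∈ C, ξ = B (f₂ + s)} Y S := by
  obtain ⟨τ, hτ, hright, hleft⟩ := hC.exists_inverse_coadjointMap hΓ₂ h.good₂ hB hBinv hq₂
    h.sup_eq (h.disjoint hΓ₁) (h.isHomogeneousSub₁ hΓ₁ hΓ₂.internal hq₁ hq₂ hq)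
    (h.isHomogeneousSub₀ hΓ₁ hΓ₂.internal hq₁ hq₂ hq)
  have hparam (x : m₁) (y : m₀) (s : C) :
      G.coAd (hM₁.exp x) (G.coAd (hM₀.exp y) (B (f₂ + s))) =
        coadjointMap B f₂ m₁.toSubmodule m₀.toSubmodule C (x, y, s) := by
    rw [hM₁.coAd_exp, hM₀.coAd_exp, coadjointMap]
  refine ⟨fun ξ => hM₀.exp (τ ξ).2.1, fun ξ => B (f₂ + (τ ξ).2.2),
    { isMorphism_left := (isMorphism_expEquiv hM₀.unipotent hM₀.nilpotent).comp
        (hτ.linear (LinearMap.fst ℂ m₀.toSubmodule C ∘ₗ LinearMap.snd ℂ m₁.toSubmodule _))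
      isMorphism_right := hτ.form_add
      mem := fun ξ => ⟨_, (τ ξ).2.2.2, rfl⟩
      exists_coAd := fun ξ hξ₁ hξ₀ => ⟨hM₁.exp (τ ξ).1, (hparam _ _ _).trans
        (hright ξ ((h.mem_zeroFibre_iff hBinv hq₁).2 ⟨hξ₁, hξ₀⟩))⟩
      coAd_mem := ?_
      left_coAd := ?_
      right_coAd := ?_ }⟩
  all_goals
    rintro v u _ ⟨s, hs, rfl⟩
    obtain ⟨x, rfl⟩ := hM₁.exp.surjective v
    obtain ⟨y, rfl⟩ := hM₀.exp.surjective u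
    simp only [hparam x y ⟨s, hs⟩]
  · rw [← h.mem_zeroFibre_iff hBinv hq₁]
    exact hC.coadjointMap_mem_zeroFibre hΓ₂ h.good₂ hBinv hq₂ h.le₁ h.le₀ _
  · rw [hleft]
  · rw [hleft]

theorem exists_isStageSlice_slice (hΓ₁ : DirectSum.IsInternal Γ₁) (hΓ₂ : IsGoodGrading Γ₂ f₂)
    {e₂ h₂ : g} (ht : IsGradedTriple Γ₂ e₂ h₂ f₂) (hB : B.Nondegenerate)
    (hBinv : B.lieInvariant g) (hq₁ : IsGradingElement Γ₁ q₁) (hq₂ : IsGradingElement Γ₂ q₂)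
    (hq : ⁅q₁, q₂⁆ = 0) (hM₁ : IsExponential M₁ m₁) (hM₀ : IsExponential M₀ m₀) :
    ∃ Y S, IsStageSlice G (B f₁) (B f₂) m₁ m₀ M₁ M₀ (slice (B f₂) e₂) Y S := by
  rw [slice_form hB hBinv]
  exact h.exists_isStageSlice hΓ₁ hΓ₂ (ht.isGradedComplement hΓ₂ h.good₂ hB hBinv hq₂) hB hBinv
    hq₁ hq₂ hq hM₁ hM₀

end IsGoodPair

end GoodPair

end SlodowyStages

end

open SlodowyStages Module in
theorem theorem2p2_general
    {g : Type*} [LieRing g] [LieAlgebra ℂ g] [FiniteDimensional ℂ g]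
    {V : Type*} [AddCommGroup V] [Module ℂ V] [FiniteDimensional ℂ V]
    (G : ConnectedAlgebraicGroup g V)
    (B : LinearMap.BilinForm ℂ g) (hB : B.Nondegenerate) (hBinv : B.lieInvariant g)
    (f₁ f₂ : g) (Γ₁ Γ₂ : ℤ → Submodule ℂ g) (hΓ₁ : IsGoodGrading Γ₁ f₁) (hΓ₂ : IsGoodGrading Γ₂ f₂)
    (q₁ q₂ : g) (hq₁ : IsGradingElement Γ₁ q₁) (hq₂ : IsGradingElement Γ₂ q₂)
    (hq : ⁅q₁, q₂⁆ = 0)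
    (m₁ m₂ m₀ : LieSubalgebra ℂ g)
    (hm₁ : IsGoodAlgebra Γ₁ (B f₁) m₁) (hm₂ : IsGoodAlgebra Γ₂ (B f₂) m₂)
    (e₂ h₂ : g) (ht₂ : IsGradedTriple Γ₂ e₂ h₂ f₂)
    (hsum : m₁.toSubmodule ⊔ m₀.toSubmodule = m₂.toSubmodule)
    (hideal : ∀ x ∈ m₂, ∀ y ∈ m₁, ⁅x, y⁆ ∈ m₁)
    (hf₀ : f₂ - f₁ ∈ Γ₁ 0) (hm₀ : m₀.toSubmodule ≤ Γ₁ 0)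
    (M₁ M₀ : Subgroup G.carrier)
    (hM₁ : G.IsUnipotentSubgroup M₁ m₁) (hM₀ : G.IsUnipotentSubgroup M₀ m₀) :
    (∀ e₁ h₁ : g, IsGradedTriple Γ₁ e₁ h₁ f₁ →
      ∃ Ψ : slice (B f₁) e₁ ≃ Reduced G (B f₁) m₁ M₁,
        IsIsomorphism (regSub (polyFun (Dual ℂ g)) (slice (B f₁) e₁))
          (regReduced G (B f₁) m₁ M₁) Ψ ∧
        ∀ ξ : slice (B f₁) e₁, ∃ hξ : (ξ : Dual ℂ g) ∈ zeroFibre (B f₁) m₁,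
          Ψ ξ = cls G (B f₁) m₁ M₁ ⟨ξ, hξ⟩) ∧
    ∃ (_ : MulAction M₀ (Reduced G (B f₁) m₁ M₁))
      (μ₀ : Reduced G (B f₁) m₁ M₁ → Dual ℂ m₀)
      (P : PoissonBracket (regReduced G (B f₁) m₁ M₁)),
      (∀ (u : M₀) (ξ : zeroFibre (B f₁) m₁),
        ∃ hξ : G.coAd (u : G.carrier) (ξ : Dual ℂ g) ∈ zeroFibre (B f₁) m₁,
          u • cls G (B f₁) m₁ M₁ ξ = cls G (B f₁) m₁ M₁ ⟨_, hξ⟩) ∧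
      IsAlgebraicAction G (regReduced G (B f₁) m₁ M₁) M₀ ∧
      (∀ ξ : zeroFibre (B f₁) m₁,
        μ₀ (cls G (B f₁) m₁ M₁ ξ) = twistedRestriction (B f₂) m₀ (ξ : Dual ℂ g)) ∧
      IsReducedBracket G (B f₁) m₁ M₁ P ∧
      IsHamiltonian G (regReduced G (B f₁) m₁ M₁) P M₀ m₀ μ₀ ∧
      ∃ Φ₀ : M₀ × slice (B f₂) e₂ ≃ ↥(μ₀ ⁻¹' {0}),
        IsIsomorphism
          (regProd (G.regSubgroup M₀) (regSub (polyFun (Dual ℂ g)) (slice (B f₂) e₂)))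
          (regSub (regReduced G (B f₁) m₁ M₁) (μ₀ ⁻¹' {0})) Φ₀ ∧
        (∀ (u v : M₀) (ξ : slice (B f₂) e₂),
          (Φ₀ (u * v, ξ) : Reduced G (B f₁) m₁ M₁) = u • (Φ₀ (v, ξ)).val) ∧
        ∀ (u : M₀) (ξ : slice (B f₂) e₂), ∃ hξ : (ξ : Dual ℂ g) ∈ zeroFibre (B f₁) m₁,
          (Φ₀ (u, ξ)).val = u • cls G (B f₁) m₁ M₁ ⟨ξ, hξ⟩ := by
  have hP : IsGoodPair B Γ₁ Γ₂ f₁ f₂ m₁ m₂ m₀ := ⟨hm₁, hm₂, hsum, hideal, hf₀, hm₀⟩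
  have hE₁ : IsExponential M₁ m₁ := .of_le_filt hM₁ hq₁ hm₁.le_filt_one
  have hE₀ : IsExponential M₀ m₀ :=
    .of_le_filt hM₀ hq₂ (le_trans (b := m₂.toSubmodule) hP.le₀ hm₂.le_filt_one)
  have hD := hP.isStageDatum hBinv hq₁ hq₂ hΓ₁ hΓ₂
  have hR := hE₁.isPoissonReducible hD.character₁
  obtain ⟨C, hC⟩ := exists_isGradedComplement hΓ₁ hq₁ hBinv hm₁
  obtain ⟨_, hT₁⟩ := hC.exists_isSlice (G := G) hΓ₁ hq₁ hB hBinv hm₁ hE₁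
  obtain ⟨_, _, hT⟩ := hP.exists_isStageSlice_slice (G := G) hΓ₁.internal hΓ₂ ht₂ hB hBinv
    hq₁ hq₂ hq hE₁ hE₀
  refine ⟨fun e₁ h₁ ht₁ => ?_, hD.action hE₁ hE₀, hD.moment hE₁, hR.reducedBracket,
    fun u ξ => ⟨hD.coAd_mem hE₀ u ξ.2, rfl⟩, hD.isAlgebraicAction hE₁ hE₀ hT₁,
    hD.moment_cls hE₁, hR.isReducedBracket_reducedBracket,
    hD.isHamiltonian hE₁ hE₀ hR.isReducedBracket_reducedBracket,
    hT.equiv hD hE₁ hE₀ hT₁, hT.isIsomorphism_equiv hD hE₁ hE₀ hT₁,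
    hT.equiv_mul hD hE₁ hE₀ hT₁, fun u ξ => ⟨hT.mem_zeroFibre ξ ξ.2, rfl⟩⟩
  obtain ⟨_, hS⟩ := ht₁.exists_isSlice (G := G) hΓ₁ hq₁ hB hBinv hm₁ hE₁
  exact ⟨hS.equiv, hS.isIsomorphism_equiv, fun ξ => ⟨hS.mem_zeroFibre ξ ξ.2, rfl⟩⟩

open SlodowyStages Module in
theorem theorem2p2
    {g : Type*} [LieRing g] [LieAlgebra ℂ g] [FiniteDimensional ℂ g] [LieAlgebra.IsSimple ℂ g]
    -- a connected algebraic group with Lie algebra `g`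
    {V : Type*} [AddCommGroup V] [Module ℂ V] [FiniteDimensional ℂ V]
    (G : ConnectedAlgebraicGroup g V)
    -- the invariant form identifying `g` with its dual
    (B : LinearMap.BilinForm ℂ g) (hB : B.Nondegenerate) (hBsymm : B.IsSymm)
    (hBinv : B.lieInvariant g)
    -- two nilpotent elements with good gradings
    (f₁ f₂ : g) (hf₁ : IsNilpotent (LieAlgebra.ad ℂ g f₁)) (hf₂ : IsNilpotent (LieAlgebra.ad ℂ g f₂))
    (Γ₁ Γ₂ : ℤ → Submodule ℂ g) (hΓ₁ : IsGoodGrading Γ₁ f₁) (hΓ₂ : IsGoodGrading Γ₂ f₂)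
    (q₁ q₂ : g) (hq₁ : IsGradingElement Γ₁ q₁) (hq₂ : IsGradingElement Γ₂ q₂)
    (h : LieSubalgebra ℂ g) [h.IsCartanSubalgebra] (hq₁h : q₁ ∈ h) (hq₂h : q₂ ∈ h)
    -- the good algebras, and a graded triple for `f₂`
    (m₁ m₂ m₀ : LieSubalgebra ℂ g)
    (hm₁ : IsGoodAlgebra Γ₁ (B f₁) m₁) (hm₂ : IsGoodAlgebra Γ₂ (B f₂) m₂)
    (e₂ h₂ : g) (ht₂ : IsGradedTriple Γ₂ e₂ h₂ f₂)
    -- `m₂ = m₁ ⊕ m₀`, with `m₁` an ideal of `m₂` and `m₀` an `h`-stable subalgebra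
    (hsum : m₁.toSubmodule ⊔ m₀.toSubmodule = m₂.toSubmodule)
    (hdisj : Disjoint m₁.toSubmodule m₀.toSubmodule)
    (hideal : ∀ x ∈ m₂, ∀ y ∈ m₁, ⁅x, y⁆ ∈ m₁)
    (hstable : ∀ x ∈ h, ∀ y ∈ m₀, ⁅x, y⁆ ∈ m₀)
    -- `f₂ - f₁` and `m₀` lie in degree `0` of the first grading
    (hf₀ : f₂ - f₁ ∈ Γ₁ 0) (hm₀ : m₀.toSubmodule ≤ Γ₁ 0)
    -- `q₂ - q₁` commutes with `f₁`
    (hq₀ : ⁅q₂ - q₁, f₁⁆ = 0)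
    -- the connected unipotent subgroups with Lie algebras `m₁` and `m₀`
    (M₁ M₀ : Subgroup G.carrier)
    (hM₁ : G.IsUnipotentSubgroup M₁ m₁) (hM₀ : G.IsUnipotentSubgroup M₀ m₀) :
    -- the quotient is isomorphic to the slice of `f₁`
    (∀ e₁ h₁ : g, IsGradedTriple Γ₁ e₁ h₁ f₁ →
      ∃ Ψ : slice (B f₁) e₁ ≃ Reduced G (B f₁) m₁ M₁,
        IsIsomorphism (regSub (polyFun (Dual ℂ g)) (slice (B f₁) e₁))
          (regReduced G (B f₁) m₁ M₁) Ψ ∧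
        ∀ ξ : slice (B f₁) e₁, ∃ hξ : (ξ : Dual ℂ g) ∈ zeroFibre (B f₁) m₁,
          Ψ ξ = cls G (B f₁) m₁ M₁ ⟨ξ, hξ⟩) ∧
    ∃ (_ : MulAction M₀ (Reduced G (B f₁) m₁ M₁))
      (μ₀ : Reduced G (B f₁) m₁ M₁ → Dual ℂ m₀)
      (P : PoissonBracket (regReduced G (B f₁) m₁ M₁)),
      -- the action is the natural one, and is algebraic
      (∀ (u : M₀) (ξ : zeroFibre (B f₁) m₁),
        ∃ hξ : G.coAd (u : G.carrier) (ξ : Dual ℂ g) ∈ zeroFibre (B f₁) m₁,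
          u • cls G (B f₁) m₁ M₁ ξ = cls G (B f₁) m₁ M₁ ⟨_, hξ⟩) ∧
      IsAlgebraicAction G (regReduced G (B f₁) m₁ M₁) M₀ ∧
      -- the moment map is `[ξ] ↦ (ξ - χ₂)|_{m₀}`
      (∀ ξ : zeroFibre (B f₁) m₁,
        μ₀ (cls G (B f₁) m₁ M₁ ξ) = twistedRestriction (B f₂) m₀ (ξ : Dual ℂ g)) ∧
      -- for the reduced Poisson structure the action is Hamiltonian
      IsReducedBracket G (B f₁) m₁ M₁ P ∧
      IsHamiltonian G (regReduced G (B f₁) m₁ M₁) P M₀ m₀ μ₀ ∧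
      -- the equivariant isomorphism `M₀ × S₂ ≅ μ₀⁻¹(0)`, `(u, ξ) ↦ u • [ξ]`
      ∃ Φ₀ : M₀ × slice (B f₂) e₂ ≃ ↥(μ₀ ⁻¹' {0}),
        IsIsomorphism
          (regProd (G.regSubgroup M₀) (regSub (polyFun (Dual ℂ g)) (slice (B f₂) e₂)))
          (regSub (regReduced G (B f₁) m₁ M₁) (μ₀ ⁻¹' {0})) Φ₀ ∧
        (∀ (u v : M₀) (ξ : slice (B f₂) e₂),
          (Φ₀ (u * v, ξ) : Reduced G (B f₁) m₁ M₁) = u • (Φ₀ (v, ξ)).val) ∧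
        ∀ (u : M₀) (ξ : slice (B f₂) e₂), ∃ hξ : (ξ : Dual ℂ g) ∈ zeroFibre (B f₁) m₁,
          (Φ₀ (u, ξ)).val = u • cls G (B f₁) m₁ M₁ ⟨ξ, hξ⟩ :=
  theorem2p2_general G B hB hBinv f₁ f₂ Γ₁ Γ₂ hΓ₁ hΓ₂ q₁ q₂ hq₁ hq₂
    (hq₁.lie_eq_zero_of_mem hΓ₁.internal hq₁h hq₂h) m₁ m₂ m₀ hm₁ hm₂ e₂ h₂ ht₂ hsum hideal hf₀ hm₀
    M₁ M₀ hM₁ hM₀
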